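/- A tetrahedron grid is a set of points in $\mathbb{R}^3$ (the ball centers of a densest packing of unit-diameter balls) built in layers as follows. Let $p=(1,0,0)$, $q=(\frac12,\frac{\sqrt3}{2},0)$, $h=(0,0,\frac{\sqrt6}{3})$, and let $(c_z)_{z\in\mathbb{Z}}$ be any sequence in $\{0,1,2\}$ with $c_z\neq c_{z+1}$ for all $z$ (the sequence of layer arrangements); the grid consists of the points $xp+yq+\frac{c_z}{3}(p+q)+zh$ with $x,y,z\in\mathbb{Z}$. A weighted cannonball graph $G$ is given by a tetrahedron grid and nonnegative integer demands $d(v)$ at its points, finitely many of them positive: its vertices are the grid points of positive demand, and two vertices are adjacent if their Euclidean distance is one. The weighted clique number $\omega(G)$ is the maximum of $\sum_{v\in K}d(v)$ over the cliques $K$ of $G$ (and $0$ if $G$ has no vertices). A proper multicoloring of $G$ assigns to every vertex $v$ a finite set $f(v)$ of integers (colors) with $|f(v)|\ge d(v)$ such that $f(u)\cap f(v)=\emptyset$ for adjacent $u,v$; the number of colors it uses is $\left|\bigcup_v f(v)\right|$. Theorem 1. There are a polynomial-time algorithm and an absolute constant $C$ such that, for every weighted cannonball graph $G$ (over any tetrahedron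 grid), the algorithm outputs a proper multicoloring of $G$ that uses at most $\frac{11}{6}\omega(G)+C$ colors. The input is the list, in any order, of the vertices of $G$, each given by its integers $x,y,z$, the position $c_z$ of its layer, and its demand; running time is measured against the length of the input with all numbers written in binary, and the output describes each color set as a union of intervals of integers. -/

import Mathlib

/-! ## Tetrahedron grids

Unit triangular layers at heights `z · √6/3`.  Every layer occupies one of the three standard
positions (letters `0, 1, 2`) obtained by translating the triangular lattice by a multiple of
`(p + q) / 3`, and consecutive layers occupy different positions: these are exactly the ways to
put each layer into the holes of the previous one, with an independent choice for every layer. -/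

/-- The layer arrangement of a tetrahedron grid: the position of every layer, where each layer is
put on one of the two sets of holes of the layer below it. -/
structure LayerArrangement where
  letter : ℤ → Fin 3
  consecutive_ne : ∀ z, letter z ≠ letter (z + 1)

/-- Coordinates `(x, y, z)` of a grid point: `z` is its layer, `x` and `y` are its coordinates
inside the layer. -/
abbrev Site : Type := ℤ × ℤ × ℤ

noncomputable section

abbrev Space3 : Type := EuclideanSpace ℝ (Fin 3)

def vecP : Space3 := !₂[1, 0, 0]

def vecQ : Space3 := !₂[1 / 2, Real.sqrt 3 / 2, 0]

/-- The vertical step between consecutive layers. -/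
def vecH : Space3 := !₂[0, 0, Real.sqrt 6 / 3]

namespace LayerArrangement

/-- The center of the ball with coordinates `(x, y, z)`. -/
def position (A : LayerArrangement) (v : Site) : Space3 :=
  (v.1 : ℝ) • vecP + (v.2.1 : ℝ) • vecQ
    + (((A.letter v.2.2 : ℕ) : ℝ) / 3) • (vecP + vecQ) + (v.2.2 : ℝ) • vecH

/-- The tetrahedron grid: grid points at Euclidean distance one (touching balls) are adjacent. -/
def grid (A : LayerArrangement) : SimpleGraph Site where
  Adj u v := dist (A.position u) (A.position v) = 1
  symm := ⟨fun u v h => by rw [dist_comm]; exact h⟩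
  loopless := ⟨fun v h => by simp at h⟩

end LayerArrangement

/-! ## Weighted graphs and multicolorings -/

open Classical in
/-- The weighted clique number `ω`: the maximal total weight of a clique. -/
def weightedCliqueNumber {V : Type} [Fintype V] (G : SimpleGraph V) (d : V → ℕ) : ℕ :=
  ((Finset.univ : Finset (Finset V)).filter (fun K : Finset V => G.IsClique (K : Set V))).sup
    (fun K : Finset V => ∑ v ∈ K, d v)

/-- Every vertex receives at least `d v` colors; adjacent vertices receive disjoint sets. -/
def IsProperMulticoloring {V : Type} (G : SimpleGraph V) (d : V → ℕ) (f : V → Finset ℤ) : Prop :=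
  (∀ v, d v ≤ (f v).card) ∧ ∀ u v, G.Adj u v → Disjoint (f u) (f v)

/-- The number of different colors that a multicoloring uses. -/
def numColors {V : Type} [Fintype V] (f : V → Finset ℤ) : ℕ :=
  (Finset.univ.biUnion f).card

/-- The data of a weighted cannonball graph: a tetrahedron grid, and demands at its points of
which only finitely many are positive. -/
structure CannonballGraph where
  arrangement : LayerArrangement
  demand : Site →₀ ℕ

namespace CannonballGraph

/-- The vertices are the grid points of positive demand. -/
abbrev Vertex (G : CannonballGraph) : Type := {v : Site // v ∈ G.demand.support}

/-- The subgraph of the grid induced on the vertices. -/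
def graph (G : CannonballGraph) : SimpleGraph G.Vertex :=
  G.arrangement.grid.comap Subtype.val

def weight (G : CannonballGraph) (v : G.Vertex) : ℕ := G.demand v.1

def omega (G : CannonballGraph) : ℕ := weightedCliqueNumber G.graph G.weight

/-- The record of a vertex in the input: its coordinates, the position of its layer, its demand. -/
def record (G : CannonballGraph) (v : G.Vertex) : List ℤ :=
  [v.1.1, v.1.2.1, v.1.2.2, ((G.arrangement.letter v.1.2.2 : ℕ) : ℤ), (G.weight v : ℤ)]

/-- The input word list: the number of vertices, followed by their records, in the order `e`. -/
def encode (G : CannonballGraph) {n : ℕ} (e : Fin n ≃ G.Vertex) : List ℤ :=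
  (n : ℤ) :: (List.ofFn e).flatMap G.record

end CannonballGraph

end

/-- The number of bits of an input, with demands and coordinates in binary (one extra bit per
number for its sign, and one as a separator). -/
def inputSize (w : List ℤ) : ℕ := (w.map fun a => Nat.size a.natAbs + 2).sum

/-! ## Output format

Color sets are handed out as lists of intervals of integers, as listing the colors one by one takes
exponential time when the demands are written in binary. -/

/-- The instruction "vertex number `vertex` also gets all colors `c` with `lo ≤ c < hi`". -/
structure ColorInterval where
  vertex : ℕ
  lo : ℤ
  hi : ℤ

/-- All colors that a list of intervals assigns to vertex number `i`. -/
noncomputable def colorsAt (l : List ColorInterval) (i : ℕ) : Finset ℤ :=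
  l.foldr (fun t s => if t.vertex = i then Finset.Ico t.lo t.hi ∪ s else s) ∅

def encodeIntervals (l : List ColorInterval) : List ℤ :=
  l.flatMap fun t => [(t.vertex : ℤ), t.lo, t.hi]

/-! ## The machine model

A random access machine with integer registers and arrays, programmed in a structured language.
Every arithmetic operation and every memory access costs one unit of time.  There is no
multiplication, so one unit of time lengthens the longest number in the machine by at most one bit
(up to the constants that occur in the program), and polynomial time on this machine
is polynomial time on a Turing machine. -/

/-- `arr a i` reads cell `i` of array number `a`; `div` is integer division. -/
inductive RExpr : Type
  | lit (c : ℤ)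
  | reg (r : ℕ)
  | arr (a : ℕ) (i : RExpr)
  | add (e₁ e₂ : RExpr)
  | sub (e₁ e₂ : RExpr)
  | div (e₁ e₂ : RExpr)

/-- `out` appends a number to the output; `ite` and `loop` test whether their expression is
positive. -/
inductive RProg : Type
  | skip
  | set (r : ℕ) (e : RExpr)
  | store (a : ℕ) (i e : RExpr)
  | out (e : RExpr)
  | seq (P Q : RProg)
  | ite (e : RExpr) (P Q : RProg)
  | loop (e : RExpr) (P : RProg)

structure RState where
  reg : ℕ → ℤ
  arr : ℕ → ℤ → ℤ
  output : List ℤ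

/-- At the start the input is in array `0`, everything else is zero, and the output is empty. -/
def RState.init (w : List ℤ) : RState where
  reg _ := 0
  arr a i := if a = 0 ∧ 0 ≤ i then w.getD i.toNat 0 else 0
  output := []

namespace RExpr

def eval (s : RState) : RExpr → ℤ
  | lit c => c
  | reg r => s.reg r
  | arr a i => s.arr a (i.eval s)
  | add e₁ e₂ => e₁.eval s + e₂.eval s
  | sub e₁ e₂ => e₁.eval s - e₂.eval s
  | div e₁ e₂ => e₁.eval s / e₂.eval s

/-- The time it takes to evaluate an expression. -/
def cost : RExpr → ℕ
  | lit _ => 1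
  | reg _ => 1
  | arr _ i => i.cost + 1
  | add e₁ e₂ => e₁.cost + e₂.cost + 1
  | sub e₁ e₂ => e₁.cost + e₂.cost + 1
  | div e₁ e₂ => e₁.cost + e₂.cost + 1

end RExpr

/-- `RExec P s t s'`: program `P`, started in state `s`, halts in state `s'` after time `t`. -/
inductive RExec : RProg → RState → ℕ → RState → Prop
  | skip (s : RState) : RExec .skip s 1 s
  | set (s : RState) (r : ℕ) (e : RExpr) :
      RExec (.set r e) s (e.cost + 1)
        { s with reg := Function.update s.reg r (e.eval s) }
  | store (s : RState) (a : ℕ) (i e : RExpr) :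
      RExec (.store a i e) s (i.cost + e.cost + 1)
        { s with arr := Function.update s.arr a
                  (Function.update (s.arr a) (i.eval s) (e.eval s)) }
  | out (s : RState) (e : RExpr) :
      RExec (.out e) s (e.cost + 1) { s with output := s.output ++ [e.eval s] }
  | seq {P Q : RProg} {s s' s'' : RState} {t t' : ℕ} :
      RExec P s t s' → RExec Q s' t' s'' → RExec (.seq P Q) s (t + t' + 1) s''
  | ite_pos {e : RExpr} {P Q : RProg} {s s' : RState} {t : ℕ} :
      0 < e.eval s → RExec P s t s' → RExec (.ite e P Q) s (e.cost + t + 1) s'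
  | ite_neg {e : RExpr} {P Q : RProg} {s s' : RState} {t : ℕ} :
      ¬ 0 < e.eval s → RExec Q s t s' → RExec (.ite e P Q) s (e.cost + t + 1) s'
  | loop_done {e : RExpr} {P : RProg} {s : RState} :
      ¬ 0 < e.eval s → RExec (.loop e P) s (e.cost + 1) s
  | loop_step {e : RExpr} {P : RProg} {s s' s'' : RState} {t t' : ℕ} :
      0 < e.eval s → RExec P s t s' → RExec (.loop e P) s' t' s'' →
        RExec (.loop e P) s (e.cost + t + t' + 1) s''

/-- On input `w` the program halts within time `T` and its output is `o`. -/
def RProg.OutputsWithin (P : RProg) (w : List ℤ) (T : ℕ) (o : List ℤ) : Prop :=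
  ∃ (t : ℕ) (s : RState), t ≤ T ∧ RExec P (RState.init w) t s ∧ s.output = o

/-! ## Structured programs with loops over the vertices -/

namespace RState

/-! Let `W` be the largest weight of a clique with at most three vertices and `m = ⌈W/6⌉`. In the
coordinates `X = 3x + c_z`, `Y = 3y + c_z`, every vector between touching balls has an odd entry, so
the parities of `X` and `Y` split the grid into four independent classes. Each class owns a palette
of `2m` colors, and three extra palettes have `m` colors each: `11m` in all, where `W ≤ ω` gives
`11m ≤ 11(ω + 5)/6`.

A vertex of demand at most `2m` is served from the bottom of its own palette. Three mutually
adjacent heavy vertices (demand above `2m`) would weigh more than `6m ≥ W`, so the heavy vertices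
span a triangle-free graph. Given a proper coloring of that graph with 1, 2, 3, a heavy vertex of
color `e` fills its palette, then extra palette `e` from the bottom, `e + 1` from the top, `e + 2`
from the bottom, and finally the next class's palette from the top. Adjacent heavy demands sum to at
most `6m`, so both are below `4m`; the two vertices meet only in one extra palette, from opposite
ends, and fit. A vertex that borrows from the next class has demand above `5m`; its neighbors are
light and stay low in their palettes.

The core is the 3-coloring of triangle-free sets of grid points (`exists_reducible`). A vertex of
degree at most two can be removed and colored last. If all degrees are at least three, look at the
top layer. Three functionals with sum zero sort the possible neighbors of a top point into three
triangles, so triangle-freeness leaves exactly one neighbor per direction, and at most one lies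
below. At an extreme point `u` of the layer this produces a square `u v b' b` with `b`, `b'` in the
layer below (`TopLayer.row`). Give `u` the color of `b'`: then `v` sees only two colors and can be
removed, after which its whole component in the layer without `u` unravels. If that component
contains the third neighbor of `u`, only `b` is left next to `u`, and `b` touches `b'`, so the
shared color is legitimate. Otherwise `u` cuts the layer, and the argument recurses into a smaller
piece (`exists_square`).

The algorithm need not know this geometry: it tries all pairs `(u, b)` and runs the unraveling as a
cascade. Colors are then assigned in reverse order of elimination. All loops run over the vertices,
which makes the running time a polynomial in their number. -/

def setReg (s : RState) (r : ℕ) (v : ℤ) : RState :=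
  { s with reg := Function.update s.reg r v }

def setCell (s : RState) (a : ℕ) (i v : ℤ) : RState :=
  { s with arr := Function.update s.arr a (Function.update (s.arr a) i v) }

def emit (s : RState) (v : ℤ) : RState := { s with output := s.output ++ [v] }

@[simp] theorem setReg_reg (s : RState) (r : ℕ) (v : ℤ) (q : ℕ) :
    (s.setReg r v).reg q = if q = r then v else s.reg q := by
  simp [setReg, Function.update_apply]

@[simp] theorem setReg_arr (s : RState) (r : ℕ) (v : ℤ) : (s.setReg r v).arr = s.arr := rfl

@[simp] theorem setReg_output (s : RState) (r : ℕ) (v : ℤ) :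
    (s.setReg r v).output = s.output := rfl

@[simp] theorem setCell_reg (s : RState) (a : ℕ) (i v : ℤ) : (s.setCell a i v).reg = s.reg := rfl

@[simp] theorem setCell_arr (s : RState) (a : ℕ) (i v : ℤ) (b : ℕ) (j : ℤ) :
    (s.setCell a i v).arr b j = if b = a ∧ j = i then v else s.arr b j := by
  by_cases h : b = a
  · subst h; simp [setCell, Function.update_apply]
  · simp [setCell, h]

theorem setCell_arr_of_ne (s : RState) {a b : ℕ} (i v : ℤ) (h : b ≠ a) :
    (s.setCell a i v).arr b = s.arr b := by
  simp [setCell, h]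

@[simp] theorem setCell_output (s : RState) (a : ℕ) (i v : ℤ) :
    (s.setCell a i v).output = s.output := rfl

@[simp] theorem emit_reg (s : RState) (v : ℤ) : (s.emit v).reg = s.reg := rfl

@[simp] theorem emit_arr (s : RState) (v : ℤ) : (s.emit v).arr = s.arr := rfl

@[simp] theorem emit_output (s : RState) (v : ℤ) : (s.emit v).output = s.output ++ [v] := rfl

theorem setReg_self (s : RState) (r : ℕ) (v : ℤ) (h : s.reg r = v) : s.setReg r v = s := by
  subst h; simp [setReg]

end RState

attribute [simp] RExpr.eval

/-- Programs all of whose loops run a counter through `0, …, n - 1`, where register `0` holds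
`n`. -/
inductive SProg : Type
  | skip
  | set (r : ℕ) (e : RExpr)
  | store (a : ℕ) (i e : RExpr)
  | out (e : RExpr)
  | seq (P Q : SProg)
  | ite (e : RExpr) (P Q : SProg)
  | forN (r : ℕ) (P : SProg)

namespace SProg

def compile : SProg → RProg
  | skip => .skip
  | set r e => .set r e
  | store a i e => .store a i e
  | out e => .out e
  | seq P Q => .seq P.compile Q.compile
  | ite e P Q => .ite e P.compile Q.compile
  | forN r P => .seq (.set r (.lit 0))
      (.loop (.sub (.reg 0) (.reg r))
        (.seq P.compile (.set r (.add (.reg r) (.lit 1)))))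

/-- `iter f k s` applies `f 0`, …, `f (k - 1)` to `s` in this order. -/
def iter (f : ℕ → RState → RState) : ℕ → RState → RState
  | 0, s => s
  | k + 1, s => f k (iter f k s)

/-- Loops are bounded by `n`, so the meaning of a program is a total function. The final assignment
after a loop reproduces the value of the counter with which the compiled loop exits. -/
def run (n : ℕ) : SProg → RState → RState
  | skip, s => s
  | set r e, s => s.setReg r (e.eval s)
  | store a i e, s => s.setCell a (i.eval s) (e.eval s)
  | out e, s => s.emit (e.eval s)
  | seq P Q, s => Q.run n (P.run n s)
  | ite e P Q, s => if 0 < e.eval s then P.run n s else Q.run n s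
  | forN r P, s => (iter (fun i s' => P.run n (s'.setReg r i)) n s).setReg r n

/-- The registers that a program may change. -/
def regs : SProg → List ℕ
  | skip => []
  | set r _ => [r]
  | store _ _ _ => []
  | out _ => []
  | seq P Q => P.regs ++ Q.regs
  | ite _ P Q => P.regs ++ Q.regs
  | forN r P => r :: P.regs

/-- The arrays that a program may change. -/
def arrs : SProg → List ℕ
  | skip => []
  | set _ _ => []
  | store a _ _ => [a]
  | out _ => []
  | seq P Q => P.arrs ++ Q.arrs
  | ite _ P Q => P.arrs ++ Q.arrs
  | forN _ P => P.arrs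

def silent : SProg → Bool
  | out _ => false
  | seq P Q => P.silent && Q.silent
  | ite _ P Q => P.silent && Q.silent
  | forN _ P => P.silent
  | _ => true

/-- Neither the number of vertices nor the counter of a running loop is ever changed. -/
def wellFormed : SProg → Bool
  | set r _ => r != 0
  | seq P Q => P.wellFormed && Q.wellFormed
  | ite _ P Q => P.wellFormed && Q.wellFormed
  | forN r P => r != 0 && !P.regs.contains r && P.wellFormed
  | _ => true

/-- The 9 per iteration is 4 for the loop test, 4 for incrementing the counter and 1 for sequencing;
the 7 is 2 for clearing the counter, 4 for the last test and 1 for sequencing. A conditional is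
charged for both branches. -/
noncomputable def time : SProg → Polynomial ℕ
  | skip => 1
  | set _ e => Polynomial.C (e.cost + 1)
  | store _ i e => Polynomial.C (i.cost + e.cost + 1)
  | out e => Polynomial.C (e.cost + 1)
  | seq P Q => P.time + Q.time + 1
  | ite e P Q => Polynomial.C (e.cost + 1) + P.time + Q.time
  | forN _ P => Polynomial.X * (P.time + 9) + 7

/-- `s'` differs from `s` only where `P` may write. -/
structure Frame (P : SProg) (s s' : RState) : Prop where
  reg : ∀ r, r ∉ P.regs → s'.reg r = s.reg r
  arr : ∀ a, a ∉ P.arrs → s'.arr a = s.arr a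
  output : P.silent = true → s'.output = s.output

theorem Frame.refl (P : SProg) (s : RState) : Frame P s s := ⟨by simp, by simp, by simp⟩

/-- This turns every claim that a subprogram leaves some register or array alone into membership in
an explicit list, which can be decided. -/
theorem frame_run (n : ℕ) (P : SProg) (s : RState) : Frame P s (P.run n s) := by
  induction P generalizing s with
  | skip => exact Frame.refl _ _
  | set r e => exact ⟨fun q h => by simp [run, regs] at *; simp [h], by simp [run], by simp [run]⟩
  | store a i e =>
    refine ⟨by simp [run], fun b h => ?_, by simp [run]⟩
    exact RState.setCell_arr_of_ne _ _ _ (by simpa [arrs] using h)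
  | out e => exact ⟨by simp [run], by simp [run], by simp [silent]⟩
  | seq P Q ihP ihQ =>
    refine ⟨fun r h => ?_, fun a h => ?_, fun h => ?_⟩
    · simp only [regs, List.mem_append, not_or] at h
      exact ((ihQ _).reg r h.2).trans ((ihP s).reg r h.1)
    · simp only [arrs, List.mem_append, not_or] at h
      exact ((ihQ _).arr a h.2).trans ((ihP s).arr a h.1)
    · simp only [silent, Bool.and_eq_true] at h
      exact ((ihQ _).output h.2).trans ((ihP s).output h.1)
  | ite e P Q ihP ihQ =>
    simp only [run]
    refine ⟨fun r h => ?_, fun a h => ?_, fun h => ?_⟩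
    · simp only [regs, List.mem_append, not_or] at h
      split_ifs
      exacts [(ihP s).reg r h.1, (ihQ s).reg r h.2]
    · simp only [arrs, List.mem_append, not_or] at h
      split_ifs
      exacts [(ihP s).arr a h.1, (ihQ s).arr a h.2]
    · simp only [silent, Bool.and_eq_true] at h
      split_ifs
      exacts [(ihP s).output h.1, (ihQ s).output h.2]
  | forN r P ih =>
    have key : ∀ k, Frame (forN r P) s (iter (fun i s' => P.run n (s'.setReg r i)) k s) := by
      intro k
      induction k with
      | zero => exact Frame.refl _ _
      | succ k ihk =>
        refine ⟨fun q h => ?_, fun a h => ?_, fun h => ?_⟩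
        · have h' := h
          simp only [regs, List.mem_cons, not_or] at h'
          rw [← ihk.reg q h]
          exact ((ih _).reg q h'.2).trans (by simp [h'.1])
        · rw [← ihk.arr a h]
          exact (ih _).arr a h
        · rw [← ihk.output h]
          exact (ih _).output h
    refine ⟨fun q h => ?_, fun a h => (key n).arr a h, fun h => (key n).output h⟩
    have h' := h
    simp only [regs, List.mem_cons, not_or] at h'
    rw [← (key n).reg q h]
    simp [run, h'.1]

theorem frame_iter (n k : ℕ) (r : ℕ) (P : SProg) (s : RState) :
    Frame (forN r P) s (iter (fun i s' => P.run n (s'.setReg r i)) k s) := by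
  induction k with
  | zero => exact Frame.refl _ _
  | succ k ihk =>
    refine ⟨fun q h => ?_, fun a h => ?_, fun h => ?_⟩
    · have h' := h
      simp only [regs, List.mem_cons, not_or] at h'
      rw [← ihk.reg q h]
      exact ((frame_run n P _).reg q h'.2).trans (by simp [h'.1])
    · rw [← ihk.arr a h]
      exact (frame_run n P _).arr a h
    · rw [← ihk.output h]
      exact (frame_run n P _).output h

/-- The loop invariant rule. -/
theorem forN_rule {n r : ℕ} {P : SProg} {s : RState} (I : ℕ → RState → Prop) (h0 : I 0 s)
    (hs : ∀ i < n, ∀ s', Frame (forN r P) s s' → I i s' → I (i + 1) (P.run n (s'.setReg r i))) :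
    ∃ s', (forN r P).run n s = s'.setReg r n ∧ I n s' ∧ Frame (forN r P) s s' := by
  refine ⟨_, rfl, ?_, frame_iter n n r P s⟩
  have key : ∀ k ≤ n, I k (iter (fun i s' => P.run n (s'.setReg r i)) k s) := by
    intro k
    induction k with
    | zero => intro _; exact h0
    | succ k ih => intro hk; exact hs k hk _ (frame_iter n k r P s) (ih (by omega))
  exact key n le_rfl

/-- Induction on `k` extends an execution backwards: one that starts after `k + 1` iterations is
preceded by the iteration numbered `k`, so the execution that merely leaves the loop grows into the
full one. -/
theorem exec_loop {n : ℕ} {r : ℕ} {P : SProg} (hr : r ≠ 0) (hP : r ∉ P.regs) (h0 : 0 ∉ P.regs)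
    (ih : ∀ s : RState, s.reg 0 = n →
      ∃ t, t ≤ P.time.eval n ∧ RExec P.compile s t (P.run n s))
    (s : RState) (hn : s.reg 0 = n) (k : ℕ) (hk : k ≤ n) (t : ℕ) (s' : RState)
    (h : RExec (.loop (.sub (.reg 0) (.reg r))
        (.seq P.compile (.set r (.add (.reg r) (.lit 1)))))
      ((iter (fun i s' => P.run n (s'.setReg r i)) k s).setReg r k) t s') :
    ∃ t', t' ≤ k * (P.time.eval n + 9) + t ∧ RExec (.loop (.sub (.reg 0) (.reg r))
        (.seq P.compile (.set r (.add (.reg r) (.lit 1))))) (s.setReg r 0) t' s' := by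
  induction k generalizing t with
  | zero => exact ⟨t, by simp, by simpa [iter] using h⟩
  | succ k ihk =>
    set sk := (iter (fun i s' => P.run n (s'.setReg r i)) k s).setReg r k with hsk
    have hfr := frame_iter n k r P s
    have hsk0 : sk.reg 0 = n := by
      rw [hsk, RState.setReg_reg, if_neg (Ne.symm hr), hfr.reg 0, hn]
      simp only [regs, List.mem_cons, not_or]
      exact ⟨Ne.symm hr, h0⟩
    have hskr : sk.reg r = k := by rw [hsk]; simp
    obtain ⟨t1, ht1, hex⟩ := ih sk hsk0
    have hr1 : (P.run n sk).reg r = k := by rw [(frame_run n P sk).reg r hP, hskr]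
    have hset : RExec _ _ _ ((P.run n sk).setReg r
      ((RExpr.add (.reg r) (.lit 1)).eval (P.run n sk))) :=
      RExec.set (P.run n sk) r (.add (.reg r) (.lit 1))
    have hbody := RExec.seq hex hset
    have hpos : 0 < (RExpr.sub (.reg 0) (.reg r)).eval sk := by
      simp only [RExpr.eval, hsk0, hskr]; omega
    have heq : (P.run n sk).setReg r ((RExpr.add (.reg r) (.lit 1)).eval (P.run n sk))
        = (iter (fun i s' => P.run n (s'.setReg r i)) (k + 1) s).setReg r ((k + 1 : ℕ) : ℤ) := by
      simp only [RExpr.eval, hr1]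
      simp [iter, RState.setReg, hsk]
    rw [heq] at hbody
    obtain ⟨t', ht', hex'⟩ := ihk (by omega) _ (RExec.loop_step hpos hbody h)
    refine ⟨t', ht'.trans ?_, hex'⟩
    simp only [RExpr.cost]
    nlinarith

theorem mem_regs_zero {P : SProg} (h : P.wellFormed = true) : 0 ∉ P.regs := by
  induction P with
  | set r e =>
    simp only [wellFormed, bne_iff_ne] at h
    simpa [regs] using h.symm
  | seq P Q ihP ihQ =>
    simp only [wellFormed, Bool.and_eq_true] at h
    simp [regs, ihP h.1, ihQ h.2]
  | ite e P Q ihP ihQ =>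
    simp only [wellFormed, Bool.and_eq_true] at h
    simp [regs, ihP h.1, ihQ h.2]
  | forN r P ih =>
    simp only [wellFormed, Bool.and_eq_true, bne_iff_ne] at h
    simp [regs, ih h.2, Ne.symm h.1.1]
  | _ => simp [regs]

/-- Compiled programs compute what `run` says, in polynomial time. -/
theorem exec_compile {n : ℕ} {P : SProg} (hP : P.wellFormed = true) (s : RState)
    (hn : s.reg 0 = n) :
    ∃ t, t ≤ P.time.eval n ∧ RExec P.compile s t (P.run n s) := by
  induction P generalizing s with
  | skip => exact ⟨1, by simp [time], RExec.skip s⟩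
  | set r e => exact ⟨_, by simp [time], RExec.set s r e⟩
  | store a i e => exact ⟨_, by simp [time], RExec.store s a i e⟩
  | out e => exact ⟨_, by simp [time], RExec.out s e⟩
  | seq P Q ihP ihQ =>
    simp only [wellFormed, Bool.and_eq_true] at hP
    obtain ⟨t, ht, h⟩ := ihP hP.1 s hn
    obtain ⟨t', ht', h'⟩ := ihQ hP.2 (P.run n s)
      (by rw [(frame_run n P s).reg 0 (mem_regs_zero hP.1), hn])
    exact ⟨_, by simp [time]; omega, RExec.seq h h'⟩
  | ite e P Q ihP ihQ =>
    simp only [wellFormed, Bool.and_eq_true] at hP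
    by_cases he : 0 < e.eval s
    · obtain ⟨t, ht, h⟩ := ihP hP.1 s hn
      refine ⟨_, ?_, by simpa [run, he, compile] using RExec.ite_pos he h⟩
      simp [time]; omega
    · obtain ⟨t, ht, h⟩ := ihQ hP.2 s hn
      refine ⟨_, ?_, by simpa [run, he, compile] using RExec.ite_neg he h⟩
      simp [time]; omega
  | forN r P ih =>
    have h00 := mem_regs_zero hP
    simp only [wellFormed, Bool.and_eq_true, bne_iff_ne, Bool.not_eq_true',
      List.contains_eq_mem, decide_eq_false_iff_not] at hP
    obtain ⟨⟨hr, hrP⟩, hP'⟩ := hP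
    have hdone : RExec (.loop (.sub (.reg 0) (.reg r))
        (.seq P.compile (.set r (.add (.reg r) (.lit 1)))))
        ((forN r P).run n s) ((RExpr.sub (.reg 0) (.reg r)).cost + 1) ((forN r P).run n s) := by
      apply RExec.loop_done
      have h1 := (frame_run n (forN r P) s).reg 0 h00
      simp only [RExpr.eval, h1, hn]
      simp [run]
    obtain ⟨t', ht', h⟩ := exec_loop hr hrP (mem_regs_zero hP') (ih hP') s hn n le_rfl _ _ hdone
    refine ⟨_, ?_, RExec.seq (RExec.set s r (.lit 0)) h⟩
    simp only [RExpr.cost] at ht' ⊢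
    simp [time]
    omega

end SProg

namespace Cannonball

open scoped Classical

/-! ## Points of a tetrahedron grid in integer coordinates -/

/-- The squared length of a vector of the grid, times nine. -/
def normNine (a b c : ℤ) : ℤ := a ^ 2 + a * b + b ^ 2 + 6 * c ^ 2

/-- Completing the square bounds all entries, and a finite check remains. Both sets of holes appear
for each adjacent layer; the arrangement decides which one occurs. -/
theorem normNine_eq_nine {a b c : ℤ} (h : normNine a b c = 9) :
    (c = 0 ∧ (a = 3 ∧ b = 0 ∨ a = -3 ∧ b = 0 ∨ a = 0 ∧ b = 3 ∨ a = 0 ∧ b = -3 ∨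
      a = 3 ∧ b = -3 ∨ a = -3 ∧ b = 3)) ∨
    ((c = 1 ∨ c = -1) ∧ (a = 1 ∧ b = 1 ∨ a = -2 ∧ b = 1 ∨ a = 1 ∧ b = -2 ∨
      a = -1 ∧ b = -1 ∨ a = 2 ∧ b = -1 ∨ a = -1 ∧ b = 2)) := by
  unfold normNine at h
  have hc1 : c ≤ 1 := by nlinarith [sq_nonneg (2 * a + b), sq_nonneg b]
  have hc2 : -1 ≤ c := by nlinarith [sq_nonneg (2 * a + b), sq_nonneg b]
  have ha1 : a ≤ 3 := by nlinarith [sq_nonneg (2 * b + a), sq_nonneg c]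
  have ha2 : -3 ≤ a := by nlinarith [sq_nonneg (2 * b + a), sq_nonneg c]
  have hb1 : b ≤ 3 := by nlinarith [sq_nonneg (2 * a + b), sq_nonneg c]
  have hb2 : -3 ≤ b := by nlinarith [sq_nonneg (2 * a + b), sq_nonneg c]
  interval_cases c <;> interval_cases a <;> interval_cases b <;> simp_all

/-- The vectors from a point to its possible neighbors in its own layer and in the layer below,
where `σ = ± 1` tells on which holes the layer lies. -/
def IsStep (σ a b c : ℤ) : Prop :=
  (c = 0 ∧ (a = 3 ∧ b = 0 ∨ a = -3 ∧ b = 0 ∨ a = 0 ∧ b = 3 ∨ a = 0 ∧ b = -3 ∨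
      a = 3 ∧ b = -3 ∨ a = -3 ∧ b = 3)) ∨
  (c = -1 ∧ (a = σ ∧ b = σ ∨ a = -2 * σ ∧ b = σ ∨ a = σ ∧ b = -2 * σ))

/-- Three linear functionals with sum zero, each maximal on one of the holes. -/
def height (σ : ℤ) (k : Fin 3) (a b : ℤ) : ℤ :=
  σ * ![a + b, -a, -b] k

theorem height_sub (σ : ℤ) (k : Fin 3) (a b a' b' : ℤ) :
    height σ k (a - a') (b - b') = height σ k a b - height σ k a' b' := by
  fin_cases k <;> simp [height] <;> ring

/-- The three functionals have sum zero, so three inequalities in the same direction must be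
equalities. -/
theorem eq_of_height_le {σ a b a' b' : ℤ} (hσ : σ = 1 ∨ σ = -1)
    (h : ∀ k, height σ k a b ≤ height σ k a' b') : a = a' ∧ b = b' := by
  have h0 := h 0
  have h1 := h 1
  have h2 := h 2
  simp [height] at h0 h1 h2
  rcases hσ with rfl | rfl <;> omega

theorem IsStep.exists_height_pos {σ a b c : ℤ} (hσ : σ = 1 ∨ σ = -1) (h : IsStep σ a b c) :
    ∃ k, 0 < height σ k a b := by
  by_contra! hk
  obtain ⟨rfl, rfl⟩ := eq_of_height_le (a' := 0) (b' := 0) hσ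
    (fun k => (hk k).trans (by fin_cases k <;> simp [height]))
  unfold IsStep at h
  rcases hσ with rfl | rfl <;> omega

theorem IsStep.of_height_pos {σ a b c : ℤ} (hσ : σ = 1 ∨ σ = -1) (h : IsStep σ a b c)
    {k : Fin 3} (hk : 0 < height σ k a b) :
    k = 0 ∧ (a = 3 * σ ∧ b = 0 ∧ c = 0 ∨ a = 0 ∧ b = 3 * σ ∧ c = 0 ∨ a = σ ∧ b = σ ∧ c = -1) ∨
    k = 1 ∧ (a = -3 * σ ∧ b = 0 ∧ c = 0 ∨ a = -3 * σ ∧ b = 3 * σ ∧ c = 0 ∨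
      a = -2 * σ ∧ b = σ ∧ c = -1) ∨
    k = 2 ∧ (a = 0 ∧ b = -3 * σ ∧ c = 0 ∨ a = 3 * σ ∧ b = -3 * σ ∧ c = 0 ∨
      a = σ ∧ b = -2 * σ ∧ c = -1) := by
  unfold IsStep at h
  rcases hσ with rfl | rfl <;> fin_cases k <;> simp [height] at hk ⊢ <;> omega

/-- The steps that rise in a fixed direction are two in the layer and one hole, for `k = 0` the
vectors `(3σ,0,0)`, `(0,3σ,0)`, `(σ,σ,-1)`. Together with the origin they form a unit tetrahedron.
-/
theorem IsStep.eq_or_adj {σ a b c a' b' c' : ℤ} (hσ : σ = 1 ∨ σ = -1) (h : IsStep σ a b c)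
    (h' : IsStep σ a' b' c') {k : Fin 3} (hk : 0 < height σ k a b) (hk' : 0 < height σ k a' b') :
    (a = a' ∧ b = b' ∧ c = c') ∨ normNine (a - a') (b - b') (c - c') = 9 := by
  have h1 := h.of_height_pos hσ hk
  have h2 := h'.of_height_pos hσ hk'
  rcases h1 with ⟨rfl, h1⟩ | ⟨rfl, h1⟩ | ⟨rfl, h1⟩ <;> simp at h2 <;>
  rcases h1 with ⟨rfl, rfl, rfl⟩ | ⟨rfl, rfl, rfl⟩ | ⟨rfl, rfl, rfl⟩ <;>
  rcases h2 with ⟨rfl, rfl, rfl⟩ | ⟨rfl, rfl, rfl⟩ | ⟨rfl, rfl, rfl⟩ <;>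
  rcases hσ with rfl | rfl <;> simp [normNine]

/-- Each of the three holes is positive for exactly one functional. -/
theorem IsStep.below_eq {σ a b c a' b' c' : ℤ} (hσ : σ = 1 ∨ σ = -1) (h : IsStep σ a b c)
    (h' : IsStep σ a' b' c') (hc : c = -1) (hc' : c' = -1) {k : Fin 3}
    (hk : 0 < height σ k a b) (hk' : 0 < height σ k a' b') : a = a' ∧ b = b' := by
  have h1 := h.of_height_pos hσ hk
  have h2 := h'.of_height_pos hσ hk'
  rcases h1 with ⟨rfl, h1⟩ | ⟨rfl, h1⟩ | ⟨rfl, h1⟩ <;> simp at h2 <;> omega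

theorem IsStep.below_eq_or_adj {σ a b c a' b' c' : ℤ} (hσ : σ = 1 ∨ σ = -1) (h : IsStep σ a b c)
    (h' : IsStep σ a' b' c') (hc : c = -1) (hc' : c' = -1) :
    (a = a' ∧ b = b') ∨ normNine (a - a') (b - b') (c - c') = 9 := by
  subst hc hc'
  unfold IsStep at h h'
  simp at h h'
  rcases h with ⟨rfl, rfl⟩ | ⟨rfl, rfl⟩ | ⟨rfl, rfl⟩ <;>
  rcases h' with ⟨rfl, rfl⟩ | ⟨rfl, rfl⟩ | ⟨rfl, rfl⟩ <;>
  rcases hσ with rfl | rfl <;> simp [normNine]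

/-- Two neighbors in the layer that both go strictly down touch, if they lie on different sides
of the third functional. -/
theorem IsStep.level_of_not_adj {σ a b c a' b' c' : ℤ} (hσ : σ = 1 ∨ σ = -1)
    (h : IsStep σ a b c) (h' : IsStep σ a' b' c') (hc : c = 0) (hc' : c' = 0) {k : Fin 3}
    (hk : height σ k a b ≤ 0) (hk' : height σ k a' b' ≤ 0)
    (hne : ¬ (a = a' ∧ b = b')) (hadj : normNine (a - a') (b - b') (c - c') ≠ 9) :
    height σ k a b = 0 ∨ height σ k a' b' = 0 := by
  subst hc hc'
  by_contra! hcon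
  have hk1 := lt_of_le_of_ne hk hcon.1
  have hk2 := lt_of_le_of_ne hk' hcon.2
  clear hk hk' hcon
  unfold IsStep at h h'
  simp at h h'
  revert hne hadj
  rcases hσ with rfl | rfl <;> fin_cases k <;> simp [height] at hk1 hk2 <;>
  rcases h with ⟨rfl, rfl⟩ | ⟨rfl, rfl⟩ | ⟨rfl, rfl⟩ | ⟨rfl, rfl⟩ | ⟨rfl, rfl⟩ | ⟨rfl, rfl⟩ <;>
  simp at hk1 <;>
  rcases h' with ⟨rfl, rfl⟩ | ⟨rfl, rfl⟩ | ⟨rfl, rfl⟩ | ⟨rfl, rfl⟩ | ⟨rfl, rfl⟩ | ⟨rfl, rfl⟩ <;>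
  simp at hk2 <;> simp [normNine]

end Cannonball

/-! ### Squares at the top layer of a triangle-free set -/

namespace Cannonball

open scoped Classical

/-- Integer coordinates of points of a tetrahedron grid, scaled by three within the layers. -/
structure Layout where
  X : ℕ → ℤ
  Y : ℕ → ℤ
  Z : ℕ → ℤ

namespace Layout

def Adj (P : Layout) (i j : ℕ) : Prop :=
  normNine (P.X i - P.X j) (P.Y i - P.Y j) (P.Z i - P.Z j) = 9

theorem Adj.symm {P : Layout} {i j : ℕ} (h : P.Adj i j) : P.Adj j i := by
  unfold Adj normNine at *; linarith

theorem Adj.ne {P : Layout} {i j : ℕ} (h : P.Adj i j) : i ≠ j := by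
  rintro rfl; simp [Adj, normNine] at h

/-- The points indexed by `R` are different points of one tetrahedron grid. -/
structure Valid (P : Layout) (R : Finset ℕ) : Prop where
  layers : ∃ l : ℤ → ℤ, (∀ z, ¬ 3 ∣ l z - l (z + 1)) ∧
    ∀ i ∈ R, 3 ∣ P.X i - l (P.Z i) ∧ 3 ∣ P.Y i - l (P.Z i)
  inj : ∀ i ∈ R, ∀ j ∈ R, P.X i = P.X j → P.Y i = P.Y j → P.Z i = P.Z j → i = j

theorem Valid.mono {P : Layout} {R R' : Finset ℕ} (h : P.Valid R) (hR : R' ⊆ R) :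
    P.Valid R' := by
  obtain ⟨⟨l, hl, hl'⟩, h2⟩ := h
  exact ⟨⟨l, hl, fun i hi => hl' i (hR hi)⟩, fun i hi j hj => h2 i (hR hi) j (hR hj)⟩

end Layout

def TriangleFree (adj : ℕ → ℕ → Prop) (R : Finset ℕ) : Prop :=
  ∀ i ∈ R, ∀ j ∈ R, ∀ k ∈ R, adj i j → adj i k → ¬ adj j k

/-- If `u` and `b` get the same color, then one can remove all neighbors of `u` that are not
neighbors of `b`, one by one, each having at most two colors in its neighborhood. -/
def Reducible (adj : ℕ → ℕ → Prop) (R : Finset ℕ) (u b : ℕ) : Prop :=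
  ∀ S ⊆ R, u ∈ S → b ∈ S →
    (∀ w ∈ S, w ≠ u → w ≠ b →
      3 + (if adj w u ∧ adj w b then 1 else 0) ≤ (S.filter (adj w)).card) →
    ∀ x ∈ S, adj u x → adj b x

/-- The top layer of a triangle-free set of points of a tetrahedron grid with minimal degree
three. -/
structure TopLayer (P : Layout) (R T : Finset ℕ) (σ top : ℤ) : Prop where
  sign : σ = 1 ∨ σ = -1
  valid : P.Valid R
  triangleFree : TriangleFree P.Adj R
  degree : ∀ w ∈ R, 3 ≤ (R.filter (P.Adj w)).card
  mem : ∀ w, w ∈ T ↔ w ∈ R ∧ P.Z w = top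
  step : ∀ w ∈ T, ∀ j ∈ R, P.Adj w j →
    IsStep σ (P.X j - P.X w) (P.Y j - P.Y w) (P.Z j - P.Z w)

/-- Consecutive layers have positions that differ modulo three, so passing to the layer below
changes the position by `1` or `-1`; this is `σ`. No neighbor lies above a point of maximal `Z`. -/
theorem exists_topLayer {P : Layout} {R : Finset ℕ} (hne : R.Nonempty) (hv : P.Valid R)
    (ht : TriangleFree P.Adj R) (hd : ∀ w ∈ R, 3 ≤ (R.filter (P.Adj w)).card) :
    ∃ T σ top, TopLayer P R T σ top ∧ T.Nonempty := by
  obtain ⟨m, hm, hmax⟩ := R.exists_max_image P.Z hne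
  obtain ⟨l, hl, hl'⟩ := hv.layers
  obtain ⟨σ, hσ, hσl⟩ : ∃ σ : ℤ, (σ = 1 ∨ σ = -1) ∧ 3 ∣ l (P.Z m - 1) - l (P.Z m) - σ := by
    have := hl (P.Z m - 1)
    rw [sub_add_cancel] at this
    by_cases h : 3 ∣ l (P.Z m - 1) - l (P.Z m) - 1
    · exact ⟨1, by simp, h⟩
    · exact ⟨-1, by simp, by omega⟩
  refine ⟨R.filter (fun w => P.Z w = P.Z m), σ, P.Z m,
    ⟨hσ, hv, ht, hd, by simp, ?_⟩, ⟨m, by simp [hm]⟩⟩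
  intro w hw j hj hadj
  simp only [Finset.mem_filter] at hw
  have hc := normNine_eq_nine hadj.symm
  have hj1 := hmax j hj
  have hlw := hl' w hw.1
  have hlj := hl' j hj
  rw [hw.2] at hlw
  unfold IsStep
  rcases hc with hc | ⟨hc | hc, hab⟩
  · exact Or.inl hc
  · omega
  · right
    refine ⟨hc, ?_⟩
    have hz : P.Z j = P.Z m - 1 := by omega
    rw [hz] at hlj
    rcases hσ with rfl | rfl <;> omega

namespace TopLayer

variable {P : Layout} {R T : Finset ℕ} {σ top : ℤ}

/-- The height of a point in direction `k`. -/
def ht (P : Layout) (σ : ℤ) (k : Fin 3) (i : ℕ) : ℤ := height σ k (P.X i) (P.Y i)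

/-- Two different neighbors that rise in the same direction would touch each other and form a
triangle with `w`. -/
theorem eq_of_ht_lt (h : TopLayer P R T σ top) {w i j : ℕ} (hw : w ∈ T) (hi : i ∈ R)
    (hj : j ∈ R) (hwi : P.Adj w i) (hwj : P.Adj w j) {k : Fin 3} (hki : ht P σ k w < ht P σ k i)
    (hkj : ht P σ k w < ht P σ k j) : i = j := by
  have hwR := ((h.mem w).1 hw).1
  rcases (h.step w hw i hi hwi).eq_or_adj h.sign (h.step w hw j hj hwj) (k := k)
    (by rw [height_sub]; unfold ht at *; linarith) (by rw [height_sub]; unfold ht at *; linarith)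
    with h1 | h1
  · exact h.valid.inj i hi j hj (by omega) (by omega) (by omega)
  · refine absurd ?_ (h.triangleFree w hwR i hi j hj hwi hwj)
    unfold Layout.Adj
    rw [← h1]; congr 1 <;> ring

theorem exists_ht_lt (h : TopLayer P R T σ top) {w i : ℕ} (hw : w ∈ T) (hi : i ∈ R)
    (hwi : P.Adj w i) : ∃ k, ht P σ k w < ht P σ k i := by
  obtain ⟨k, hk⟩ := (h.step w hw i hi hwi).exists_height_pos h.sign
  rw [height_sub] at hk
  exact ⟨k, by unfold ht; linarith⟩

/-- Choosing for each neighbor a direction in which it rises is injective by `eq_of_ht_lt`. With at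
least three neighbors and three directions it is a bijection. -/
theorem exists_side (h : TopLayer P R T σ top) {w : ℕ} (hw : w ∈ T) :
    (R.filter (P.Adj w)).card = 3 ∧
      ∀ k, ∃ i ∈ R, P.Adj w i ∧ ht P σ k w < ht P σ k i := by
  have hwR := ((h.mem w).1 hw).1
  have hex : ∀ i ∈ R.filter (P.Adj w), ∃ k, ht P σ k w < ht P σ k i := fun i hi => by
    simp only [Finset.mem_filter] at hi
    exact h.exists_ht_lt hw hi.1 hi.2
  choose! g hg using hex
  have hinj : Set.InjOn g (R.filter (P.Adj w) : Finset ℕ) := by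
    intro i hi j hj hij
    have h1 := hg i hi
    have h2 := hg j hj
    rw [← hij] at h2
    simp only [Finset.coe_filter, Set.mem_ofPred_eq] at hi hj
    exact h.eq_of_ht_lt hw hi.1 hj.1 hi.2 hj.2 h1 h2
  have hcard := Finset.card_image_of_injOn hinj
  have hle : ((R.filter (P.Adj w)).image g).card ≤ 3 := Finset.card_le_univ _
  have hge := h.degree w hwR
  have hun : (R.filter (P.Adj w)).image g = Finset.univ :=
    Finset.eq_univ_of_card _ (by simp; omega)
  refine ⟨by omega, fun k => ?_⟩
  have hk : k ∈ (R.filter (P.Adj w)).image g := by rw [hun]; simp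
  obtain ⟨i, hi, rfl⟩ := Finset.mem_image.1 hk
  have h1 := hg i hi
  simp only [Finset.mem_filter] at hi
  exact ⟨i, hi.1, hi.2, h1⟩

/-- The three holes under a point touch each other, so two neighbors below would close a triangle.
-/
theorem below_unique (h : TopLayer P R T σ top) {w i j : ℕ} (hw : w ∈ T) (hi : i ∈ R)
    (hj : j ∈ R) (hwi : P.Adj w i) (hwj : P.Adj w j) (hiT : i ∉ T) (hjT : j ∉ T) : i = j := by
  have hw' := (h.mem w).1 hw
  have hsi := h.step w hw i hi hwi
  have hsj := h.step w hw j hj hwj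
  have hzi : P.Z i - P.Z w = -1 := by
    have : P.Z i ≠ top := fun hh => hiT ((h.mem i).2 ⟨hi, hh⟩)
    unfold IsStep at hsi; omega
  have hzj : P.Z j - P.Z w = -1 := by
    have : P.Z j ≠ top := fun hh => hjT ((h.mem j).2 ⟨hj, hh⟩)
    unfold IsStep at hsj; omega
  rcases hsi.below_eq_or_adj h.sign hsj hzi hzj with h1 | h1
  · exact h.valid.inj i hi j hj (by omega) (by omega) (by omega)
  · refine absurd ?_ (h.triangleFree w hw'.1 i hi j hj hwi hwj)
    unfold Layout.Adj
    rw [← h1]; congr 1 <;> ring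

/-- A point that is maximal among its neighbors in the layer in direction `k` has a neighbor on
the hole in direction `k` and two neighbors in the layer, one of them at the same height. -/
theorem row (h : TopLayer P R T σ top) {w : ℕ} (hw : w ∈ T) (k : Fin 3)
    (hmax : ∀ j ∈ T, P.Adj w j → ht P σ k j ≤ ht P σ k w) :
    ∃ b v c, b ∈ R ∧ b ∉ T ∧ P.Adj w b ∧ ht P σ k w < ht P σ k b ∧
      v ∈ T ∧ P.Adj w v ∧ ht P σ k v = ht P σ k w ∧ c ∈ T ∧ P.Adj w c ∧
      ∀ j ∈ R, P.Adj w j → j = b ∨ j = v ∨ j = c := by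
  have hw' := (h.mem w).1 hw
  obtain ⟨hcard, hside⟩ := h.exists_side hw
  obtain ⟨b, hb, hwb, hkb⟩ := hside k
  have hbT : b ∉ T := fun hbT => by linarith [hmax b hbT hwb]
  obtain ⟨x, y, hxy, hN⟩ : ∃ x y, x ≠ y ∧ (R.filter (P.Adj w)).erase b = {x, y} := by
    apply Finset.card_eq_two.1
    rw [Finset.card_erase_of_mem (by simp [hb, hwb]), hcard]
  have hmem : ∀ j, (j = x ∨ j = y) ↔ (j ≠ b ∧ j ∈ R ∧ P.Adj w j) := by
    intro j
    have := congrArg (fun s => j ∈ s) hN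
    simpa [and_assoc, eq_iff_iff, iff_comm] using this
  have hx := (hmem x).1 (Or.inl rfl)
  have hy := (hmem y).1 (Or.inr rfl)
  have hxT : x ∈ T := by
    by_contra hxT
    exact hx.1 (h.below_unique hw hx.2.1 hb hx.2.2 hwb hxT hbT)
  have hyT : y ∈ T := by
    by_contra hyT
    exact hy.1 (h.below_unique hw hy.2.1 hb hy.2.2 hwb hyT hbT)
  have hxZ := (h.mem x).1 hxT
  have hyZ := (h.mem y).1 hyT
  -- The two remaining neighbors do not touch, hence they cannot both be strictly lower than `w` in
  -- direction `k`.
  have hlevel := (h.step w hw x hx.2.1 hx.2.2).level_of_not_adj h.sign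
    (h.step w hw y hy.2.1 hy.2.2) (by omega) (by omega) (k := k)
    (by have := hmax x hxT hx.2.2; rw [height_sub]; unfold ht at this; linarith)
    (by have := hmax y hyT hy.2.2; rw [height_sub]; unfold ht at this; linarith)
    (fun hh => hxy (h.valid.inj x hx.2.1 y hy.2.1 (by omega) (by omega) (by omega)))
    (fun hh => by
      refine absurd ?_ (h.triangleFree w hw'.1 x hx.2.1 y hy.2.1 hx.2.2 hy.2.2)
      unfold Layout.Adj
      rw [← hh]; congr 1 <;> ring)
  rw [height_sub, height_sub] at hlevel
  rcases hlevel with hl | hl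
  · refine ⟨b, x, y, hb, hbT, hwb, hkb, hxT, hx.2.2, by unfold ht; linarith, hyT, hy.2.2, ?_⟩
    intro j hj hwj
    by_cases hjb : j = b
    · exact Or.inl hjb
    · exact Or.inr ((hmem j).2 ⟨hjb, hj, hwj⟩)
  · refine ⟨b, y, x, hb, hbT, hwb, hkb, hyT, hy.2.2, by unfold ht; linarith, hxT, hx.2.2, ?_⟩
    intro j hj hwj
    by_cases hjb : j = b
    · exact Or.inl hjb
    · exact Or.inr ((hmem j).2 ⟨hjb, hj, hwj⟩).symm

/-- Adjacency in the layer away from the point `u`. -/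
def Link (P : Layout) (T : Finset ℕ) (u x y : ℕ) : Prop :=
  P.Adj x y ∧ x ∈ T ∧ x ≠ u ∧ y ∈ T ∧ y ≠ u

def Reach (P : Layout) (T : Finset ℕ) (u : ℕ) : ℕ → ℕ → Prop :=
  Relation.ReflTransGen (Link P T u)

theorem Reach.symm {u x y : ℕ} (h : Reach P T u x y) : Reach P T u y x := by
  have : Std.Symm (Link P T u) := ⟨fun a b hab =>
    ⟨hab.1.symm, hab.2.2.2.1, hab.2.2.2.2, hab.2.1, hab.2.2.1⟩⟩
  exact Std.Symm.symm (r := Relation.ReflTransGen (Link P T u)) _ _ h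

/-- The pair of opposite corners of a square, two corners of which lie in the top layer. -/
structure Square (P : Layout) (R T : Finset ℕ) (u v c b b' : ℕ) : Prop where
  u_mem : u ∈ T
  v_mem : v ∈ T
  b_mem : b ∈ R
  b'_mem : b' ∈ R
  b'_not_mem : b' ∉ T
  adj_v : P.Adj u v
  adj_vb' : P.Adj v b'
  adj_bb' : P.Adj b b'
  nbr : ∀ j ∈ R, P.Adj u j → j = b ∨ j = v ∨ j = c
  reach : Reach P T u v c

/-- A set of points of the layer, connected to the rest of the layer at most through the edge
`a u`, contains such a square. -/
theorem exists_square (h : TopLayer P R T σ top) (N : ℕ) (D : Finset ℕ) (a u : ℕ)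
    (hN : D.card ≤ N) (hD : D.Nonempty) (hDT : D ⊆ T)
    (hcl : ∀ x ∈ D, ∀ y ∈ T, P.Adj x y → y ∈ D ∨ (x = a ∧ y = u)) :
    ∃ u v c b b', Square P R T u v c b b' := by
  induction N generalizing D a u with
  | zero => exact absurd (Finset.card_pos.2 hD) (by omega)
  | succ N ih =>
    -- Some direction has its maximum over `D` strictly above `a`. Otherwise `a` is maximal in all
    -- three directions, which forces `D = {a}`; then all neighbors of `a` other than `u`, at least
    -- two, lie below, against `below_unique`.
    have hk : ∃ k, ∃ w ∈ D, (∀ x ∈ D, ht P σ k x ≤ ht P σ k w) ∧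
        (a ∈ D → ht P σ k a < ht P σ k w) := by
      by_contra! hcon
      have hall : ∀ k, a ∈ D ∧ ∀ x ∈ D, ht P σ k x ≤ ht P σ k a := by
        intro k
        obtain ⟨w, hw, hwmax⟩ := D.exists_max_image (ht P σ k) hD
        obtain ⟨haD, hle⟩ := hcon k w hw hwmax
        exact ⟨haD, fun x hx => (hwmax x hx).trans hle⟩
      have haD := (hall 0).1
      have haT := (h.mem a).1 (hDT haD)
      have hsing : ∀ x ∈ D, x = a := by
        intro x hx
        have hxT := (h.mem x).1 (hDT hx)
        obtain ⟨h1, h2⟩ := eq_of_height_le h.sign (fun k => (hall k).2 x hx)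
        exact h.valid.inj x hxT.1 a haT.1 h1 h2 (by omega)
      obtain ⟨hcard, -⟩ := h.exists_side (hDT haD)
      obtain ⟨x, hx, y, hy, hxy⟩ := Finset.one_lt_card.1
        (show 1 < ((R.filter (P.Adj a)).erase u).card by
          have := Finset.pred_card_le_card_erase (s := R.filter (P.Adj a)) (a := u); omega)
      simp only [Finset.mem_erase, Finset.mem_filter] at hx hy
      have hout : ∀ y, y ≠ u → P.Adj a y → y ∉ T := by
        intro y hyu hay hyT
        rcases hcl a haD y hyT hay with h1 | h1
        · exact hay.ne (hsing y h1).symm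
        · exact hyu h1.2
      exact hxy (h.below_unique (hDT haD) hx.2.1 hy.2.1 hx.2.2 hy.2.2
        (hout x hx.1 hx.2.2) (hout y hy.1 hy.2.2))
    obtain ⟨k, w, hw, hwmax, hwa⟩ := hk
    -- The only exit from `D` is at `a`, which is strictly lower, so points at maximal height keep
    -- all their neighbors in the layer inside `D`.
    have hin : ∀ x ∈ D, ht P σ k x = ht P σ k w → ∀ y ∈ T, P.Adj x y → y ∈ D := by
      intro x hx hxw y hy hxy
      rcases hcl x hx y hy hxy with h1 | ⟨rfl, -⟩
      · exact h1
      · exact absurd (hwa hx) (by omega)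
    obtain ⟨b, v, c, hb, hbT, hwb, hkb, hv, hwv, hkv, hc, hwc, hnbr⟩ :=
      h.row (hDT hw) k (fun j hj hwj => hwmax j (hin w hw rfl j hj hwj))
    have hvD := hin w hw rfl v hv hwv
    have hcD := hin w hw rfl c hc hwc
    obtain ⟨b', -, -, hb', hbT', hvb', hkb', -⟩ :=
      h.row hv k (fun j hj hvj => hkv ▸ hwmax j (hin v hvD hkv j hj hvj))
    have hbb' : P.Adj b b' := by
      have hw' := (h.mem w).1 (hDT hw)
      have hv' := (h.mem v).1 hv
      have h1 := h.step w (hDT hw) b hb hwb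
      have h2 := h.step v hv b' hb' hvb'
      have hz1 : P.Z b - P.Z w = -1 := by
        have : P.Z b ≠ top := fun hh => hbT ((h.mem b).2 ⟨hb, hh⟩)
        unfold IsStep at h1; omega
      have hz2 : P.Z b' - P.Z v = -1 := by
        have : P.Z b' ≠ top := fun hh => hbT' ((h.mem b').2 ⟨hb', hh⟩)
        unfold IsStep at h2; omega
      -- Both points sit in the hole of direction `k`, so `b - w = b' - v`, and `b b'` is a
      -- translate of the edge `w v`.
      obtain ⟨h3, h4⟩ := h1.below_eq h.sign h2 hz1 hz2 (k := k)
        (by rw [height_sub]; unfold ht at hkb; linarith)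
        (by rw [height_sub]; unfold ht at hkb'; linarith)
      have : P.Adj w v := hwv
      unfold Layout.Adj at this ⊢
      rw [← this]; congr 1 <;> omega
    by_cases hreach : Reach P T w v c
    · exact ⟨w, v, c, b, b', hDT hw, hv, hb, hb', hbT', hwv, hvb', hbb', hnbr, hreach⟩
    -- A component of the layer without `w` that avoids `a` stays inside `D`. If it contains only
    -- one of the two layer neighbors of `w`, the edge from that neighbor to `w` is its only exit,
    -- and it is smaller than `D` because `w` is missing.
    have hpiece : ∀ p q, p ∈ T → P.Adj w p → p ∈ D → (∀ j ∈ R, P.Adj w j → j ∈ T → j = p ∨ j = q) →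
        ¬ Reach P T w p q → ¬ Reach P T w p a → ∃ u v c b b', Square P R T u v c b b' := by
      intro p q hp hwp hpD hpq hnq hna
      refine ih (D.filter (Reach P T w p)) p w ?_ ⟨p, Finset.mem_filter.2
        ⟨hpD, Relation.ReflTransGen.refl⟩⟩ ((Finset.filter_subset _ _).trans hDT) ?_
      · have : D.filter (Reach P T w p) ⊂ D := by
          refine Finset.filter_ssubset.2 ⟨w, hw, fun hr => ?_⟩
          rcases Relation.ReflTransGen.cases_tail hr with h1 | ⟨_, _, h1⟩
          · exact hwp.ne h1
          · exact h1.2.2.2.2 rfl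
        have := Finset.card_lt_card this
        omega
      · intro x hx y hy hxy
        simp only [Finset.mem_filter] at hx ⊢
        have hxT := hDT hx.1
        have hxw : x ≠ w := by
          rintro rfl
          rcases Relation.ReflTransGen.cases_tail hx.2 with h1 | ⟨_, _, h1⟩
          · exact hwp.ne h1
          · exact h1.2.2.2.2 rfl
        by_cases hyw : y = w
        · right
          refine ⟨?_, hyw⟩
          subst hyw
          rcases hpq x ((h.mem x).1 hxT).1 hxy.symm hxT with h1 | h1
          · exact h1
          · exact absurd (h1 ▸ hx.2) hnq
        · left
          have hyD : y ∈ D := by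
            rcases hcl x hx.1 y hy hxy with h1 | h1
            · exact h1
            · exact absurd (h1.1 ▸ hx.2) hna
          exact ⟨hyD, hx.2.tail ⟨hxy, hxT, hxw, hy, hyw⟩⟩
    -- At most one of the components of `v` and `c` contains `a`; the recursion enters the other
    -- one.
    by_cases hra : Reach P T w v a
    · refine hpiece c v hc hwc hcD (fun j hj hwj hjT => ?_) (fun hh => hreach hh.symm)
        (fun hh => hreach (hra.trans hh.symm))
      rcases hnbr j hj hwj with rfl | rfl | rfl
      · exact absurd hjT hbT
      · exact Or.inr rfl
      · exact Or.inl rfl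
    · refine hpiece v c hv hwv hvD (fun j hj hwj hjT => ?_) hreach hra
      rcases hnbr j hj hwj with rfl | rfl | rfl
      · exact absurd hjT hbT
      · exact Or.inl rfl
      · exact Or.inr rfl

/-- All top points have degree three. In a set `S` where the cascade has stopped, `v` cannot
survive, since it touches both `u` and `b'` and would need four neighbors. Along a path from `v` in
the layer, each next point has lost a neighbor and cannot survive either. So `c` is gone, and of the
neighbors of `u` only `b` can remain. -/
theorem Square.reducible (h : TopLayer P R T σ top) {u v c b b' : ℕ}
    (hs : Square P R T u v c b b') : Reducible P.Adj R u b' := by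
  intro S hS _ _ hdeg
  have hTR : T ⊆ R := fun x hx => ((h.mem x).1 hx).1
  have hcard : ∀ w ∈ T, (S.filter (P.Adj w)).card ≤ 3 := fun w hw =>
    (Finset.card_le_card (Finset.filter_subset_filter _ hS)).trans (h.exists_side hw).1.le
  have hvS : v ∉ S := by
    intro hvS
    have h1 := hdeg v hvS hs.adj_v.ne.symm (fun hh => hs.b'_not_mem (hh ▸ hs.v_mem))
    rw [if_pos ⟨hs.adj_v.symm, hs.adj_vb'⟩] at h1
    have := hcard v hs.v_mem
    omega
  have hreach : ∀ x, Reach P T u v x → x ∉ S := by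
    intro x hx
    induction hx with
    | refl => exact hvS
    | @tail y z _ hyz ihy =>
      intro hzS
      have h1 := hdeg z hzS hyz.2.2.2.2 (fun hh => hs.b'_not_mem (hh ▸ hyz.2.2.2.1))
      have hlt : (S.filter (P.Adj z)).card < (R.filter (P.Adj z)).card := by
        apply Finset.card_lt_card
        refine (Finset.ssubset_iff_of_subset (Finset.filter_subset_filter _ hS)).2
          ⟨y, ?_, ?_⟩
        · simp [hTR hyz.2.1, hyz.1.symm]
        · simp [ihy]
      rw [(h.exists_side hyz.2.2.2.1).1] at hlt
      omega
  intro x hxS hux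
  rcases hs.nbr x (hS hxS) hux with rfl | rfl | rfl
  · exact hs.adj_bb'.symm
  · exact absurd hxS hvS
  · exact absurd hxS (hreach _ hs.reach)

end TopLayer

theorem exists_reducible {P : Layout} {R : Finset ℕ} (hne : R.Nonempty) (hv : P.Valid R)
    (ht : TriangleFree P.Adj R) (hd : ∀ w ∈ R, 3 ≤ (R.filter (P.Adj w)).card) :
    ∃ u ∈ R, ∃ b ∈ R, u ≠ b ∧ ¬ P.Adj u b ∧ Reducible P.Adj R u b := by
  obtain ⟨T, σ, top, h, hT⟩ := exists_topLayer hne hv ht hd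
  obtain ⟨u, v, c, b, b', hs⟩ := h.exists_square T.card T 0 0 le_rfl hT subset_rfl
    (fun x _ y hy _ => Or.inl hy)
  have huR := ((h.mem u).1 hs.u_mem).1
  have hvR := ((h.mem v).1 hs.v_mem).1
  exact ⟨u, huR, b', hs.b'_mem, fun hh => hs.b'_not_mem (hh ▸ hs.u_mem),
    fun hh => h.triangleFree u huR v hvR b' hs.b'_mem hs.adj_v hh hs.adj_vb', hs.reducible h⟩

end Cannonball

namespace Cannonball

open scoped Classical

/-! ## Elimination orders for three colors -/

/-- The vertices of `H` that are not yet eliminated. -/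
noncomputable def alive (H : Finset ℕ) (L : List ℕ) : Finset ℕ := H.filter (· ∉ L)

theorem mem_alive {H : Finset ℕ} {L : List ℕ} {w : ℕ} : w ∈ alive H L ↔ w ∈ H ∧ w ∉ L := by
  simp [alive]

theorem alive_cons (H : Finset ℕ) (L : List ℕ) (w : ℕ) :
    alive H (w :: L) = (alive H L).erase w := by
  ext x; simp [mem_alive]; tauto

/-- If all other vertices of `A` are colored, then `w` can be colored as well. Here `cp u = b` if
`u` gets the color of `b`, and `cp u = -1` if `u` gets a free color. -/
def Removable (adj : ℕ → ℕ → Prop) (cp : ℕ → ℤ) (A : Finset ℕ) (w : ℕ) : Prop :=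
  (cp w = -1 ∧ ((A.filter (adj w)).card ≤ 2 ∨
    ∃ u ∈ A, ∃ b ∈ A, u ≠ b ∧ cp u = b ∧ adj w u ∧ adj w b ∧ (A.filter (adj w)).card ≤ 3)) ∨
  ∃ b ∈ A, cp w = b ∧ b ≠ w ∧ ∀ x ∈ A, adj w x → adj b x

/-- `L` lists eliminated vertices of `H`, the last one first. -/
def Elim (adj : ℕ → ℕ → Prop) (cp : ℕ → ℤ) (H : Finset ℕ) : List ℕ → Prop
  | [] => True
  | w :: L => Elim adj cp H L ∧ w ∈ alive H L ∧ Removable adj cp (alive H L) w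

/-- Recording the copy mark of one more vertex must not invalidate eliminations that were made
earlier. -/
theorem Removable.congr {adj : ℕ → ℕ → Prop} {cp cp' : ℕ → ℤ} {A : Finset ℕ} {w : ℕ}
    (h : Removable adj cp A w) (hw : cp' w = cp w)
    (hcp : ∀ u, ∀ b : ℕ, cp u = b → cp' u = b) : Removable adj cp' A w := by
  rcases h with ⟨h1, h2⟩ | ⟨b, h1, h2, h3⟩
  · refine Or.inl ⟨hw.trans h1, h2.imp_right ?_⟩
    rintro ⟨u, hu, b, hb, hub, h3, h4⟩
    exact ⟨u, hu, b, hb, hub, hcp u b h3, h4⟩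
  · exact Or.inr ⟨b, h1, hw.trans h2, h3⟩

theorem Elim.congr {adj : ℕ → ℕ → Prop} {cp cp' : ℕ → ℤ} {H : Finset ℕ} {L : List ℕ}
    (h : Elim adj cp H L) (hw : ∀ w ∈ L, cp' w = cp w)
    (hcp : ∀ u, ∀ b : ℕ, cp u = b → cp' u = b) : Elim adj cp' H L := by
  induction L with
  | nil => trivial
  | cons w L ih =>
    exact ⟨ih h.1 (fun x hx => hw x (List.mem_cons_of_mem _ hx)), h.2.1,
      h.2.2.congr (hw w List.mem_cons_self) hcp⟩

theorem Elim.of_suffix {adj : ℕ → ℕ → Prop} {cp : ℕ → ℤ} {H : Finset ℕ} {L L' : List ℕ}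
    (h : Elim adj cp H L') (hL : L <:+ L') : Elim adj cp H L := by
  induction L' with
  | nil => rw [List.suffix_nil.1 hL]; trivial
  | cons w L' ih =>
    rcases List.suffix_cons_iff.1 hL with rfl | h1
    · exact h
    · exact ih h.1 h1

theorem Elim.subset {adj : ℕ → ℕ → Prop} {cp : ℕ → ℤ} {H : Finset ℕ} {L : List ℕ}
    (h : Elim adj cp H L) : ∀ w ∈ L, w ∈ H := by
  induction L with
  | nil => simp
  | cons w L ih =>
    intro x hx
    rcases List.mem_cons.1 hx with rfl | hx
    · exact (mem_alive.1 h.2.1).1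
    · exact ih h.1 x hx

theorem Elim.nodup {adj : ℕ → ℕ → Prop} {cp : ℕ → ℤ} {H : Finset ℕ} {L : List ℕ}
    (h : Elim adj cp H L) : L.Nodup := by
  induction L with
  | nil => simp
  | cons w L ih => exact List.nodup_cons.2 ⟨(mem_alive.1 h.2.1).2, ih h.1⟩

theorem Elim.length_le {adj : ℕ → ℕ → Prop} {cp : ℕ → ℤ} {H : Finset ℕ} {L : List ℕ}
    (h : Elim adj cp H L) : L.length ≤ H.card := by
  rw [← List.toFinset_card_of_nodup h.nodup]
  exact Finset.card_le_card fun x hx => h.subset x (List.mem_toFinset.1 hx)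

/-- A proper coloring of `C` with the colors 1, 2, 3. -/
structure Colored (adj : ℕ → ℕ → Prop) (cp : ℕ → ℤ) (C : Finset ℕ) (col : ℕ → ℤ) : Prop where
  range : ∀ i ∈ C, col i = 1 ∨ col i = 2 ∨ col i = 3
  proper : ∀ i ∈ C, ∀ j ∈ C, adj i j → col i ≠ col j
  copy : ∀ u ∈ C, cp u = -1 ∨ ∃ b ∈ C, cp u = b ∧ col u = col b

theorem Colored.insert {adj : ℕ → ℕ → Prop} {cp : ℕ → ℤ} {C : Finset ℕ} {col col' : ℕ → ℤ} {w : ℕ}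
    (hsymm : ∀ i j, adj i j → adj j i) (hirr : ∀ i, ¬ adj i i) (h : Colored adj cp C col)
    (hC : ∀ x ∈ C, col' x = col x) (hr : col' w = 1 ∨ col' w = 2 ∨ col' w = 3)
    (hp : ∀ x ∈ C, adj w x → col x ≠ col' w)
    (hc : cp w = -1 ∨ ∃ b ∈ C, cp w = b ∧ col' w = col b) :
    Colored adj cp (insert w C) col' := by
  refine ⟨fun i hi => ?_, fun i hi j hj hij => ?_, fun u hu => ?_⟩
  · rcases Finset.mem_insert.1 hi with rfl | hi
    · exact hr
    · rw [hC i hi]; exact h.range i hi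
  · rcases Finset.mem_insert.1 hi with hi' | hi' <;>
      rcases Finset.mem_insert.1 hj with hj' | hj'
    · exact absurd (hi' ▸ hj' ▸ hij) (hirr _)
    · rw [hC j hj', hi']; exact (hp j hj' (hi' ▸ hij)).symm
    · rw [hC i hi', hj']; exact hp i hi' (hsymm _ _ (hj' ▸ hij))
    · rw [hC i hi', hC j hj']; exact h.proper i hi' j hj' hij
  · rcases Finset.mem_insert.1 hu with rfl | hu
    · refine hc.imp_right ?_
      rintro ⟨b, hb, h1, h2⟩
      exact ⟨b, Finset.mem_insert_of_mem hb, h1, by rw [hC b hb, h2]⟩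
    · refine (h.copy u hu).imp_right ?_
      rintro ⟨b, hb, h1, h2⟩
      exact ⟨b, Finset.mem_insert_of_mem hb, h1, by rw [hC b hb, hC u hu, h2]⟩

/-- The neighbors of `w` show at most two colors: either there are at most two of them, or there are
three and two of these share a color by a copy mark. -/
theorem Colored.exists_free {adj : ℕ → ℕ → Prop} {cp : ℕ → ℤ} {A : Finset ℕ} {col : ℕ → ℤ} {w : ℕ}
    (hirr : ∀ i, ¬ adj i i) (h : Colored adj cp (A.erase w) col)
    (hw : Removable adj cp A w) (hcp : cp w = -1) :
    ∃ c : ℤ, (c = 1 ∨ c = 2 ∨ c = 3) ∧ ∀ x ∈ A.erase w, adj w x → col x ≠ c := by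
  have hcard : ((A.filter (adj w)).image col).card ≤ 2 := by
    rcases hw with ⟨-, h1 | ⟨u, hu, b, hb, hub, hcu, hwu, hwb, h1⟩⟩ | ⟨b, -, h1, -⟩
    · exact Finset.card_image_le.trans h1
    · have huw : u ≠ w := by rintro rfl; exact hirr _ hwu
      have hbw : b ≠ w := by rintro rfl; exact hirr _ hwb
      have hcol : col u = col b := by
        rcases h.copy u (Finset.mem_erase.2 ⟨huw, hu⟩) with h2 | ⟨b', -, h2, h3⟩
        · omega
        · have : b = b' := by omega
          rw [h3, this]
      have himg : (A.filter (adj w)).image col ⊆ ((A.filter (adj w)).erase u).image col := by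
        intro c hc
        obtain ⟨x, hx, rfl⟩ := Finset.mem_image.1 hc
        by_cases hxu : x = u
        · exact Finset.mem_image.2 ⟨b, Finset.mem_erase.2
            ⟨hub.symm, Finset.mem_filter.2 ⟨hb, hwb⟩⟩, by rw [hxu, hcol]⟩
        · exact Finset.mem_image_of_mem _ (Finset.mem_erase.2 ⟨hxu, hx⟩)
      refine (Finset.card_le_card himg).trans (Finset.card_image_le.trans ?_)
      rw [Finset.card_erase_of_mem (Finset.mem_filter.2 ⟨hu, hwu⟩)]
      omega
    · omega
  obtain ⟨c, hc, hc'⟩ := Finset.exists_mem_notMem_of_card_lt_card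
    (show ((A.filter (adj w)).image col).card < ({1, 2, 3} : Finset ℤ).card by
      rw [show ({1, 2, 3} : Finset ℤ).card = 3 from rfl]; omega)
  refine ⟨c, by simpa using hc, fun x hx hwx hxc => hc' ?_⟩
  exact Finset.mem_image.2 ⟨x, Finset.mem_filter.2 ⟨Finset.mem_of_mem_erase hx, hwx⟩, hxc⟩

/-- Every remaining neighbor of `w` is a neighbor of `b`, so none of them has the color of `b`. -/
theorem Colored.copy_free {adj : ℕ → ℕ → Prop} {cp : ℕ → ℤ} {A : Finset ℕ} {col : ℕ → ℤ} {w b : ℕ}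
    (h : Colored adj cp (A.erase w) col)
    (hw : Removable adj cp A w) (hcp : cp w = b) :
    b ∈ A.erase w ∧ ∀ x ∈ A.erase w, adj w x → col x ≠ col b := by
  rcases hw with ⟨h1, -⟩ | ⟨b', hb', h1, h2, h3⟩
  · omega
  · obtain rfl : b' = b := by omega
    have hb : b' ∈ A.erase w := Finset.mem_erase.2 ⟨h2, hb'⟩
    refine ⟨hb, fun x hx hwx => ?_⟩
    have := h3 x (Finset.mem_of_mem_erase hx) hwx
    exact fun hh => h.proper b' hb x hx this hh.symm

end Cannonball

namespace Cannonball

open scoped Classical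

/-! ## Elimination on the machine -/

/-- Array `5` holds the starts of the rows of the adjacency matrix in array `6`. -/
structure Table (n : ℕ) (adj : ℕ → ℕ → Prop) (s : RState) : Prop where
  count : s.reg 0 = n
  base : ∀ i < n, s.arr 5 i = i * n
  entry : ∀ i < n, ∀ j < n, s.arr 6 (i * n + j) = if adj i j then 1 else 0

theorem Table.congr {n : ℕ} {adj : ℕ → ℕ → Prop} {s s' : RState} (h : Table n adj s)
    (h0 : s'.reg 0 = s.reg 0) (h5 : s'.arr 5 = s.arr 5) (h6 : s'.arr 6 = s.arr 6) :
    Table n adj s' :=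
  ⟨h0.trans h.count, by rw [h5]; exact h.base, by rw [h6]; exact h.entry⟩

theorem Table.frame {n : ℕ} {adj : ℕ → ℕ → Prop} {s s' : RState} (h : Table n adj s)
    {P : SProg} (hP : SProg.Frame P s s') (h0 : 0 ∉ P.regs) (h5 : 5 ∉ P.arrs) (h6 : 6 ∉ P.arrs) :
    Table n adj s' :=
  h.congr (hP.reg 0 h0) (hP.arr 5 h5) (hP.arr 6 h6)

theorem Table.setReg {n : ℕ} {adj : ℕ → ℕ → Prop} {s : RState} (h : Table n adj s) {r : ℕ}
    (hr : 0 ≠ r) (v : ℤ) : Table n adj (s.setReg r v) :=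
  h.congr (by simp [hr]) rfl rfl

/-- The adjacency of the vertices in two registers. -/
def adjE (i j : ℕ) : RExpr := .arr 6 (.add (.arr 5 (.reg i)) (.reg j))

/-- One if two registers are different, otherwise zero. -/
def neE (i j : ℕ) : RExpr := .div (.sub (.reg i) (.reg j)) (.sub (.reg i) (.reg j))

theorem Table.eval_adjE {n : ℕ} {adj : ℕ → ℕ → Prop} {s : RState} (h : Table n adj s)
    {r q i j : ℕ} (hr : s.reg r = i) (hq : s.reg q = j) (hi : i < n) (hj : j < n) :
    (adjE r q).eval s = if adj i j then 1 else 0 := by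
  simp only [adjE, RExpr.eval, hr, hq, h.base i hi]
  exact h.entry i hi j hj

/-- A nonzero number divided by itself is `1`, whereas `0 / 0 = 0` by convention. -/
theorem eval_neE {s : RState} {r q i j : ℕ} (hr : s.reg r = i) (hq : s.reg q = j) :
    (neE r q).eval s = if i ≠ j then 1 else 0 := by
  simp only [neE, RExpr.eval, hr, hq]
  split_ifs with h
  · exact Int.ediv_self (by omega)
  · simp only [ne_eq, not_not] at h; simp [h]

/-- Array `a` holds the characteristic function of `S`. -/
structure Mask (n a : ℕ) (S : Finset ℕ) (s : RState) : Prop where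
  lt : ∀ x ∈ S, x < n
  cell : ∀ x < n, s.arr a x = if x ∈ S then 1 else 0

theorem Mask.congr {n a : ℕ} {S : Finset ℕ} {s s' : RState} (h : Mask n a S s)
    (ha : s'.arr a = s.arr a) : Mask n a S s' := ⟨h.lt, by rw [ha]; exact h.cell⟩

theorem card_filter_lt_succ (S : Finset ℕ) (i : ℕ) :
    (S.filter (· < i + 1)).card = (S.filter (· < i)).card + if i ∈ S then 1 else 0 := by
  split_ifs with h
  · rw [← Finset.card_insert_of_notMem (a := i) (by simp)]
    congr 1; ext x; simp only [Finset.mem_filter, Finset.mem_insert]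
    constructor
    · rintro ⟨h1, h2⟩; by_cases hx : x = i
      · exact Or.inl hx
      · exact Or.inr ⟨h1, by omega⟩
    · rintro (rfl | ⟨h1, h2⟩)
      · exact ⟨h, by omega⟩
      · exact ⟨h1, by omega⟩
  · rw [add_zero]; congr 1; ext x; simp only [Finset.mem_filter]
    refine and_congr_right fun hx => ?_
    have : x ≠ i := by rintro rfl; exact h hx
    omega

/-- Count the neighbors of the vertex in register `5` that are marked in array `a`. -/
def countNbrs (a : ℕ) : SProg :=
  .seq (.set 7 (.lit 0)) (.forN 6 (.ite (.sub (.add (.arr a (.reg 6)) (adjE 5 6)) (.lit 1))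
    (.set 7 (.add (.reg 7) (.lit 1))) .skip))

theorem countNbrs_run {n a w : ℕ} {adj : ℕ → ℕ → Prop} {S : Finset ℕ} {s : RState}
    (h : Table n adj s) (hm : Mask n a S s) (hw : s.reg 5 = w) (hwn : w < n) :
    ((countNbrs a).run n s).reg 7 = (S.filter (adj w)).card := by
  unfold countNbrs
  rw [SProg.run]
  obtain ⟨s', hs', hI, -⟩ := SProg.forN_rule (n := n) (r := 6)
    (P := .ite (.sub (.add (.arr a (.reg 6)) (adjE 5 6)) (.lit 1))
      (.set 7 (.add (.reg 7) (.lit 1))) .skip)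
    (s := (SProg.set 7 (.lit 0)).run n s)
    (fun i s' => s'.reg 7 = ((S.filter (adj w)).filter (· < i)).card)
    (by simp [SProg.run]) (by
      intro i hi s' hF hI
      have ht : Table n adj (s'.setReg 6 i) := (Table.setReg (h.setReg (r := 7) (by decide) 0
        |>.frame hF (by simp [SProg.regs]) (by simp [SProg.arrs]) (by simp [SProg.arrs]))
        (by decide) _)
      have hm' := (hm.congr (s' := s'.setReg 6 i) (hF.arr a (by simp [SProg.arrs]))).cell i hi
      have hw' : (s'.setReg 6 i).reg 5 = w := by
        rw [RState.setReg_reg, if_neg (by decide), hF.reg 5 (by simp [SProg.regs])]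
        simpa [SProg.run] using hw
      have hadj := ht.eval_adjE (q := 6) hw' (by simp) hwn hi
      have hr6 : (s'.setReg 6 i).reg 6 = i := by simp
      have hr7 : (s'.setReg 6 i).reg 7 = s'.reg 7 := by simp
      rw [card_filter_lt_succ]
      simp only [SProg.run]
      -- Two indicators minus one is positive exactly when both are one.
      simp only [RExpr.eval, hadj, hr6, hm', Finset.mem_filter, hr7, hI]
      by_cases h1 : i ∈ S <;> by_cases h2 : adj w i <;> simp [h1, h2, hI])
  have hle : (S.filter (adj w)).filter (· < n) = S.filter (adj w) :=
    Finset.filter_true_of_mem fun x hx => hm.lt x (Finset.mem_filter.1 hx).1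
  rw [hs', RState.setReg_reg, if_neg (by decide), hI, hle]

/-- Array `9` lists the vertices of `L` in the order of their elimination. -/
def Order (s : RState) : List ℕ → Prop
  | [] => True
  | w :: L => s.arr 9 L.length = w ∧ Order s L

theorem Order.congr {s s' : RState} {L : List ℕ} (h : Order s L)
    (h9 : ∀ i : ℕ, i < L.length → s'.arr 9 i = s.arr 9 i) : Order s' L := by
  induction L with
  | nil => trivial
  | cons w L ih =>
    exact ⟨(h9 _ (by simp)).trans h.1, ih h.2 fun i hi => h9 i (by simp; omega)⟩

theorem Order.of_suffix {s : RState} {L L' : List ℕ} (h : Order s L') (hL : L <:+ L') :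
    Order s L := by
  induction L' with
  | nil => rw [List.suffix_nil.1 hL]; trivial
  | cons w L' ih =>
    rcases List.suffix_cons_iff.1 hL with rfl | h1
    · exact h
    · exact ih h.2 h1

/-- The elimination order `L`, with the remaining vertices marked in array `a` and the length
of `L` in register `t`. -/
structure Stage (n : ℕ) (adj : ℕ → ℕ → Prop) (H : Finset ℕ) (a t : ℕ) (cp : ℕ → ℤ) (L : List ℕ)
    (s : RState) : Prop where
  elim : Elim adj cp H L
  mask : Mask n a (alive H L) s
  length : s.reg t = L.length
  order : Order s L

theorem Stage.congr {n : ℕ} {adj : ℕ → ℕ → Prop} {H : Finset ℕ} {a t : ℕ} {cp : ℕ → ℤ}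
    {L : List ℕ} {s s' : RState} (h : Stage n adj H a t cp L s) (ha : s'.arr a = s.arr a)
    (h9 : s'.arr 9 = s.arr 9) (ht : s'.reg t = s.reg t) : Stage n adj H a t cp L s' :=
  ⟨h.elim, h.mask.congr ha, ht.trans h.length, h.order.congr fun i _ => by rw [h9]⟩

/-- Eliminate the vertex in register `v`. -/
def remove (a t v : ℕ) : SProg :=
  .seq (.store 9 (.reg t) (.reg v)) (.seq (.store a (.reg v) (.lit 0))
    (.set t (.add (.reg t) (.lit 1))))

theorem Stage.remove {n : ℕ} {adj : ℕ → ℕ → Prop} {H : Finset ℕ} {a t v w : ℕ} {cp : ℕ → ℤ}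
    {L : List ℕ} {s : RState} (h : Stage n adj H a t cp L s) (ha : a ≠ 9) (hv : s.reg v = w)
    (hw : w ∈ alive H L) (hr : Removable adj cp (alive H L) w) :
    Stage n adj H a t cp (w :: L) ((remove a t v).run n s) := by
  refine ⟨⟨h.elim, hw, hr⟩, ⟨?_, ?_⟩, ?_, ?_, ?_⟩
  · intro x hx
    rw [alive_cons] at hx
    exact h.mask.lt x (Finset.mem_of_mem_erase hx)
  · intro x hx
    rw [alive_cons]
    simp only [Cannonball.remove, SProg.run]
    simp [ha, hv, h.mask.cell x hx, Finset.mem_erase]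
    by_cases hxw : x = w <;> simp [hxw]
  · simp [Cannonball.remove, SProg.run, h.length]
  · simp only [Cannonball.remove, SProg.run]
    simp [ha.symm, hv, h.length]
  · refine h.order.congr fun i hi => ?_
    have : (i : ℤ) ≠ L.length := by omega
    simp only [Cannonball.remove, SProg.run]
    simp [ha.symm, h.length, this]

/-- Eliminate vertices with at most two remaining neighbors. -/
def peelLow : SProg :=
  .forN 5 (.ite (.arr 7 (.reg 5)) (.seq (countNbrs 7)
    (.ite (.sub (.lit 3) (.reg 7)) (remove 7 8 5) .skip)) .skip)

theorem alive_subset {H : Finset ℕ} {L L' : List ℕ}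
    (h : L <:+ L') : alive H L' ⊆ alive H L := by
  intro x hx
  rw [mem_alive] at hx ⊢
  exact ⟨hx.1, fun hL => hx.2 (h.subset hL)⟩

/-- When a pass eliminates nothing, every vertex has been tested against the same set, so the degree
bound holds for all of them at once. -/
theorem peelLow_run {n : ℕ} {adj : ℕ → ℕ → Prop} {H : Finset ℕ} {cp : ℕ → ℤ}
    {L : List ℕ} {s : RState} (hT : Table n adj s) (h : Stage n adj H 7 8 cp L s)
    (hcp : ∀ w, w ∉ L → cp w = -1) :
    ∃ L', L <:+ L' ∧ Stage n adj H 7 8 cp L' (peelLow.run n s) ∧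
      (L' = L → ∀ w ∈ alive H L, 3 ≤ ((alive H L).filter (adj w)).card) := by
  obtain ⟨s', hs', ⟨L', hL', hS, hdeg⟩, -⟩ := SProg.forN_rule (n := n) (r := 5)
    (P := .ite (.arr 7 (.reg 5)) (.seq (countNbrs 7)
      (.ite (.sub (.lit 3) (.reg 7)) (remove 7 8 5) .skip)) .skip) (s := s)
    (fun i s' => ∃ L', L <:+ L' ∧ Stage n adj H 7 8 cp L' s' ∧
      (L' = L → ∀ w ∈ alive H L, w < i → 3 ≤ ((alive H L).filter (adj w)).card))
    ⟨L, List.suffix_rfl, h, by simp⟩ (by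
      rintro i hi s' hF ⟨L', hL', hS, hdeg⟩
      set s1 := s'.setReg 5 i with hs1
      have hT1 : Table n adj s1 :=
        (hT.frame hF (by decide) (by decide) (by decide)).setReg (by decide) _
      have hS1 : Stage n adj H 7 8 cp L' s1 := hS.congr rfl rfl (by simp [hs1])
      have h5 : s1.reg 5 = i := by simp [hs1]
      have hc := countNbrs_run hT1 hS1.mask h5 hi
      have hFc := SProg.frame_run n (countNbrs 7) s1
      rw [SProg.run]
      simp only [RExpr.eval, h5, hS1.mask.cell i hi]
      by_cases hiA : i ∈ alive H L'
      · simp only [hiA, if_true, zero_lt_one]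
        rw [SProg.run]
        have hS2 : Stage n adj H 7 8 cp L' ((countNbrs 7).run n s1) :=
          hS1.congr (hFc.arr 7 (by decide)) (hFc.arr 9 (by decide)) (hFc.reg 8 (by decide))
        have h52 : ((countNbrs 7).run n s1).reg 5 = i := by rw [hFc.reg 5 (by decide), h5]
        rw [SProg.run]
        simp only [RExpr.eval, hc]
        split_ifs with h3
        · have hrem : Removable adj cp (alive H L') i :=
            Or.inl ⟨hcp i fun hh => (mem_alive.1 hiA).2 (hL'.subset hh), Or.inl (by omega)⟩
          refine ⟨i :: L', hL'.trans (List.suffix_cons _ _),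
            hS2.remove (by decide) h52 hiA hrem, fun hh => ?_⟩
          -- The list has grown strictly beyond `L`, so the premise of equality is impossible.
          have := hL'.length_le
          rw [← hh] at this
          simp at this
        · refine ⟨L', hL', hS2, fun hh w hw hwi => ?_⟩
          by_cases hwe : w = i
          · subst hwe; subst hh; omega
          · exact hdeg hh w hw (by omega)
      · simp only [hiA, if_false, lt_irrefl]
        refine ⟨L', hL', hS1, fun hh w hw hwi => ?_⟩
        by_cases hwe : w = i
        · subst hwe; subst hh; exact absurd hw hiA
        · exact hdeg hh w hw (by omega))
  refine ⟨L', hL', ?_, fun hh w hw => hdeg hh w hw (h.mask.lt w hw)⟩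
  unfold peelLow
  rw [hs']
  exact hS.congr rfl rfl (by simp)

end Cannonball

/-! ### Trials: the cascade for a pair of vertices with a common color -/

namespace Cannonball

open scoped Classical

/-- Eliminate the vertex in register `5`, if at most two different colors can occur among its
remaining neighbors when the vertices in registers `2` and `3` get the same color. -/
def cascadeStep : SProg :=
  .ite (.sub (.add (.arr 10 (.reg 5)) (.add (neE 5 2) (neE 5 3))) (.lit 2))
    (.seq (countNbrs 10)
      (.ite (.sub (.add (.lit 3) (.div (.add (adjE 5 2) (adjE 5 3)) (.lit 2))) (.reg 7))
        (remove 10 9 5) .skip))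
    .skip

/-- Copy array `a` to array `b`. -/
def copyArr (a b : ℕ) : SProg := .forN 6 (.store b (.reg 6) (.arr a (.reg 6)))

theorem copyArr_run {n a b : ℕ} (hab : a ≠ b) (s : RState) :
    ∀ x < n, ((copyArr a b).run n s).arr b x = s.arr a x := by
  obtain ⟨s', hs', hI, -⟩ := SProg.forN_rule (n := n) (r := 6)
    (P := .store b (.reg 6) (.arr a (.reg 6))) (s := s)
    (fun i s' => ∀ x < i, s'.arr b x = s.arr a x) (by simp) (by
      intro i hi s' hF hI x hx
      have ha := hF.arr a (by simpa [SProg.arrs] using hab)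
      simp only [SProg.run]
      by_cases hxi : x = i
      · simp [ha, hxi]
      · simp [hxi, hI x (by omega)])
  intro x hx
  unfold copyArr
  rw [hs']
  exact hI x hx

/-- No vertex can be eliminated if `u` and `b` get the same color. -/
def Stuck (adj : ℕ → ℕ → Prop) (S : Finset ℕ) (u b w : ℕ) : Prop :=
  w ≠ u → w ≠ b → 3 + (if adj w u ∧ adj w b then 1 else 0) ≤ (S.filter (adj w)).card

section

variable {n : ℕ} {adj : ℕ → ℕ → Prop} {H : Finset ℕ} {u b : ℕ}

theorem cascadeStep_run {cp : ℕ → ℤ} {L : List ℕ} {s : RState} {w : ℕ} (hT : Table n adj s)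
    (h : Stage n adj H 10 9 cp L s) (hcp : ∀ w, w ∉ L → w ≠ u → cp w = -1)
    (hun : u < n) (hbn : b < n) (hub : u ≠ b) (hu : u ∈ alive H L) (hb : b ∈ alive H L)
    (hcu : cp u = b) (h2 : s.reg 2 = u) (h3 : s.reg 3 = b) (h5 : s.reg 5 = w) (hw : w < n) :
    (Stage n adj H 10 9 cp L (cascadeStep.run n s) ∧
      (w ∈ alive H L → Stuck adj (alive H L) u b w)) ∨
    (Stage n adj H 10 9 cp (w :: L) (cascadeStep.run n s) ∧ w ≠ u ∧ w ≠ b ∧ w ∈ alive H L ∧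
      ¬ Stuck adj (alive H L) u b w) := by
  have hc := countNbrs_run hT h.mask h5 hw
  have hF := SProg.frame_run n (countNbrs 10) s
  have hT2 := hT.frame hF (by decide) (by decide) (by decide)
  have hS2 : Stage n adj H 10 9 cp L ((countNbrs 10).run n s) :=
    h.congr (hF.arr 10 (by decide)) (hF.arr 9 (by decide)) (hF.reg 9 (by decide))
  have h52 : ((countNbrs 10).run n s).reg 5 = w := by rw [hF.reg 5 (by decide), h5]
  have h22 : ((countNbrs 10).run n s).reg 2 = u := by rw [hF.reg 2 (by decide), h2]
  have h32 : ((countNbrs 10).run n s).reg 3 = b := by rw [hF.reg 3 (by decide), h3]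
  have ha2 := hT2.eval_adjE h52 h22 hw hun
  have ha3 := hT2.eval_adjE h52 h32 hw hbn
  have hn2 := eval_neE h5 h2
  have hn3 := eval_neE h5 h3
  unfold cascadeStep
  rw [SProg.run]
  -- Three indicators sum to more than two only if all of them are one.
  have hiff : 0 < (RExpr.sub (.add (.arr 10 (.reg 5)) (.add (neE 5 2) (neE 5 3)))
      (.lit 2)).eval s ↔ w ∈ alive H L ∧ w ≠ u ∧ w ≠ b := by
    simp only [RExpr.eval, hn2, hn3, h5, h.mask.cell w hw]
    by_cases h1 : w ∈ alive H L <;> by_cases h2 : w = u <;> by_cases h3 : w = b <;>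
      simp only [h1, h2, h3] <;> (try split_ifs) <;> simp_all
  by_cases hcond : w ∈ alive H L ∧ w ≠ u ∧ w ≠ b
  · rw [if_pos (hiff.2 hcond), SProg.run, SProg.run]
    obtain ⟨hwA, hwu, hwb⟩ := hcond
    -- Half the sum of two indicators, rounded down, is the indicator of their conjunction.
    have hdiv : ((if adj w u then (1 : ℤ) else 0) + (if adj w b then 1 else 0)) / 2 =
        ((if adj w u ∧ adj w b then 1 else 0 : ℕ) : ℤ) := by
      by_cases h1 : adj w u <;> by_cases h2 : adj w b <;> simp [h1, h2]
    have hiff2 : 0 < (RExpr.sub (.add (.lit 3) (.div (.add (adjE 5 2) (adjE 5 3)) (.lit 2)))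
        (.reg 7)).eval ((countNbrs 10).run n s) ↔
        (Finset.filter (adj w) (alive H L)).card <
          3 + (if adj w u ∧ adj w b then 1 else 0) := by
      simp only [RExpr.eval, ha2, ha3, hc, hdiv]
      omega
    by_cases hlt : (Finset.filter (adj w) (alive H L)).card <
        3 + (if adj w u ∧ adj w b then 1 else 0)
    · right
      rw [if_pos (hiff2.2 hlt)]
      refine ⟨hS2.remove (by decide) h52 hwA (Or.inl ⟨hcp w (mem_alive.1 hwA).2 hwu, ?_⟩),
        hwu, hwb, hwA, fun hst => absurd (hst hwu hwb) (by omega)⟩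
      by_cases hboth : adj w u ∧ adj w b
      · rw [if_pos hboth] at hlt
        exact Or.inr ⟨u, hu, b, hb, hub, hcu, hboth.1, hboth.2, by omega⟩
      · rw [if_neg hboth] at hlt
        exact Or.inl (by omega)
    · left
      rw [if_neg fun hh => hlt (hiff2.1 hh), SProg.run]
      exact ⟨hS2, fun _ _ _ => by omega⟩
  · left
    rw [if_neg fun hh => hcond (hiff.1 hh), SProg.run]
    exact ⟨h, fun h1 h2 h3 => absurd ⟨h1, h2, h3⟩ hcond⟩

/-- The part of the state that the cascade relies on. -/
structure Trial (n : ℕ) (adj : ℕ → ℕ → Prop) (H : Finset ℕ) (u b : ℕ) (cp : ℕ → ℤ) (L : List ℕ)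
    (s : RState) : Prop where
  table : Table n adj s
  stage : Stage n adj H 10 9 cp L s
  fresh : ∀ w, w ∉ L → w ≠ u → cp w = -1
  u_mem : u ∈ alive H L
  b_mem : b ∈ alive H L
  copy : cp u = b
  reg_u : s.reg 2 = u
  reg_b : s.reg 3 = b

theorem Trial.step {cp : ℕ → ℤ} {L : List ℕ} {s : RState} {w : ℕ}
    (h : Trial n adj H u b cp L s) (hun : u < n) (hbn : b < n) (hub : u ≠ b)
    (h5 : s.reg 5 = w) (hw : w < n) :
    (Trial n adj H u b cp L (cascadeStep.run n s) ∧
      (w ∈ alive H L → Stuck adj (alive H L) u b w)) ∨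
    (Trial n adj H u b cp (w :: L) (cascadeStep.run n s) ∧ w ∈ alive H L ∧
      ¬ Stuck adj (alive H L) u b w) := by
  have hF := SProg.frame_run n cascadeStep s
  have hT := h.table.frame hF (by decide) (by decide) (by decide)
  have h2 := (hF.reg 2 (by decide)).trans h.reg_u
  have h3 := (hF.reg 3 (by decide)).trans h.reg_b
  rcases cascadeStep_run h.table h.stage h.fresh hun hbn hub h.u_mem h.b_mem h.copy h.reg_u
    h.reg_b h5 hw with ⟨h6, h7⟩ | ⟨h6, hwu, hwb, h7⟩
  · exact Or.inl ⟨⟨hT, h6, h.fresh, h.u_mem, h.b_mem, h.copy, h2, h3⟩, h7⟩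
  · refine Or.inr ⟨⟨hT, h6, fun x hx => h.fresh x fun hh => hx (List.mem_cons_of_mem _ hh), ?_, ?_,
      h.copy, h2, h3⟩, h7⟩
    · rw [alive_cons]; exact Finset.mem_erase.2 ⟨hwu.symm, h.u_mem⟩
    · rw [alive_cons]; exact Finset.mem_erase.2 ⟨hwb.symm, h.b_mem⟩

theorem Trial.congr {cp : ℕ → ℤ} {L : List ℕ} {s s' : RState}
    (h : Trial n adj H u b cp L s) (hreg : ∀ r, r ≠ 5 → r ≠ 4 → s'.reg r = s.reg r)
    (harr : s'.arr = s.arr) : Trial n adj H u b cp L s' :=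
  ⟨h.table.congr (hreg 0 (by decide) (by decide)) (by rw [harr]) (by rw [harr]),
    h.stage.congr (by rw [harr]) (by rw [harr]) (hreg 9 (by decide) (by decide)), h.fresh,
    h.u_mem, h.b_mem, h.copy, (hreg 2 (by decide) (by decide)).trans h.reg_u,
    (hreg 3 (by decide) (by decide)).trans h.reg_b⟩

/-- The third clause detects that the cascade has stopped; the last one says that a stopped cascade
stays stopped, so that superfluous passes do no harm. -/
theorem Trial.pass {cp : ℕ → ℤ} {L : List ℕ} {s : RState}
    (h : Trial n adj H u b cp L s) (hun : u < n) (hbn : b < n) (hub : u ≠ b) :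
    ∃ L', L <:+ L' ∧ Trial n adj H u b cp L' ((SProg.forN 5 cascadeStep).run n s) ∧
      (L' = L → ∀ w ∈ alive H L, Stuck adj (alive H L) u b w) ∧
      ((∀ w ∈ alive H L, Stuck adj (alive H L) u b w) → L' = L) := by
  obtain ⟨s', hs', ⟨L', hL', hS, h1, h2⟩, -⟩ := SProg.forN_rule (n := n) (r := 5)
    (P := cascadeStep) (s := s)
    (fun i s' => ∃ L', L <:+ L' ∧ Trial n adj H u b cp L' s' ∧
      (L' = L → ∀ w ∈ alive H L, w < i → Stuck adj (alive H L) u b w) ∧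
      ((∀ w ∈ alive H L, Stuck adj (alive H L) u b w) → L' = L))
    ⟨L, List.suffix_rfl, h, by simp, by simp⟩ (by
      rintro i hi s' hF ⟨L', hL', hS, h1, h2⟩
      have hS1 : Trial n adj H u b cp L' (s'.setReg 5 i) :=
        hS.congr (fun r hr _ => by simp [hr]) rfl
      rcases hS1.step hun hbn hub (by simp) hi with ⟨h3, h4⟩ | ⟨h3, h4, h5⟩
      · refine ⟨L', hL', h3, fun hh w hw hwi => ?_, h2⟩
        by_cases hwe : w = i
        · subst hwe; subst hh; exact h4 hw
        · exact h1 hh w hw (by omega)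
      · refine ⟨i :: L', hL'.trans (List.suffix_cons _ _), h3, fun hh => ?_, fun hh => ?_⟩
        · have := hL'.length_le
          rw [← hh] at this
          simp at this
        · have := h2 hh
          subst this
          exact absurd (hh i h4) h5)
  refine ⟨L', hL', ?_, fun hh w hw => h1 hh w hw (h.stage.mask.lt w hw), h2⟩
  rw [hs']
  exact hS.congr (fun r hr _ => by simp [hr]) rfl

/-- A pass that is not stuck eliminates some vertex, and `u` itself is never eliminated here. Fewer
than `H.card ≤ n` eliminations are therefore possible, and `n` passes suffice. -/
theorem Trial.cascade {cp : ℕ → ℤ} {L : List ℕ} {s : RState}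
    (h : Trial n adj H u b cp L s) (hun : u < n) (hbn : b < n) (hub : u ≠ b)
    (hH : H.card ≤ n) :
    ∃ L', L <:+ L' ∧
      Trial n adj H u b cp L' ((SProg.forN 4 (.forN 5 cascadeStep)).run n s) ∧
      ∀ w ∈ alive H L', Stuck adj (alive H L') u b w := by
  obtain ⟨s', hs', ⟨L', hL', hS, h1⟩, -⟩ := SProg.forN_rule (n := n) (r := 4)
    (P := .forN 5 cascadeStep) (s := s)
    (fun i s' => ∃ L', L <:+ L' ∧ Trial n adj H u b cp L' s' ∧
      (i ≤ L'.length ∨ ∀ w ∈ alive H L', Stuck adj (alive H L') u b w))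
    ⟨L, List.suffix_rfl, h, by simp⟩ (by
      rintro i hi s' hF ⟨L', hL', hS, h1⟩
      have hS1 : Trial n adj H u b cp L' (s'.setReg 4 i) :=
        hS.congr (fun r _ hr => by simp [hr]) rfl
      obtain ⟨L'', hL'', hS2, h2, h3⟩ := hS1.pass hun hbn hub
      refine ⟨L'', hL'.trans hL'', hS2, ?_⟩
      rcases h1 with h1 | h1
      · by_cases hh : L'' = L'
        · subst hh; exact Or.inr (h2 rfl)
        · left
          have := hL''.length_le
          have : L'.length ≠ L''.length := fun h4 => hh (hL''.eq_of_length h4).symm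
          omega
      · have := h3 h1
        subst this
        exact Or.inr h1)
  refine ⟨L', hL', ?_, ?_⟩
  · rw [hs']
    exact hS.congr (fun r _ hr => by simp [hr]) rfl
  · refine h1.resolve_left fun hle => ?_
    have hlt : L'.length < H.card := by
      rw [← List.toFinset_card_of_nodup hS.stage.elim.nodup]
      refine Finset.card_lt_card ((Finset.ssubset_iff_of_subset fun x hx =>
        hS.stage.elim.subset x (List.mem_toFinset.1 hx)).2 ⟨u, (mem_alive.1 hS.u_mem).1, ?_⟩)
      simpa using (mem_alive.1 hS.u_mem).2
    omega

/-- Check that every remaining neighbor of the vertex in register `2` is a neighbor of the vertex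
in register `3`. -/
def checkNbrs : SProg :=
  .seq (.set 10 (.lit 1)) (.forN 6
    (.ite (.sub (.sub (.add (.arr 10 (.reg 6)) (adjE 2 6)) (adjE 3 6)) (.lit 1))
      (.set 10 (.lit 0)) .skip))

/-- The tested expression, alive plus adjacent to `u` minus adjacent to `b` minus one, is positive
only for a remaining neighbor of `u` that is not a neighbor of `b`. -/
theorem checkNbrs_run {S : Finset ℕ} {s : RState} (hT : Table n adj s) (hm : Mask n 10 S s)
    (hun : u < n) (hbn : b < n) (h2 : s.reg 2 = u) (h3 : s.reg 3 = b) :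
    (checkNbrs.run n s).reg 10 = if ∀ x ∈ S, adj u x → adj b x then 1 else 0 := by
  unfold checkNbrs
  rw [SProg.run]
  obtain ⟨s', hs', hI, -⟩ := SProg.forN_rule (n := n) (r := 6)
    (P := .ite (.sub (.sub (.add (.arr 10 (.reg 6)) (adjE 2 6)) (adjE 3 6)) (.lit 1))
      (.set 10 (.lit 0)) .skip)
    (s := (SProg.set 10 (.lit 1)).run n s)
    (fun i s' => s'.reg 10 = if ∀ x ∈ S, x < i → adj u x → adj b x then 1 else 0)
    (by simp [SProg.run]) (by
      intro i hi s' hF hI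
      have ht : Table n adj (s'.setReg 6 i) := (Table.setReg (hT.setReg (r := 10) (by decide) 1
        |>.frame hF (by decide) (by decide) (by decide)) (by decide) _)
      have hm' := (hm.congr (s' := s'.setReg 6 i) (hF.arr 10 (by decide))).cell i hi
      have h2' : (s'.setReg 6 i).reg 2 = u := by
        rw [RState.setReg_reg, if_neg (by decide), hF.reg 2 (by decide)]
        simpa [SProg.run] using h2
      have h3' : (s'.setReg 6 i).reg 3 = b := by
        rw [RState.setReg_reg, if_neg (by decide), hF.reg 3 (by decide)]
        simpa [SProg.run] using h3
      have ha2 := ht.eval_adjE (q := 6) h2' (by simp) hun hi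
      have ha3 := ht.eval_adjE (q := 6) h3' (by simp) hbn hi
      have hr6 : (s'.setReg 6 i).reg 6 = i := by simp
      rw [SProg.run]
      simp only [RExpr.eval, ha2, ha3, hr6, hm']
      by_cases hbad : i ∈ S ∧ adj u i ∧ ¬ adj b i
      · obtain ⟨h4, h5, h6⟩ := hbad
        simp only [h4, h5, h6, if_true, if_false]
        rw [if_pos (by norm_num), SProg.run, if_neg]
        · simp
        · exact fun hh => h6 (hh i h4 (by omega) h5)
      · rw [if_neg, SProg.run, RState.setReg_reg, if_neg (by decide), hI]
        · congr 1
          refine propext (forall₂_congr fun x hx => ?_)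
          by_cases hxi : x = i
          · subst hxi; simp; tauto
          · refine imp_congr_left ?_; omega
        · by_cases h1 : i ∈ S <;> by_cases h2 : adj u i <;> by_cases h3 : adj b i <;>
            simp [h1, h2, h3] at hbad ⊢)
  rw [hs', RState.setReg_reg, if_neg (by decide), hI]
  congr 1
  exact propext (forall₂_congr fun x hx => by simp [hm.lt x hx])

/-- Try to eliminate the vertex in register `2`, with the color of the vertex in register `3`. -/
def trial : SProg :=
  .ite (.sub (.sub (.add (.add (.arr 7 (.reg 2)) (.arr 7 (.reg 3))) (neE 2 3)) (adjE 2 3)) (.lit 2))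
    (.seq (copyArr 7 10) (.seq (.set 9 (.reg 8)) (.seq (.forN 4 (.forN 5 cascadeStep))
      (.seq checkNbrs (.ite (.reg 10)
        (.seq (remove 10 9 2) (.seq (.store 8 (.reg 2) (.reg 3)) (.seq (.set 8 (.reg 9))
          (copyArr 10 7)))) .skip)))))
    .skip

/-- Between two trials. -/
structure Main (n : ℕ) (adj : ℕ → ℕ → Prop) (H : Finset ℕ) (cp : ℕ → ℤ) (L : List ℕ)
    (s : RState) : Prop where
  table : Table n adj s
  stage : Stage n adj H 7 8 cp L s
  cell : ∀ w < n, s.arr 8 w = cp w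
  fresh : ∀ w, w ∉ L → cp w = -1

theorem Main.congr {cp : ℕ → ℤ} {L : List ℕ} {s s' : RState} (h : Main n adj H cp L s)
    (h0 : s'.reg 0 = s.reg 0) (h8 : s'.reg 8 = s.reg 8) (harr : s'.arr = s.arr) :
    Main n adj H cp L s' :=
  ⟨h.table.congr h0 (by rw [harr]) (by rw [harr]),
    h.stage.congr (by rw [harr]) (by rw [harr]) h8, by rw [harr]; exact h.cell, h.fresh⟩

/-- The cascade works on a copy of the mask and appends to the common order array beyond position
`L.length`. Discarding a failed trial thus needs no repair: the old length still describes the old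
prefix. A success copies mask and length back and records the copy mark. -/
theorem Main.run_trial {cp : ℕ → ℤ} {L : List ℕ} {s : RState} (h : Main n adj H cp L s)
    (hH : H.card ≤ n) (hun : u < n) (hbn : b < n) (h2 : s.reg 2 = u) (h3 : s.reg 3 = b) :
    ∃ cp' L', L <:+ L' ∧ Main n adj H cp' L' (trial.run n s) ∧
      (u ∈ alive H L → b ∈ alive H L → u ≠ b → ¬ adj u b → Reducible adj (alive H L) u b →
        L' ≠ L) := by
  have hn := eval_neE h2 h3
  have ha := h.table.eval_adjE h2 h3 hun hbn
  have hiff : 0 < (RExpr.sub (.sub (.add (.add (.arr 7 (.reg 2)) (.arr 7 (.reg 3))) (neE 2 3))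
      (adjE 2 3)) (.lit 2)).eval s ↔ u ∈ alive H L ∧ b ∈ alive H L ∧ u ≠ b ∧ ¬ adj u b := by
    simp only [RExpr.eval, hn, ha, h2, h3, h.stage.mask.cell u hun, h.stage.mask.cell b hbn]
    clear * -
    split_ifs <;> constructor <;> intro hh <;>
      first
      | (norm_num at hh; done)
      | exact ⟨by assumption, by assumption, by assumption, by assumption⟩
      | (norm_num; done)
      | (exfalso; obtain ⟨_, _, _, _⟩ := hh; contradiction)
  unfold trial
  rw [SProg.run]
  by_cases hcond : u ∈ alive H L ∧ b ∈ alive H L ∧ u ≠ b ∧ ¬ adj u b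
  swap
  · rw [if_neg fun hh => hcond (hiff.1 hh), SProg.run]
    exact ⟨cp, L, List.suffix_rfl, h, fun h4 h5 h6 h7 => absurd ⟨h4, h5, h6, h7⟩ hcond⟩
  rw [if_pos (hiff.2 hcond)]
  obtain ⟨hu, hb, hub, hadj⟩ := hcond
  have huL := (mem_alive.1 hu).2
  have hbL := (mem_alive.1 hb).2
  rw [SProg.run]
  have hF1 := SProg.frame_run n (copyArr 7 10) s
  have hC1 := copyArr_run (n := n) (a := 7) (b := 10) (by decide) s
  set s1 := (copyArr 7 10).run n s
  rw [SProg.run]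
  have hF2 := SProg.frame_run n (.set 9 (.reg 8)) s1
  have h9 : ((SProg.set 9 (.reg 8)).run n s1).reg 9 = L.length := by
    simp only [SProg.run, RExpr.eval]
    rw [RState.setReg_reg, if_pos rfl, hF1.reg 8 (by decide), h.stage.length]
  set s2 := (SProg.set 9 (.reg 8)).run n s1
  have harr2 : s2.arr = s1.arr := funext fun a => hF2.arr a (by simp [SProg.arrs])
  -- The mark counts as set for the reasoning throughout the cascade; array `8` receives it only
  -- when the trial succeeds.
  set cp' : ℕ → ℤ := Function.update cp u b with hcp'
  have hTr : Trial n adj H u b cp' L s2 := by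
    refine ⟨(h.table.frame hF1 (by decide) (by decide) (by decide)).frame hF2 (by decide)
      (by decide) (by decide), ⟨h.stage.elim.congr (fun w hw => ?_) fun w c hw => ?_,
      ⟨h.stage.mask.lt, fun x hx => ?_⟩, h9, h.stage.order.congr fun i hi => ?_⟩,
      fun w hw hwu => ?_, hu, hb, by simp [hcp'], ?_, ?_⟩
    · rw [hcp', Function.update_of_ne]
      rintro rfl; exact huL hw
    · rw [hcp', Function.update_of_ne, hw]
      rintro rfl
      have := h.fresh w huL
      omega
    · rw [harr2, hC1 x hx, h.stage.mask.cell x hx]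
    · rw [harr2, hF1.arr 9 (by decide)]
    · rw [hcp', Function.update_of_ne hwu, h.fresh w hw]
    · rw [hF2.reg 2 (by decide), hF1.reg 2 (by decide), h2]
    · rw [hF2.reg 3 (by decide), hF1.reg 3 (by decide), h3]
  have h7 : s2.arr 7 = s.arr 7 := by rw [harr2, hF1.arr 7 (by decide)]
  have h8 : s2.arr 8 = s.arr 8 := by rw [harr2, hF1.arr 8 (by decide)]
  have hr8 : s2.reg 8 = s.reg 8 := by rw [hF2.reg 8 (by decide), hF1.reg 8 (by decide)]
  rw [SProg.run]
  obtain ⟨L1, hL1, hT1, hst⟩ := hTr.cascade hun hbn hub hH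
  have hF3 := SProg.frame_run n (.forN 4 (.forN 5 cascadeStep)) s2
  set s3 := (SProg.forN 4 (.forN 5 cascadeStep)).run n s2
  rw [SProg.run]
  have hchk := checkNbrs_run hT1.table hT1.stage.mask hun hbn hT1.reg_u hT1.reg_b
  have hF4 := SProg.frame_run n checkNbrs s3
  set s4 := checkNbrs.run n s3
  have harr4 : s4.arr = s3.arr := funext fun a => hF4.arr a (by simp [checkNbrs, SProg.arrs])
  rw [SProg.run]
  simp only [RExpr.eval, hchk]
  have hT4 : Trial n adj H u b cp' L1 s4 :=
    ⟨hT1.table.frame hF4 (by decide) (by decide) (by decide),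
      hT1.stage.congr (by rw [harr4]) (by rw [harr4]) (hF4.reg 9 (by decide)), hT1.fresh,
      hT1.u_mem, hT1.b_mem, hT1.copy, (hF4.reg 2 (by decide)).trans hT1.reg_u,
      (hF4.reg 3 (by decide)).trans hT1.reg_b⟩
  have h74 : s4.arr 7 = s.arr 7 := by rw [harr4, hF3.arr 7 (by decide), h7]
  have h84 : s4.arr 8 = s.arr 8 := by rw [harr4, hF3.arr 8 (by decide), h8]
  by_cases hok : ∀ x ∈ alive H L1, adj u x → adj b x
  swap
  · rw [if_neg hok, if_neg (by norm_num), SProg.run]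
    refine ⟨cp, L, List.suffix_rfl, ⟨hT4.table, ⟨h.stage.elim, h.stage.mask.congr h74, ?_,
      hT4.stage.order.of_suffix hL1⟩, by rw [h84]; exact h.cell, h.fresh⟩,
      fun _ _ _ _ hred => absurd (hred _ (alive_subset hL1) hT1.u_mem hT1.b_mem
        (fun w hw h5 h6 => hst w hw h5 h6)) hok⟩
    rw [hF4.reg 8 (by decide), hF3.reg 8 (by decide), hr8, h.stage.length]
  rw [if_pos hok, if_pos (by norm_num)]
  rw [SProg.run]
  have hrem : Removable adj cp' (alive H L1) u :=
    Or.inr ⟨b, hT1.b_mem, hT1.copy, hub.symm, hok⟩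
  have hS5 := hT4.stage.remove (n := n) (v := 2) (by decide) hT4.reg_u hT4.u_mem hrem
  have hF5 := SProg.frame_run n (remove 10 9 2) s4
  set s5 := (remove 10 9 2).run n s4
  rw [SProg.run]
  have hF6 := SProg.frame_run n (.store 8 (.reg 2) (.reg 3)) s5
  have h86 : ∀ w : ℕ, ((SProg.store 8 (.reg 2) (.reg 3)).run n s5).arr 8 w =
      if w = u then (b : ℤ) else s.arr 8 w := by
    intro w
    simp only [SProg.run, RExpr.eval]
    rw [RState.setCell_arr, hF5.reg 2 (by decide), hF5.reg 3 (by decide), hT4.reg_u, hT4.reg_b,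
      hF5.arr 8 (by decide), h84]
    simp
  set s6 := (SProg.store 8 (.reg 2) (.reg 3)).run n s5
  rw [SProg.run]
  have hF7 := SProg.frame_run n (.set 8 (.reg 9)) s6
  have h87 : ((SProg.set 8 (.reg 9)).run n s6).reg 8 = s6.reg 9 := by
    simp [SProg.run]
  set s7 := (SProg.set 8 (.reg 9)).run n s6
  have harr7 : s7.arr = s6.arr := funext fun a => hF7.arr a (by simp [SProg.arrs])
  have hF8 := SProg.frame_run n (copyArr 10 7) s7
  have hC8 := copyArr_run (n := n) (a := 10) (b := 7) (by decide) s7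
  set s8 := (copyArr 10 7).run n s7
  refine ⟨cp', u :: L1, hL1.trans (List.suffix_cons _ _), ⟨?_, ⟨hS5.elim, ⟨hS5.mask.lt,
    fun x hx => ?_⟩, ?_, hS5.order.congr fun i _ => ?_⟩, fun w hw => ?_, fun w hw => ?_⟩,
    fun _ _ _ _ _ hh => ?_⟩
  · exact (((hT4.table.frame hF5 (by decide) (by decide) (by decide)).frame hF6 (by decide)
      (by decide) (by decide)).frame hF7 (by decide) (by decide) (by decide)).frame hF8 (by decide)
      (by decide) (by decide)
  · rw [hC8 x hx, harr7, hF6.arr 10 (by decide), hS5.mask.cell x hx]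
  · rw [hF8.reg 8 (by decide), h87, hF6.reg 9 (by decide), hS5.length]
  · rw [hF8.arr 9 (by decide), harr7, hF6.arr 9 (by decide)]
  · rw [hF8.arr 8 (by decide), harr7, h86, hcp', Function.update_apply]
    split_ifs
    · rfl
    · exact h.cell w hw
  · simp only [List.mem_cons, not_or] at hw
    exact hT1.fresh w hw.2 hw.1
  · have := hL1.length_le
    rw [← hh] at this
    simp at this

end

end Cannonball

/-! ### Complete elimination, and coloring in reverse order -/

namespace Cannonball

open scoped Classical

theorem _root_.SProg.run_seq (n : ℕ) (P Q : SProg) (s : RState) :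
    (SProg.seq P Q).run n s = Q.run n (P.run n s) := rfl

section

variable {n : ℕ} {adj : ℕ → ℕ → Prop} {H : Finset ℕ}

/-- Whether `u` can be eliminated with the color of `b`. -/
def GoodPair (adj : ℕ → ℕ → Prop) (A : Finset ℕ) (u b : ℕ) : Prop :=
  u ∈ A ∧ b ∈ A ∧ u ≠ b ∧ ¬ adj u b ∧ Reducible adj A u b

theorem _root_.List.IsSuffix.eq_of_trans {L L' L'' : List ℕ} (h : L <:+ L') (h' : L' <:+ L'')
    (h'' : L'' = L) : L' = L := by
  subst h''
  exact (h'.eq_of_length_le h.length_le)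

theorem Main.run_trialRow {cp : ℕ → ℤ} {L : List ℕ} {s : RState} {u : ℕ} (h : Main n adj H cp L s)
    (hH : H.card ≤ n) (hun : u < n) (h2 : s.reg 2 = u) :
    ∃ cp' L', L <:+ L' ∧ Main n adj H cp' L' ((SProg.forN 3 trial).run n s) ∧
      (L' = L → ∀ b < n, ¬ GoodPair adj (alive H L) u b) := by
  obtain ⟨s', hs', ⟨cp', L', hL', hM, hg⟩, hF⟩ := SProg.forN_rule (n := n) (r := 3)
    (P := trial) (s := s)
    (fun i s' => ∃ cp' L', L <:+ L' ∧ Main n adj H cp' L' s' ∧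
      (L' = L → ∀ b < i, ¬ GoodPair adj (alive H L) u b))
    ⟨cp, L, List.suffix_rfl, h, by simp⟩ (by
      rintro i hi s' hF ⟨cp', L', hL', hM, hg⟩
      obtain ⟨cp'', L'', hL'', hM', hg'⟩ := (hM.congr (s' := s'.setReg 3 i) (by simp) (by simp)
        rfl).run_trial (u := u) (b := i) hH hun hi
        (by rw [RState.setReg_reg, if_neg (by decide), hF.reg 2 (by decide), h2]) (by simp)
      refine ⟨cp'', L'', hL'.trans hL'', hM', fun hh b hb hgood => ?_⟩
      have h1 := hL'.eq_of_trans hL'' hh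
      by_cases hbi : b = i
      · subst hbi; subst h1
        exact hg' hgood.1 hgood.2.1 hgood.2.2.1 hgood.2.2.2.1 hgood.2.2.2.2 hh
      · exact hg h1 b (by omega) hgood)
  refine ⟨cp', L', hL', ?_, hg⟩
  rw [hs']
  exact hM.congr (by simp) (by simp) rfl

theorem Main.run_trials {cp : ℕ → ℤ} {L : List ℕ} {s : RState} (h : Main n adj H cp L s)
    (hH : H.card ≤ n) :
    ∃ cp' L', L <:+ L' ∧ Main n adj H cp' L' ((SProg.forN 2 (.forN 3 trial)).run n s) ∧
      (L' = L → ∀ u < n, ∀ b < n, ¬ GoodPair adj (alive H L) u b) := by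
  obtain ⟨s', hs', ⟨cp', L', hL', hM, hg⟩, hF⟩ := SProg.forN_rule (n := n) (r := 2)
    (P := .forN 3 trial) (s := s)
    (fun i s' => ∃ cp' L', L <:+ L' ∧ Main n adj H cp' L' s' ∧
      (L' = L → ∀ u < i, ∀ b < n, ¬ GoodPair adj (alive H L) u b))
    ⟨cp, L, List.suffix_rfl, h, by simp⟩ (by
      rintro i hi s' hF ⟨cp', L', hL', hM, hg⟩
      obtain ⟨cp'', L'', hL'', hM', hg'⟩ := (hM.congr (s' := s'.setReg 2 i) (by simp) (by simp)
        rfl).run_trialRow (u := i) hH hi (by simp)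
      refine ⟨cp'', L'', hL'.trans hL'', hM', fun hh u hu b hb => ?_⟩
      have h1 := hL'.eq_of_trans hL'' hh
      by_cases hui : u = i
      · subst hui; subst h1
        exact hg' hh b hb
      · exact hg h1 u (by omega) b hb)
  refine ⟨cp', L', hL', ?_, hg⟩
  rw [hs']
  exact hM.congr (by simp) (by simp) rfl

theorem Main.run_peelLow {cp : ℕ → ℤ} {L : List ℕ} {s : RState} (h : Main n adj H cp L s) :
    ∃ L', L <:+ L' ∧ Main n adj H cp L' (peelLow.run n s) ∧
      (L' = L → ∀ w ∈ alive H L, 3 ≤ ((alive H L).filter (adj w)).card) := by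
  obtain ⟨L', hL', hS, hd⟩ := peelLow_run h.table h.stage h.fresh
  have hF := SProg.frame_run n peelLow s
  refine ⟨L', hL', ⟨h.table.frame hF (by decide) (by decide) (by decide), hS, ?_,
    fun w hw => h.fresh w fun hh => hw (hL'.subset hh)⟩, hd⟩
  rw [hF.arr 8 (by decide)]
  exact h.cell

/-- Find an elimination order of all marked vertices. -/
def eliminate : SProg :=
  .seq (.set 8 (.lit 0)) (.forN 1 (.seq peelLow (.forN 2 (.forN 3 trial))))

/-- Every round that does not empty the set lengthens the order. As no order exceeds `H.card ≤ n`,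
after `n` rounds nothing remains. -/
theorem eliminate_run {s : RState} (hT : Table n adj s) (hm : Mask n 7 H s)
    (hcp : ∀ w < n, s.arr 8 w = -1)
    (hprog : ∀ A ⊆ H, A.Nonempty → (∀ w ∈ A, 3 ≤ (A.filter (adj w)).card) →
      ∃ u b, GoodPair adj A u b) :
    ∃ cp L, Main n adj H cp L (eliminate.run n s) ∧ alive H L = ∅ := by
  have hH : H.card ≤ n := by
    have := Finset.card_le_card (show H ⊆ Finset.range n from fun x hx => by simpa using hm.lt x hx)
    simpa using this
  have hnil : alive H [] = H := by ext; simp [mem_alive]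
  unfold eliminate
  rw [SProg.run]
  have h0 : Main n adj H (fun _ => -1) [] ((SProg.set 8 (.lit 0)).run n s) :=
    ⟨hT.setReg (by decide) _, ⟨trivial, by rw [hnil]; exact hm.congr rfl, by simp [SProg.run],
      trivial⟩, hcp, by simp⟩
  obtain ⟨s', hs', ⟨cp, L, hM, hI⟩, -⟩ := SProg.forN_rule (n := n) (r := 1)
    (P := .seq peelLow (.forN 2 (.forN 3 trial)))
    (s := (SProg.set 8 (.lit 0)).run n s)
    (fun i s' => ∃ cp L, Main n adj H cp L s' ∧ (i ≤ L.length ∨ alive H L = ∅))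
    ⟨_, [], h0, by simp⟩ (by
      rintro i hi s' hF ⟨cp, L, hM, hI⟩
      obtain ⟨L1, hL1, hM1, hd1⟩ :=
        (hM.congr (s' := s'.setReg 1 i) (by simp) (by simp) rfl).run_peelLow
      obtain ⟨cp2, L2, hL2, hM2, hg2⟩ := hM1.run_trials hH
      refine ⟨cp2, L2, hM2, ?_⟩
      by_cases hem : alive H L2 = ∅
      · exact Or.inr hem
      left
      have hne : (alive H L).Nonempty :=
        (Finset.nonempty_iff_ne_empty.2 hem).mono (alive_subset (hL1.trans hL2))
      have hI' := hI.resolve_right (Finset.nonempty_iff_ne_empty.1 hne)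
      have hlen := (hL1.trans hL2).length_le
      rcases hlen.lt_or_eq with h1 | h1
      · omega
      · exfalso
        -- In an idle round `peelLow` certifies that all degrees are at least three, so a good pair
        -- exists, while the trials certify that there is none.
        have h2 := ((hL1.trans hL2).eq_of_length h1).symm
        have h3 := hL1.eq_of_trans hL2 h2
        subst h3
        obtain ⟨u, b, hgood⟩ := hprog (alive H L1) (Finset.filter_subset _ _) hne (hd1 rfl)
        exact hg2 h2 u (hm.lt u (mem_alive.1 hgood.1).1) b (hm.lt b (mem_alive.1 hgood.2.1).1)
          hgood)
  refine ⟨cp, L, ?_, ?_⟩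
  · rw [hs']
    exact hM.congr (by simp) (by simp) rfl
  · refine hI.elim (fun hle => ?_) id
    have hsub : L.toFinset ⊆ H := fun x hx => hM.stage.elim.subset x (List.mem_toFinset.1 hx)
    have heq := Finset.eq_of_subset_of_card_le hsub
      (by rw [List.toFinset_card_of_nodup hM.stage.elim.nodup]; omega)
    ext x
    rw [mem_alive, ← heq]
    simp

/-- Give the vertex in register `5` the least color of none of its neighbors. -/
def freeColor : SProg :=
  .seq (.store 12 (.lit 1) (.lit 0)) (.seq (.store 12 (.lit 2) (.lit 0))
    (.seq (.store 12 (.lit 3) (.lit 0))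
    (.seq (.forN 6 (.ite (adjE 5 6) (.store 12 (.arr 11 (.reg 6)) (.lit 1)) .skip))
    (.ite (.arr 12 (.lit 1)) (.ite (.arr 12 (.lit 2)) (.store 11 (.reg 5) (.lit 3))
      (.store 11 (.reg 5) (.lit 2))) (.store 11 (.reg 5) (.lit 1))))))

/-- Vertices without a color carry `0`. They only mark cell `0` of array `12`, which is never
consulted, so all `x < n` may be scanned. -/
theorem freeColor_run {s : RState} {w : ℕ} (hT : Table n adj s) (hw : s.reg 5 = w) (hwn : w < n)
    (hex : ∃ c : ℤ, (c = 1 ∨ c = 2 ∨ c = 3) ∧ ∀ x < n, adj w x → s.arr 11 x ≠ c) :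
    ∃ c : ℤ, (c = 1 ∨ c = 2 ∨ c = 3) ∧ (∀ x < n, adj w x → s.arr 11 x ≠ c) ∧
      ∀ x : ℕ, (freeColor.run n s).arr 11 x = if x = w then c else s.arr 11 x := by
  unfold freeColor
  rw [SProg.run_seq, SProg.run_seq, SProg.run_seq, SProg.run_seq]
  set s1 := (SProg.store 12 (.lit 3) (.lit 0)).run n ((SProg.store 12 (.lit 2) (.lit 0)).run n
    ((SProg.store 12 (.lit 1) (.lit 0)).run n s)) with hs1
  have hT1 : Table n adj s1 := hT.congr rfl rfl rfl
  have h11 : s1.arr 11 = s.arr 11 := rfl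
  have h12 : s1.arr 12 1 = 0 ∧ s1.arr 12 2 = 0 ∧ s1.arr 12 3 = 0 := by
    simp [hs1, SProg.run]
  have h5 : s1.reg 5 = w := hw
  clear_value s1
  obtain ⟨s', hs', hI, hF⟩ := SProg.forN_rule (n := n) (r := 6)
    (P := .ite (adjE 5 6) (.store 12 (.arr 11 (.reg 6)) (.lit 1)) .skip) (s := s1)
    (fun i s' => ∀ c : ℤ, (c = 1 ∨ c = 2 ∨ c = 3) →
      s'.arr 12 c = if ∃ x < i, adj w x ∧ s.arr 11 x = c then 1 else 0)
    (by rintro c (rfl | rfl | rfl) <;> simp [h12]) (by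
      intro i hi s' hF hI c hc
      have hT2 : Table n adj (s'.setReg 6 i) :=
        (hT1.frame hF (by decide) (by decide) (by decide)).setReg (by decide) _
      have ha := hT2.eval_adjE (r := 5) (q := 6) (i := w) (j := i)
        (by rw [RState.setReg_reg, if_neg (by decide), hF.reg 5 (by decide), h5]) (by simp) hwn hi
      have h6 : (s'.setReg 6 i).reg 6 = i := by simp
      have h11' : s'.arr 11 = s.arr 11 := by rw [hF.arr 11 (by decide), h11]
      rw [SProg.run, ha]
      have hsucc : (∃ x < i + 1, adj w x ∧ s.arr 11 x = c) ↔
          (∃ x < i, adj w x ∧ s.arr 11 x = c) ∨ (adj w i ∧ s.arr 11 i = c) := by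
        constructor
        · rintro ⟨x, hx, h1⟩
          by_cases hxi : x = i
          · exact Or.inr (hxi ▸ h1)
          · exact Or.inl ⟨x, by omega, h1⟩
        · rintro (⟨x, hx, h1⟩ | h1)
          · exact ⟨x, by omega, h1⟩
          · exact ⟨i, by omega, h1⟩
      by_cases hadj : adj w i
      · rw [if_pos hadj, if_pos (by norm_num), SProg.run]
        simp only [RExpr.eval, RState.setCell_arr, RState.setReg_arr, h6, h11', hI c hc, hsucc]
        by_cases h7 : c = s.arr 11 i
        · simp [h7, hadj]
        · simp [h7, Ne.symm h7]
      · rw [if_neg hadj, if_neg (by norm_num), SProg.run]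
        simp only [RState.setReg_arr, hI c hc, hsucc]
        simp [hadj])
  have h5' : (s'.setReg 6 n).reg 5 = w := by
    rw [RState.setReg_reg, if_neg (by decide), hF.reg 5 (by decide), h5]
  have h11' : (s'.setReg 6 n).arr 11 = s.arr 11 := by
    rw [RState.setReg_arr, hF.arr 11 (by decide), h11]
  have hused : ∀ c : ℤ, (c = 1 ∨ c = 2 ∨ c = 3) →
      (0 < (s'.setReg 6 n).arr 12 c ↔ ∃ x < n, adj w x ∧ s.arr 11 x = c) := by
    intro c hc
    rw [RState.setReg_arr, hI c hc]
    split_ifs with h7 <;> simp [h7]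
  rw [hs', SProg.run]
  simp only [RExpr.eval, hused 1 (by simp)]
  have hfin : ∀ c : ℤ, ∀ x : ℕ, ((SProg.store 11 (.reg 5) (.lit c)).run n (s'.setReg 6 n)).arr 11 x =
      if x = w then c else s.arr 11 x := by
    intro c x
    simp only [SProg.run, RExpr.eval]
    rw [RState.setCell_arr, h5', h11']
    simp
  by_cases h1 : ∃ x < n, adj w x ∧ s.arr 11 x = 1
  · rw [if_pos h1, SProg.run]
    simp only [RExpr.eval, hused 2 (by simp)]
    by_cases h2 : ∃ x < n, adj w x ∧ s.arr 11 x = 2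
    · rw [if_pos h2]
      refine ⟨3, by simp, ?_, hfin 3⟩
      obtain ⟨c, hc | hc | rfl, hc'⟩ := hex
      · obtain ⟨x, hx, hwx, h3⟩ := h1
        exact absurd (h3.trans hc.symm) (hc' x hx hwx)
      · obtain ⟨x, hx, hwx, h3⟩ := h2
        exact absurd (h3.trans hc.symm) (hc' x hx hwx)
      · exact hc'
    · rw [if_neg h2]
      exact ⟨2, by simp, fun x hx hwx h3 => h2 ⟨x, hx, hwx, h3⟩, hfin 2⟩
  · rw [if_neg h1]
    exact ⟨1, by simp, fun x hx hwx h3 => h1 ⟨x, hx, hwx, h3⟩, hfin 1⟩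

/-- Color the next vertex, the vertices eliminated later being colored. -/
def colorStep : SProg :=
  .seq (.set 5 (.arr 9 (.sub (.sub (.reg 8) (.lit 1)) (.reg 1))))
    (.ite (.add (.arr 8 (.reg 5)) (.lit 1))
      (.store 11 (.reg 5) (.arr 11 (.arr 8 (.reg 5)))) freeColor)

def colorAll : SProg := .forN 1 (.ite (.sub (.reg 8) (.reg 1)) colorStep .skip)

/-- The list has the last eliminated vertex in front. After `i` steps the colored vertices are those
alive once `L.drop i` is eliminated, so the next vertex meets exactly the set for which it was
declared removable. -/
theorem colorAll_run {cp : ℕ → ℤ} {L : List ℕ} {s : RState} (hsymm : ∀ i j, adj i j → adj j i)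
    (hirr : ∀ i, ¬ adj i i) (h : Main n adj H cp L s) (hal : alive H L = ∅)
    (hHn : ∀ x ∈ H, x < n) (hcol : ∀ x < n, s.arr 11 x = 0) :
    ∃ col : ℕ → ℤ, (∀ x < n, (colorAll.run n s).arr 11 x = col x) ∧
      (∀ x ∈ H, col x = 1 ∨ col x = 2 ∨ col x = 3) ∧
      ∀ x ∈ H, ∀ y ∈ H, adj x y → col x ≠ col y := by
  have hH : H.card ≤ n := by
    have := Finset.card_le_card (show H ⊆ Finset.range n from fun x hx => by simpa using hHn x hx)
    simpa using this
  obtain ⟨s', hs', ⟨hC, h0⟩, hF⟩ := SProg.forN_rule (n := n) (r := 1)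
    (P := .ite (.sub (.reg 8) (.reg 1)) colorStep .skip) (s := s)
    (fun i s' => Colored adj cp (alive H (L.drop i)) (fun x => s'.arr 11 x) ∧
      ∀ x < n, x ∉ alive H (L.drop i) → s'.arr 11 x = 0)
    ⟨by rw [List.drop_zero, hal]; exact ⟨by simp, by simp, by simp⟩, fun x hx _ => hcol x hx⟩ (by
      rintro i hi s' hF ⟨hC, h0⟩
      have h8 : (s'.setReg 1 i).reg 8 = L.length := by
        rw [RState.setReg_reg, if_neg (by decide), hF.reg 8 (by decide), h.stage.length]
      have h1 : (s'.setReg 1 i).reg 1 = i := by simp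
      rw [SProg.run]
      simp only [RExpr.eval, h8, h1]
      by_cases hiL : i < L.length
      swap
      · rw [if_neg (by omega), SProg.run]
        rw [List.drop_of_length_le (by omega)] at hC h0 ⊢
        exact ⟨hC, h0⟩
      rw [if_pos (by omega)]
      have hdrop := List.drop_eq_getElem_cons hiL
      set w := L[i]
      have hsuf : w :: L.drop (i + 1) <:+ L := hdrop ▸ List.drop_suffix i L
      have helim := h.stage.elim.of_suffix hsuf
      have hord : s.arr 9 ((L.length : ℤ) - 1 - i) = w := by
        rw [← (h.stage.order.of_suffix hsuf).1]
        congr 1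
        rw [List.length_drop]
        omega
      obtain ⟨-, hwA, hrem⟩ := helim
      have hwn := hHn w (mem_alive.1 hwA).1
      rw [hdrop, alive_cons] at hC h0
      set A := alive H (L.drop (i + 1))
      have hA : A = insert w (A.erase w) := (Finset.insert_erase hwA).symm
      unfold colorStep
      rw [SProg.run]
      set s1 := (SProg.set 5 (.arr 9 (.sub (.sub (.reg 8) (.lit 1)) (.reg 1)))).run n
        (s'.setReg 1 i) with hs1
      have hT1 : Table n adj s1 :=
        ((h.table.frame hF (by decide) (by decide) (by decide)).setReg (by decide) _).setReg
          (by decide) _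
      have harr1 : s1.arr = s'.arr := rfl
      have h5 : s1.reg 5 = w := by
        rw [hs1, SProg.run]
        simp only [RExpr.eval, h8, h1, RState.setReg_arr, hF.arr 9 (by decide), hord]
        simp
      have hcell : s1.arr 8 w = cp w := by
        rw [harr1, hF.arr 8 (by decide), h.cell w hwn]
      clear_value s1
      rw [SProg.run]
      simp only [RExpr.eval, h5, hcell]
      have hA' : ∀ x ∈ A.erase w, x < n := fun x hx =>
        hHn x (mem_alive.1 (Finset.mem_of_mem_erase hx)).1
      -- Free colors and copied colors extend the invariant in the same way.
      have hfinish : ∀ (t : RState) (c : ℤ), (c = 1 ∨ c = 2 ∨ c = 3) →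
          (∀ x ∈ A.erase w, adj w x → s'.arr 11 x ≠ c) →
          (∀ x : ℕ, t.arr 11 x = if x = w then c else s'.arr 11 x) →
          (cp w = -1 ∨ ∃ b ∈ A.erase w, cp w = b ∧ c = s'.arr 11 b) →
          Colored adj cp A (fun x => t.arr 11 x) ∧ ∀ x < n, x ∉ A → t.arr 11 x = 0 := by
        intro t c hc hp ht hcw
        constructor
        · rw [hA]
          have htw : t.arr 11 w = c := by rw [ht, if_pos rfl]
          refine hC.insert hsymm hirr (fun x hx => ?_) (by simpa [htw] using hc)
            (fun x hx hwx => ?_) (by simpa only [htw] using hcw)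
          · show t.arr 11 x = _
            rw [ht, if_neg (Finset.ne_of_mem_erase hx)]
          · show s'.arr 11 x ≠ t.arr 11 w
            rw [htw]; exact hp x hx hwx
        · intro x hx hxA
          have hxw : x ≠ w := by rintro rfl; exact hxA hwA
          rw [ht, if_neg hxw]
          exact h0 x hx fun hh => hxA (Finset.mem_of_mem_erase hh)
      by_cases hcw : cp w = -1
      · rw [if_neg (by omega)]
        obtain ⟨c, hc, hc'⟩ := hC.exists_free hirr hrem hcw
        obtain ⟨c2, hc2, hp2, hrun⟩ := freeColor_run hT1 h5 hwn ⟨c, hc, fun x hx hwx => by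
          rw [harr1]
          by_cases hxA : x ∈ A.erase w
          · exact hc' x hxA hwx
          · rw [h0 x hx hxA]; omega⟩
        rw [harr1] at hp2 hrun
        exact hfinish _ c2 hc2 (fun x hx hwx => hp2 x (hA' x hx) hwx) hrun (Or.inl hcw)
      · obtain ⟨b, hb⟩ : ∃ b : ℕ, cp w = b := by
          rcases hrem with ⟨h2, -⟩ | ⟨b, -, h2, -⟩
          · exact absurd h2 hcw
          · exact ⟨b, h2⟩
        obtain ⟨hbA, hbf⟩ := hC.copy_free hrem hb
        rw [if_pos (by omega)]
        refine hfinish _ (s'.arr 11 b) (hC.range b hbA) hbf (fun x => ?_) (Or.inr ⟨b, hbA, hb, rfl⟩)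
        rw [SProg.run]
        simp only [RExpr.eval]
        rw [RState.setCell_arr, h5, hcell, hb, harr1]
        simp)
  have hnil : alive H (L.drop n) = H := by
    rw [List.drop_of_length_le (h.stage.elim.length_le.trans hH)]
    ext; simp [mem_alive]
  rw [hnil] at hC
  refine ⟨fun x => s'.arr 11 x, fun x _ => ?_, hC.range, hC.proper⟩
  unfold colorAll
  rw [hs', RState.setReg_arr]

end

end Cannonball

namespace Cannonball

open scoped Classical

/-! ## Reading the input -/

def loadStep : SProg :=
  .seq (.store 1 (.reg 5) (.add (.add (.add (.arr 0 (.reg 10)) (.arr 0 (.reg 10)))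
      (.arr 0 (.reg 10))) (.arr 0 (.add (.reg 10) (.lit 3)))))
  (.seq (.store 2 (.reg 5) (.add (.add (.add (.arr 0 (.add (.reg 10) (.lit 1)))
      (.arr 0 (.add (.reg 10) (.lit 1)))) (.arr 0 (.add (.reg 10) (.lit 1))))
      (.arr 0 (.add (.reg 10) (.lit 3)))))
  (.seq (.store 3 (.reg 5) (.arr 0 (.add (.reg 10) (.lit 2))))
  (.seq (.store 4 (.reg 5) (.arr 0 (.add (.reg 10) (.lit 4))))
  (.seq (.store 5 (.reg 5) (.reg 11))
  (.seq (.set 10 (.add (.reg 10) (.lit 5))) (.set 11 (.add (.reg 11) (.reg 0))))))))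

/-- Load the scaled coordinates and the demands of the vertices. -/
def load : SProg := .seq (.set 10 (.lit 1)) (.seq (.set 11 (.lit 0)) (.forN 5 loadStep))

section

variable {n : ℕ}

/-- The arrays with the scaled coordinates, the demands and the multiples of `n`. -/
structure Loaded (n : ℕ) (P : Layout) (D : ℕ → ℤ) (s : RState) : Prop where
  count : s.reg 0 = n
  x : ∀ i < n, s.arr 1 i = P.X i
  y : ∀ i < n, s.arr 2 i = P.Y i
  z : ∀ i < n, s.arr 3 i = P.Z i
  d : ∀ i < n, s.arr 4 i = D i
  base : ∀ i < n, s.arr 5 i = i * n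

theorem Loaded.frame {P : Layout} {D : ℕ → ℤ} {s s' : RState} (h : Loaded n P D s)
    {Q : SProg} (hQ : SProg.Frame Q s s') (h0 : 0 ∉ Q.regs)
    (h1 : ∀ a ∈ [1, 2, 3, 4, 5], a ∉ Q.arrs) : Loaded n P D s' := by
  refine ⟨(hQ.reg 0 h0).trans h.count, ?_, ?_, ?_, ?_, ?_⟩
  · rw [hQ.arr 1 (h1 1 (by simp))]; exact h.x
  · rw [hQ.arr 2 (h1 2 (by simp))]; exact h.y
  · rw [hQ.arr 3 (h1 3 (by simp))]; exact h.z
  · rw [hQ.arr 4 (h1 4 (by simp))]; exact h.d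
  · rw [hQ.arr 5 (h1 5 (by simp))]; exact h.base

/-- Products are replaced by running sums: register `10` moves through the records in steps of five,
starting after the vertex count, and register `11` accumulates the multiples of `n`. -/
theorem load_run {P : Layout} {D : ℕ → ℤ} {s : RState} {x y l : ℕ → ℤ} (h0 : s.reg 0 = n)
    (hx : ∀ i < n, s.arr 0 (1 + 5 * i) = x i) (hy : ∀ i < n, s.arr 0 (1 + 5 * i + 1) = y i)
    (hz : ∀ i < n, s.arr 0 (1 + 5 * i + 2) = P.Z i) (hl : ∀ i < n, s.arr 0 (1 + 5 * i + 3) = l i)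
    (hd : ∀ i < n, s.arr 0 (1 + 5 * i + 4) = D i)
    (hX : ∀ i < n, P.X i = 3 * x i + l i) (hY : ∀ i < n, P.Y i = 3 * y i + l i) :
    Loaded n P D (load.run n s) := by
  unfold load
  rw [SProg.run_seq, SProg.run_seq]
  obtain ⟨s', hs', ⟨-, -, hI⟩, hF⟩ := SProg.forN_rule (n := n) (r := 5) (P := loadStep)
    (s := (SProg.set 11 (.lit 0)).run n ((SProg.set 10 (.lit 1)).run n s))
    (fun i s' => s'.reg 10 = 1 + 5 * i ∧ s'.reg 11 = i * n ∧ ∀ j < i,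
      s'.arr 1 j = P.X j ∧ s'.arr 2 j = P.Y j ∧ s'.arr 3 j = P.Z j ∧ s'.arr 4 j = D j ∧
        s'.arr 5 j = j * n)
    (by simp [SProg.run]) (by
      rintro i hi s' hF ⟨h10, h11, hI⟩
      have ha0 : s'.arr 0 = s.arr 0 := by rw [hF.arr 0 (by decide)]; simp [SProg.run]
      have hr0 : s'.reg 0 = n := by rw [hF.reg 0 (by decide)]; simp [SProg.run, h0]
      unfold loadStep
      simp only [SProg.run, RExpr.eval]
      simp [h10, h11, ha0, hr0, hx i hi, hy i hi, hz i hi, hl i hi, hd i hi]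
      refine ⟨by ring, by ring, fun j hj => ?_⟩
      by_cases hji : j = i
      · subst hji
        simp only [if_true, hX j hi, hY j hi, and_true]
        constructor <;> ring
      · simpa [hji] using hI j (by omega))
  have h00 : s'.reg 0 = n := by rw [hF.reg 0 (by decide)]; simp [SProg.run, h0]
  rw [hs']
  exact ⟨by simpa using h00, fun i hi => (hI i hi).1, fun i hi => (hI i hi).2.1,
    fun i hi => (hI i hi).2.2.1, fun i hi => (hI i hi).2.2.2.1, fun i hi => (hI i hi).2.2.2.2⟩

/-- Replace register `r` by the maximum of its value and `e`. -/
def raise (r : ℕ) (e : RExpr) : SProg := .ite (.sub e (.reg r)) (.set r e) .skip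

/-- Replace register `r` by the minimum of its value and `e`. -/
def lower (r : ℕ) (e : RExpr) : SProg := .ite (.sub (.reg r) e) (.set r e) .skip

theorem _root_.SProg.run_ite_pos {e : RExpr} {P Q : SProg} {s : RState} (h : 0 < e.eval s) :
    (SProg.ite e P Q).run n s = P.run n s := if_pos h

theorem _root_.SProg.run_ite_neg {e : RExpr} {P Q : SProg} {s : RState} (h : ¬ 0 < e.eval s) :
    (SProg.ite e P Q).run n s = Q.run n s := if_neg h

theorem raise_run (r : ℕ) (e : RExpr) (s : RState) :
    (raise r e).run n s = s.setReg r (max (s.reg r) (e.eval s)) := by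
  unfold raise
  by_cases h : s.reg r < e.eval s
  · rw [SProg.run_ite_pos (by simpa using h), max_eq_right h.le, SProg.run]
  · rw [SProg.run_ite_neg (by simpa using h), max_eq_left (not_lt.1 h), SProg.run,
      RState.setReg_self _ _ _ rfl]

theorem lower_run (r : ℕ) (e : RExpr) (s : RState) :
    (lower r e).run n s = s.setReg r (min (s.reg r) (e.eval s)) := by
  unfold lower
  by_cases h : e.eval s < s.reg r
  · rw [SProg.run_ite_pos (by simpa using h), min_eq_right h.le, SProg.run]
  · rw [SProg.run_ite_neg (by simpa using h), min_eq_left (not_lt.1 h), SProg.run,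
      RState.setReg_self _ _ _ rfl]

/-- The machine cannot multiply, so distance one is tested with the hexagonal norm `M = max(|a|,
|b|, |a + b|)` and `W = |c|`. Neighbors have `M = 3` within a layer and `M = 2` between adjacent
layers; the congruences modulo three exclude all other vectors of these sizes. -/
theorem adj_iff_max {a b c : ℤ} (hab : 3 ∣ a - b) (h0 : c = 0 → 3 ∣ a)
    (h1 : c = 1 ∨ c = -1 → ¬ 3 ∣ a) {M W : ℤ}
    (hM : M = max (max (max (max (max (max 0 a) (-a)) b) (-b)) (a + b)) (-(a + b)))
    (hW : W = max (max 0 c) (-c)) :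
    normNine a b c = 9 ↔ W < 2 ∧ M + W = 3 := by
  constructor
  · intro h
    have := normNine_eq_nine h
    omega
  · rintro ⟨h2, h3⟩
    have ha1 : a ≤ M := by omega
    have ha2 : -a ≤ M := by omega
    have hb1 : b ≤ M := by omega
    have hb2 : -b ≤ M := by omega
    have hab1 : a + b ≤ M := by omega
    have hab2 : -(a + b) ≤ M := by omega
    have hat : M ≤ 0 ∨ M ≤ a ∨ M ≤ -a ∨ M ≤ b ∨ M ≤ -b ∨ M ≤ a + b ∨ M ≤ -(a + b) := by
      by_contra! hlt
      have : M < M := by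
        conv_lhs => rw [hM]
        simp only [max_lt_iff]
        omega
      exact lt_irrefl _ this
    have hc : c = 0 ∨ c = 1 ∨ c = -1 := by omega
    have hW' : W = 0 ∧ c = 0 ∨ W = 1 ∧ (c = 1 ∨ c = -1) := by omega
    clear hM hW
    have hM0 : M ≤ 3 := by omega
    have : -3 ≤ a := by omega
    have : a ≤ 3 := by omega
    have : -3 ≤ b := by omega
    have : b ≤ 3 := by omega
    rcases hW' with ⟨rfl, rfl⟩ | ⟨rfl, hc1⟩
    · have h4 := h0 rfl
      clear h0 h1
      unfold normNine
      interval_cases a <;> interval_cases b <;> first | rfl | (exfalso; omega)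
    · have h4 := h1 hc1
      have h5 : c * c = 1 := by rcases hc1 with rfl | rfl <;> rfl
      have h6 : c ^ 2 = 1 := by rw [sq, h5]
      clear h0 h1
      unfold normNine
      rw [h6]
      interval_cases a <;> interval_cases b <;> first | rfl | (exfalso; omega)

/-- The differences of the coordinates of the vertices in registers `5` and `6`, and their sizes. -/
def differences : SProg :=
  .seq (.set 1 (.sub (.arr 1 (.reg 5)) (.arr 1 (.reg 6))))
  (.seq (.set 2 (.sub (.arr 2 (.reg 5)) (.arr 2 (.reg 6))))
  (.seq (.set 3 (.sub (.arr 3 (.reg 5)) (.arr 3 (.reg 6))))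
  (.seq (.set 4 (.lit 0)) (.seq (raise 4 (.reg 1)) (.seq (raise 4 (.sub (.lit 0) (.reg 1)))
  (.seq (raise 4 (.reg 2)) (.seq (raise 4 (.sub (.lit 0) (.reg 2)))
  (.seq (raise 4 (.add (.reg 1) (.reg 2))) (.seq (raise 4 (.sub (.lit 0) (.add (.reg 1) (.reg 2))))
  (.seq (.set 7 (.lit 0)) (.seq (raise 7 (.reg 3)) (raise 7 (.sub (.lit 0) (.reg 3))))))))))))))

theorem differences_run (s : RState) {a b c : ℤ}
    (ha : s.arr 1 (s.reg 5) - s.arr 1 (s.reg 6) = a) (hb : s.arr 2 (s.reg 5) - s.arr 2 (s.reg 6) = b)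
    (hc : s.arr 3 (s.reg 5) - s.arr 3 (s.reg 6) = c) :
    (differences.run n s).reg 4 =
      max (max (max (max (max (max 0 a) (-a)) b) (-b)) (a + b)) (-(a + b)) ∧
    (differences.run n s).reg 7 = max (max 0 c) (-c) := by
  unfold differences
  simp only [SProg.run, raise_run, RExpr.eval]
  simp [ha, hb, hc]

def adjStep : SProg :=
  .seq differences (.seq (.store 6 (.add (.arr 5 (.reg 5)) (.reg 6)) (.lit 0))
    (.ite (.sub (.lit 2) (.reg 7)) (.ite (.sub (.lit 4) (.add (.reg 4) (.reg 7)))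
      (.ite (.sub (.add (.reg 4) (.reg 7)) (.lit 2))
        (.store 6 (.add (.arr 5 (.reg 5)) (.reg 6)) (.lit 1)) .skip) .skip) .skip))

/-- Compute the adjacency matrix. -/
def adjAll : SProg := .forN 5 (.forN 6 adjStep)

theorem adjStep_run {P : Layout} {D : ℕ → ℤ} {s : RState} {i j : ℕ} (h : Loaded n P D s)
    (hv : P.Valid (Finset.range n)) (hi : i < n) (hj : j < n) (h5 : s.reg 5 = i)
    (h6 : s.reg 6 = j) (t : ℤ) :
    (adjStep.run n s).arr 6 t =
      if t = i * n + j then (if P.Adj i j then 1 else 0) else s.arr 6 t := by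
  obtain ⟨l, hl, hl'⟩ := hv.layers
  have hli := hl' i (by simpa using hi)
  have hlj := hl' j (by simpa using hj)
  obtain ⟨hr4, hr7⟩ := differences_run (n := n) s (a := P.X i - P.X j) (b := P.Y i - P.Y j)
    (c := P.Z i - P.Z j) (by rw [h5, h6, h.x i hi, h.x j hj]) (by rw [h5, h6, h.y i hi, h.y j hj])
    (by rw [h5, h6, h.z i hi, h.z j hj])
  have hiff := adj_iff_max (by omega) (fun hc => by
      have : P.Z i = P.Z j := by omega
      rw [this] at hli; omega) (fun hc => by
      rcases hc with hc | hc
      · have h2 := hl (P.Z j)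
        rw [show P.Z j + 1 = P.Z i by omega] at h2; omega
      · have h2 := hl (P.Z i)
        rw [show P.Z i + 1 = P.Z j by omega] at h2; omega) hr4 hr7
  have hF := SProg.frame_run n differences s
  unfold adjStep
  rw [SProg.run_seq, SProg.run_seq]
  set s1 := differences.run n s
  have h5' : s1.reg 5 = i := (hF.reg 5 (by decide)).trans h5
  have h6' : s1.reg 6 = j := (hF.reg 6 (by decide)).trans h6
  have hb : s1.arr 5 i = i * n := by rw [hF.arr 5 (by decide), h.base i hi]
  have ha6 : s1.arr 6 = s.arr 6 := hF.arr 6 (by decide)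
  unfold Layout.Adj
  clear_value s1
  simp only [hiff]
  set s2 := (SProg.store 6 (.add (.arr 5 (.reg 5)) (.reg 6)) (.lit 0)).run n s1 with hs2
  have hr2 : s2.reg = s1.reg := rfl
  have ha2 : s2.arr 6 t = if t = i * n + j then 0 else s.arr 6 t := by
    simp [hs2, SProg.run, h5', h6', hb, ha6]
  have hb2 : s2.arr 5 i = i * n := by rw [← hb, hs2]; simp [SProg.run]
  clear_value s2
  have e1 : (RExpr.sub (.lit 2) (.reg 7)).eval s2 = 2 - s1.reg 7 := by simp [hr2]
  have e2 : (RExpr.sub (.lit 4) (.add (.reg 4) (.reg 7))).eval s2 =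
    4 - (s1.reg 4 + s1.reg 7) := by simp [hr2]
  have e3 : (RExpr.sub (.add (.reg 4) (.reg 7)) (.lit 2)).eval s2 =
    s1.reg 4 + s1.reg 7 - 2 := by simp [hr2]
  by_cases c1 : s1.reg 7 < 2
  · rw [SProg.run_ite_pos (by omega)]
    by_cases c2 : s1.reg 4 + s1.reg 7 = 3
    · rw [SProg.run_ite_pos (by omega), SProg.run_ite_pos (by omega)]
      simp only [c1, c2, and_self, if_true, SProg.run, RState.setCell_arr, RExpr.eval, hr2, h5',
        h6', hb2, ha2, true_and]
      split_ifs <;> rfl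
    · simp only [c1, c2, and_false, if_false]
      rw [← ha2]
      by_cases c3 : 0 < 4 - (s1.reg 4 + s1.reg 7)
      · rw [SProg.run_ite_pos (by omega), SProg.run_ite_neg (by omega)]; rfl
      · rw [SProg.run_ite_neg (by omega)]; rfl
  · rw [SProg.run_ite_neg (by omega)]
    simp only [c1, false_and, if_false]
    rw [← ha2]; rfl

theorem index_ne {i i' j j' : ℕ} (hj : j < n) (hj' : j' < n) (h : i ≠ i' ∨ j ≠ j') :
    (i : ℤ) * n + j ≠ i' * n + j' := by
  intro he
  have he' : i * n + j = i' * n + j' := by exact_mod_cast he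
  have h1 : i = i' := by
    have := congrArg (· / n) he'
    simp only [mul_comm i n, mul_comm i' n] at this
    rwa [Nat.mul_add_div (by omega), Nat.mul_add_div (by omega), Nat.div_eq_of_lt hj,
      Nat.div_eq_of_lt hj', add_zero, add_zero] at this
  subst h1
  omega

theorem adjAll_run {P : Layout} {D : ℕ → ℤ} {s : RState} (h : Loaded n P D s)
    (hv : P.Valid (Finset.range n)) : Table n P.Adj (adjAll.run n s) := by
  have hFall := SProg.frame_run n adjAll s
  have hL := h.frame hFall (by decide) (by decide)
  refine ⟨hL.count, hL.base, ?_⟩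
  obtain ⟨s', hs', hI, -⟩ := SProg.forN_rule (n := n) (r := 5) (P := .forN 6 adjStep) (s := s)
    (fun i s' => ∀ i' < i, ∀ j < n, s'.arr 6 (i' * n + j) = if P.Adj i' j then 1 else 0)
    (by simp) (by
      intro i hi s1 hF1 hI1
      have hL1 : Loaded n P D (s1.setReg 5 i) :=
        (h.frame hF1 (by decide) (by decide)).frame (Q := .set 5 (.lit 0))
          ⟨fun r hr => by simp [SProg.regs] at hr; simp [hr], by simp, by simp⟩
          (by decide) (by decide)
      obtain ⟨s', hs', ⟨hI2, hI3⟩, -⟩ := SProg.forN_rule (n := n) (r := 6) (P := adjStep)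
        (s := s1.setReg 5 i)
        (fun j s' => (∀ i' < i, ∀ j < n, s'.arr 6 (i' * n + j) = if P.Adj i' j then 1 else 0) ∧
          ∀ j' < j, s'.arr 6 (i * n + j') = if P.Adj i j' then 1 else 0)
        ⟨hI1, by simp⟩ (by
          rintro j hj s2 hF2 ⟨h2, h3⟩
          have hL2 : Loaded n P D (s2.setReg 6 j) :=
            (hL1.frame hF2 (by decide) (by decide)).frame (Q := .set 6 (.lit 0))
              ⟨fun r hr => by simp [SProg.regs] at hr; simp [hr], by simp, by simp⟩
              (by decide) (by decide)
          have hstep := adjStep_run hL2 hv hi hj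
            (by rw [RState.setReg_reg, if_neg (by decide), hF2.reg 5 (by decide)]; simp)
            (by simp)
          refine ⟨fun i' hi' j' hj' => ?_, fun j' hj' => ?_⟩
          · rw [hstep, if_neg (index_ne hj' hj (Or.inl (by omega)))]
            exact h2 i' hi' j' hj'
          · rw [hstep]
            by_cases hjj : j' = j
            · subst hjj; simp
            · rw [if_neg (index_ne (by omega) hj (Or.inr hjj))]
              exact h3 j' (by omega))
      intro i' hi' j hj
      rw [hs', RState.setReg_arr]
      by_cases hii : i' = i
      · subst hii; exact hI3 j hj
      · exact hI2 i' (by omega) j hj)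
  intro i hi j hj
  unfold adjAll
  rw [hs', RState.setReg_arr]
  exact hI i hi j hj

/-- The weight of the clique formed by `i`, by `j` if it is a neighbor, and by `k` if it is a
neighbor of both. -/
noncomputable def cliqueWeight (adj : ℕ → ℕ → Prop) (D : ℕ → ℤ) (i j k : ℕ) : ℤ :=
  D i + if adj i j then D j + if adj i k ∧ adj j k then D k else 0 else 0

def weightStep : SProg :=
  .seq (.set 4 (.arr 4 (.reg 1)))
  (.seq (.ite (adjE 1 2) (.seq (.set 4 (.add (.reg 4) (.arr 4 (.reg 2))))
    (.ite (.sub (.add (adjE 1 3) (adjE 2 3)) (.lit 1))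
      (.set 4 (.add (.reg 4) (.arr 4 (.reg 3)))) .skip)) .skip)
  (raise 10 (.reg 4)))

/-- Compute the largest weight of a clique with at most three vertices. -/
def weightAll : SProg :=
  .seq (.set 10 (.lit 0)) (.forN 1 (.forN 2 (.forN 3 weightStep)))

theorem weightStep_run {adj : ℕ → ℕ → Prop} {D : ℕ → ℤ} {s : RState} {i j k : ℕ}
    (hT : Table n adj s) (hD : ∀ i < n, s.arr 4 i = D i) (hi : i < n) (hj : j < n) (hk : k < n)
    (h1 : s.reg 1 = i) (h2 : s.reg 2 = j) (h3 : s.reg 3 = k) :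
    (weightStep.run n s).reg 10 = max (s.reg 10) (cliqueWeight adj D i j k) := by
  have e12 : ∀ v, (adjE 1 2).eval (s.setReg 4 v) = if adj i j then 1 else 0 := fun v =>
    (hT.setReg (by decide) v).eval_adjE (by simpa using h1) (by simpa using h2) hi hj
  have e13 : ∀ v w, (adjE 1 3).eval ((s.setReg 4 v).setReg 4 w) = if adj i k then 1 else 0 :=
    fun v w => ((hT.setReg (by decide) v).setReg (by decide) w).eval_adjE
      (by simpa using h1) (by simpa using h3) hi hk
  have e23 : ∀ v w, (adjE 2 3).eval ((s.setReg 4 v).setReg 4 w) = if adj j k then 1 else 0 :=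
    fun v w => ((hT.setReg (by decide) v).setReg (by decide) w).eval_adjE
      (by simpa using h2) (by simpa using h3) hj hk
  unfold weightStep cliqueWeight
  simp only [SProg.run, raise_run, RExpr.eval, e12, e13, e23]
  by_cases a1 : adj i j
  · by_cases a2 : adj i k <;> by_cases a3 : adj j k <;>
      simp [a1, a2, a3, h1, h2, h3, hD i hi, hD j hj, hD k hk, add_assoc]
  · simp [a1, h1, hD i hi]

/-- The upper bound makes the coloring proper, and attainment gives `W ≤ ω`. The value `0` covers
the graph without vertices. Cliques with four vertices are not needed. -/
theorem weightAll_run {adj : ℕ → ℕ → Prop} {D : ℕ → ℤ} {s : RState}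
    (hT : Table n adj s) (hD : ∀ i < n, s.arr 4 i = D i) :
    (∀ i < n, ∀ j < n, ∀ k < n, cliqueWeight adj D i j k ≤ (weightAll.run n s).reg 10) ∧
    ((weightAll.run n s).reg 10 = 0 ∨ ∃ i < n, ∃ j < n, ∃ k < n,
      (weightAll.run n s).reg 10 = cliqueWeight adj D i j k) := by
  unfold weightAll
  rw [SProg.run_seq]
  set s0 := (SProg.set 10 (.lit 0)).run n s with hs0
  have hT0 : Table n adj s0 := hT.setReg (by decide) _
  have hD0 : ∀ i < n, s0.arr 4 i = D i := hD
  have h10 : s0.reg 10 = 0 := by simp [hs0, SProg.run]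
  clear_value s0
  have hset : ∀ (t : RState) (r : ℕ) (v : ℤ), r ∈ [1, 2, 3] →
      SProg.Frame (.forN 1 (.forN 2 (.forN 3 weightStep))) t (t.setReg r v) := by
    intro t r v hr
    refine ⟨fun q hq => ?_, fun _ _ => rfl, fun _ => rfl⟩
    have : q ≠ r := by
      rintro rfl
      apply hq
      simp at hr
      rcases hr with rfl | rfl | rfl <;> decide
    simp [this]
  let Att (t : RState) : Prop := t.reg 10 = 0 ∨ ∃ i < n, ∃ j < n, ∃ k < n,
    t.reg 10 = cliqueWeight adj D i j k
  have inner : ∀ (t : RState) (i j : ℕ), i < n → j < n → Table n adj t →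
      (∀ i < n, t.arr 4 i = D i) → t.reg 1 = i → t.reg 2 = j → Att t →
      t.reg 10 ≤ ((SProg.forN 3 weightStep).run n t).reg 10 ∧
      Att ((SProg.forN 3 weightStep).run n t) ∧
      ∀ k < n, cliqueWeight adj D i j k ≤ ((SProg.forN 3 weightStep).run n t).reg 10 := by
    intro t i j hi hj hTt hDt h1 h2 hatt
    obtain ⟨s', hs', hI, -⟩ := SProg.forN_rule (n := n) (r := 3) (P := weightStep) (s := t)
      (fun k s' => t.reg 10 ≤ s'.reg 10 ∧ Att s' ∧ ∀ k' < k, cliqueWeight adj D i j k' ≤ s'.reg 10)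
      ⟨le_rfl, hatt, by simp⟩ (by
        rintro k hk s1 hF ⟨i1, i2, i3⟩
        have hrun := weightStep_run (s := s1.setReg 3 k) ((hTt.frame hF (by decide) (by decide)
          (by decide)).setReg (by decide) _) (D := D)
          (by rw [RState.setReg_arr, hF.arr 4 (by decide)]; exact hDt) hi hj hk
          (by rw [RState.setReg_reg, if_neg (by decide), hF.reg 1 (by decide), h1])
          (by rw [RState.setReg_reg, if_neg (by decide), hF.reg 2 (by decide), h2]) (by simp)
        rw [RState.setReg_reg, if_neg (by decide)] at hrun
        refine ⟨?_, ?_, fun k' hk' => ?_⟩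
        · rw [hrun]; exact i1.trans (le_max_left _ _)
        · show _ ∨ _
          rw [hrun]
          rcases max_choice (s1.reg 10) (cliqueWeight adj D i j k) with hm | hm <;> rw [hm]
          · exact i2
          · exact Or.inr ⟨i, hi, j, hj, k, hk, rfl⟩
        · rw [hrun]
          by_cases hkk : k' = k
          · subst hkk; exact le_max_right _ _
          · exact (i3 k' (by omega)).trans (le_max_left _ _))
    have hr : (s'.setReg 3 n).reg 10 = s'.reg 10 := by simp
    simp only [Att] at hI ⊢
    rw [hs', hr]
    exact hI
  have middle : ∀ (t : RState) (i : ℕ), i < n → Table n adj t →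
      (∀ i < n, t.arr 4 i = D i) → t.reg 1 = i → Att t →
      t.reg 10 ≤ ((SProg.forN 2 (.forN 3 weightStep)).run n t).reg 10 ∧
      Att ((SProg.forN 2 (.forN 3 weightStep)).run n t) ∧
      ∀ j < n, ∀ k < n,
        cliqueWeight adj D i j k ≤ ((SProg.forN 2 (.forN 3 weightStep)).run n t).reg 10 := by
    intro t i hi hTt hDt h1 hatt
    obtain ⟨s', hs', hI, -⟩ := SProg.forN_rule (n := n) (r := 2) (P := .forN 3 weightStep) (s := t)
      (fun j s' => t.reg 10 ≤ s'.reg 10 ∧ Att s' ∧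
        ∀ j' < j, ∀ k < n, cliqueWeight adj D i j' k ≤ s'.reg 10)
      ⟨le_rfl, hatt, by simp⟩ (by
        rintro j hj s1 hF ⟨i1, i2, i3⟩
        have hr : (s1.setReg 2 j).reg 10 = s1.reg 10 := by simp
        obtain ⟨q1, q2, q3⟩ := inner (s1.setReg 2 j) i j hi hj ((hTt.frame hF (by decide)
          (by decide) (by decide)).setReg (by decide) _)
          (by rw [RState.setReg_arr, hF.arr 4 (by decide)]; exact hDt)
          (by rw [RState.setReg_reg, if_neg (by decide), hF.reg 1 (by decide), h1]) (by simp)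
          (by simp only [Att, hr]; exact i2)
        rw [hr] at q1
        refine ⟨i1.trans q1, q2, fun j' hj' k hk => ?_⟩
        by_cases hjj : j' = j
        · subst hjj; exact q3 k hk
        · exact (i3 j' (by omega) k hk).trans q1)
    have hr : (s'.setReg 2 n).reg 10 = s'.reg 10 := by simp
    simp only [Att] at hI ⊢
    rw [hs', hr]
    exact hI
  obtain ⟨s', hs', hI, -⟩ := SProg.forN_rule (n := n) (r := 1)
    (P := .forN 2 (.forN 3 weightStep)) (s := s0)
    (fun i s' => Att s' ∧ ∀ i' < i, ∀ j < n, ∀ k < n, cliqueWeight adj D i' j k ≤ s'.reg 10)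
    ⟨Or.inl h10, by simp⟩ (by
      rintro i hi s1 hF ⟨i2, i3⟩
      have hr : (s1.setReg 1 i).reg 10 = s1.reg 10 := by simp
      obtain ⟨q1, q2, q3⟩ := middle (s1.setReg 1 i) i hi ((hT0.frame hF (by decide)
        (by decide) (by decide)).setReg (by decide) _)
        (by rw [RState.setReg_arr, hF.arr 4 (by decide)]; exact hD0) (by simp)
        (by simp only [Att, hr]; exact i2)
      rw [hr] at q1
      refine ⟨q2, fun i' hi' j hj k hk => ?_⟩
      by_cases hii : i' = i
      · subst hii; exact q3 j hj k hk
      · exact (i3 i' (by omega) j hj k hk).trans q1)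
  have hr : (s'.setReg 1 n).reg 10 = s'.reg 10 := by simp
  simp only [Att] at hI
  rw [hs', hr]
  exact ⟨hI.2, hI.1⟩

end

end Cannonball

namespace Cannonball

open scoped Classical

/-! ## The complete program -/

section

variable {n : ℕ}

/-- The start of the four palettes of size `2 m`, and of the three palettes of size `m`, both
continued cyclically. -/
structure Palettes (m : ℤ) (pal ext : ℤ → ℤ) : Prop where
  pal_zero : pal 0 = 0
  pal_one : pal 1 = 2 * m
  pal_two : pal 2 = 4 * m
  pal_three : pal 3 = 6 * m
  pal_four : pal 4 = 0
  ext_one : ext 1 = 8 * m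
  ext_two : ext 2 = 9 * m
  ext_three : ext 3 = 10 * m
  ext_four : ext 4 = 8 * m
  ext_five : ext 5 = 9 * m

/-- Compute `m` from the maximal weight of a clique, and the starts of the palettes. -/
def palettes : SProg :=
  .seq (.set 11 (.div (.add (.reg 10) (.lit 5)) (.lit 6)))
  (.seq (.set 1 (.add (.reg 11) (.reg 11)))
  (.seq (.set 2 (.add (.reg 1) (.reg 1)))
  (.seq (.set 3 (.add (.reg 2) (.reg 2)))
  (.seq (.store 13 (.lit 0) (.lit 0)) (.seq (.store 13 (.lit 1) (.reg 1))
  (.seq (.store 13 (.lit 2) (.reg 2)) (.seq (.store 13 (.lit 3) (.add (.reg 1) (.reg 2)))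
  (.seq (.store 13 (.lit 4) (.lit 0)) (.seq (.store 14 (.lit 1) (.reg 3))
  (.seq (.store 14 (.lit 2) (.add (.reg 3) (.reg 11)))
  (.seq (.store 14 (.lit 3) (.add (.reg 3) (.reg 1))) (.seq (.store 14 (.lit 4) (.reg 3))
  (.store 14 (.lit 5) (.add (.reg 3) (.reg 11)))))))))))))))

theorem palettes_run (s : RState) :
    (palettes.run n s).reg 11 = (s.reg 10 + 5) / 6 ∧
    Palettes ((s.reg 10 + 5) / 6) ((palettes.run n s).arr 13) ((palettes.run n s).arr 14) := by
  unfold palettes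
  simp only [SProg.run, RExpr.eval]
  refine ⟨by simp, ?_⟩
  constructor <;> simp <;> ring

/-- Mark the vertices with demand greater than `2 m`. -/
def markHeavy : SProg :=
  .forN 5 (.seq (.store 8 (.reg 5) (.lit (-1)))
    (.ite (.sub (.arr 4 (.reg 5)) (.add (.reg 11) (.reg 11)))
      (.store 7 (.reg 5) (.lit 1)) (.store 7 (.reg 5) (.lit 0))))

/-- The vertices that need more colors than the palettes of size `2 m` offer. -/
noncomputable def heavy (n : ℕ) (D : ℕ → ℤ) (m : ℤ) : Finset ℕ :=
  (Finset.range n).filter fun i => m + m < D i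

theorem markHeavy_run {D : ℕ → ℤ} {s : RState} {m : ℤ} (hm : s.reg 11 = m)
    (hD : ∀ i < n, s.arr 4 i = D i) :
    Mask n 7 (heavy n D m) (markHeavy.run n s) ∧ ∀ w < n, (markHeavy.run n s).arr 8 w = -1 := by
  unfold markHeavy
  obtain ⟨s', hs', hI, -⟩ := SProg.forN_rule (n := n) (r := 5)
    (P := .seq (.store 8 (.reg 5) (.lit (-1)))
      (.ite (.sub (.arr 4 (.reg 5)) (.add (.reg 11) (.reg 11)))
        (.store 7 (.reg 5) (.lit 1)) (.store 7 (.reg 5) (.lit 0)))) (s := s)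
    (fun i s' => ∀ w < i, s'.arr 7 w = (if w ∈ heavy n D m then 1 else 0) ∧ s'.arr 8 w = -1)
    (by simp) (by
      intro i hi s1 hF hI w hw
      have h4 : s1.arr 4 i = D i := by rw [hF.arr 4 (by decide), hD i hi]
      have h11 : s1.reg 11 = m := by rw [hF.reg 11 (by decide), hm]
      rw [SProg.run_seq]
      set s2 := (SProg.store 8 (.reg 5) (.lit (-1))).run n (s1.setReg 5 i) with hs2
      have e : (RExpr.sub (.arr 4 (.reg 5)) (.add (.reg 11) (.reg 11))).eval s2 =
          D i - (m + m) := by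
        simp [hs2, SProg.run, h4, h11]
      have hmem : i ∈ heavy n D m ↔ m + m < D i := by simp [heavy, hi]
      have h5 : s2.reg 5 = i := by simp [hs2, SProg.run]
      have h7 : s2.arr 7 = s1.arr 7 := by
        rw [hs2, SProg.run, RState.setCell_arr_of_ne _ _ _ (by decide)]; rfl
      have h8 : s2.arr 8 w = if w = i then -1 else s1.arr 8 w := by simp [hs2, SProg.run]
      clear_value s2
      by_cases hwi : w = i
      · subst hwi
        by_cases h : m + m < D w
        · rw [SProg.run_ite_pos (by omega), if_pos (hmem.2 h)]
          simp [SProg.run, h5, h8]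
        · rw [SProg.run_ite_neg (by omega), if_neg (fun hh => h (hmem.1 hh))]
          simp [SProg.run, h5, h8]
      · have := hI w (by omega)
        by_cases h : m + m < D i
        · rw [SProg.run_ite_pos (by omega)]
          simpa [SProg.run, h5, h8, hwi, h7] using this
        · rw [SProg.run_ite_neg (by omega)]
          simpa [SProg.run, h5, h8, hwi, h7] using this)
  rw [hs']
  exact ⟨⟨fun x hx => by simpa using (Finset.mem_filter.1 hx).1, fun x hx => (hI x hx).1⟩,
    fun w hw => (hI w hw).2⟩

/-- The color intervals of vertex `i` with demand `d`, lattice class `c` and color `e`. -/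
def vertexIntervals (pal ext : ℤ → ℤ) (m d c e : ℤ) (i : ℕ) : List ColorInterval :=
  [⟨i, pal c, pal c + min d (m + m)⟩,
   ⟨i, ext e, ext e + min (d - (m + m)) m⟩,
   ⟨i, ext (e + 1) + m - min (d - (m + m) - m) m, ext (e + 1) + m⟩,
   ⟨i, ext (e + 2), ext (e + 2) + min (d - (m + m) - m - m) m⟩,
   ⟨i, pal (c + 1) + (m + m) - (d - (m + m) - m - m - m), pal (c + 1) + (m + m)⟩]

/-- The parities of two integers as a number between zero and three. -/
def parityClass (a b : ℤ) : ℤ := (a - (a / 2 + a / 2)) + (a - (a / 2 + a / 2)) + (b - (b / 2 + b / 2))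

def parityE (a : ℕ) : RExpr :=
  .sub (.arr a (.reg 5)) (.add (.div (.arr a (.reg 5)) (.lit 2)) (.div (.arr a (.reg 5)) (.lit 2)))

def outInterval (lo hi : RExpr) : SProg := .seq (.out (.reg 5)) (.seq (.out lo) (.out hi))

def outStep : SProg :=
  .seq (.set 2 (.add (.add (parityE 1) (parityE 1)) (parityE 2)))
  (.seq (.set 3 (.arr 11 (.reg 5)))
  (.seq (.set 4 (.add (.reg 11) (.reg 11)))
  (.seq (.set 1 (.sub (.arr 4 (.reg 5)) (.reg 4)))
  (.seq (.set 7 (.arr 4 (.reg 5))) (.seq (lower 7 (.reg 4))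
  (.seq (outInterval (.arr 13 (.reg 2)) (.add (.arr 13 (.reg 2)) (.reg 7)))
  (.seq (.set 7 (.reg 1)) (.seq (lower 7 (.reg 11))
  (.seq (outInterval (.arr 14 (.reg 3)) (.add (.arr 14 (.reg 3)) (.reg 7)))
  (.seq (.set 1 (.sub (.reg 1) (.reg 11)))
  (.seq (.set 7 (.reg 1)) (.seq (lower 7 (.reg 11))
  (.seq (outInterval (.sub (.add (.arr 14 (.add (.reg 3) (.lit 1))) (.reg 11)) (.reg 7))
    (.add (.arr 14 (.add (.reg 3) (.lit 1))) (.reg 11)))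
  (.seq (.set 1 (.sub (.reg 1) (.reg 11)))
  (.seq (.set 7 (.reg 1)) (.seq (lower 7 (.reg 11))
  (.seq (outInterval (.arr 14 (.add (.reg 3) (.lit 2)))
    (.add (.arr 14 (.add (.reg 3) (.lit 2))) (.reg 7)))
  (.seq (.set 1 (.sub (.reg 1) (.reg 11)))
  (outInterval (.sub (.add (.arr 13 (.add (.reg 2) (.lit 1))) (.reg 4)) (.reg 1))
    (.add (.arr 13 (.add (.reg 2) (.lit 1))) (.reg 4)))))))))))))))))))))

def outAll : SProg := .forN 5 outStep

theorem outStep_run (s : RState) {i : ℕ} (h5 : s.reg 5 = i) :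
    (outStep.run n s).output = s.output ++ encodeIntervals (vertexIntervals (s.arr 13) (s.arr 14)
      (s.reg 11) (s.arr 4 i) (parityClass (s.arr 1 i) (s.arr 2 i)) (s.arr 11 i) i) := by
  unfold outStep outInterval
  simp only [SProg.run, lower_run]
  simp [h5, encodeIntervals, vertexIntervals, parityClass, parityE]

theorem outAll_run (s : RState) : (outAll.run n s).output = s.output ++
    encodeIntervals ((List.range n).flatMap fun i : ℕ => vertexIntervals (s.arr 13) (s.arr 14)
      (s.reg 11) (s.arr 4 i) (parityClass (s.arr 1 i) (s.arr 2 i)) (s.arr 11 i) i) := by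
  obtain ⟨s', hs', hI, -⟩ := SProg.forN_rule (n := n) (r := 5) (P := outStep) (s := s)
    (fun k s' => s'.output = s.output ++
      encodeIntervals ((List.range k).flatMap fun i : ℕ => vertexIntervals (s.arr 13) (s.arr 14)
        (s.reg 11) (s.arr 4 i) (parityClass (s.arr 1 i) (s.arr 2 i)) (s.arr 11 i) i))
    (by simp [encodeIntervals]) (by
      intro i hi s1 hF hI
      rw [outStep_run _ (i := i) (by simp), RState.setReg_output, hI, RState.setReg_arr,
        RState.setReg_reg, if_neg (by decide), hF.arr 13 (by decide), hF.arr 14 (by decide),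
        hF.arr 4 (by decide), hF.arr 1 (by decide), hF.arr 2 (by decide), hF.arr 11 (by decide),
        hF.reg 11 (by decide), List.range_succ, List.flatMap_append, encodeIntervals,
        encodeIntervals, encodeIntervals, List.flatMap_append, List.append_assoc]
      simp)
  unfold outAll
  rw [hs', RState.setReg_output, hI]

def multicolor : SProg :=
  .seq load (.seq adjAll (.seq weightAll (.seq palettes (.seq markHeavy (.seq eliminate
    (.seq colorAll outAll))))))

/-- Three demands above `2m` add up to more than `6m`. -/
theorem heavy_triangleFree {adj : ℕ → ℕ → Prop} {D : ℕ → ℤ} {m : ℤ}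
    (h : ∀ i < n, ∀ j < n, ∀ k < n, cliqueWeight adj D i j k ≤ 6 * m) :
    TriangleFree adj (heavy n D m) := by
  intro i hi j hj k hk hij hik hjk
  simp only [heavy, Finset.mem_filter, Finset.mem_range] at hi hj hk
  have := h i hi.1 j hj.1 k hk.1
  simp only [cliqueWeight, hij, hik, hjk, and_self, if_true] at this
  omega

/-- What the program computes. -/
theorem multicolor_run {P : Layout} {D : ℕ → ℤ} {s : RState} {x y l : ℕ → ℤ} (h0 : s.reg 0 = n)
    (hx : ∀ i < n, s.arr 0 (1 + 5 * i) = x i) (hy : ∀ i < n, s.arr 0 (1 + 5 * i + 1) = y i)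
    (hz : ∀ i < n, s.arr 0 (1 + 5 * i + 2) = P.Z i) (hl : ∀ i < n, s.arr 0 (1 + 5 * i + 3) = l i)
    (hd : ∀ i < n, s.arr 0 (1 + 5 * i + 4) = D i)
    (hX : ∀ i < n, P.X i = 3 * x i + l i) (hY : ∀ i < n, P.Y i = 3 * y i + l i)
    (hv : P.Valid (Finset.range n)) (h11 : ∀ i < n, s.arr 11 i = 0) (hout : s.output = []) :
    ∃ (W m : ℤ) (pal ext : ℤ → ℤ) (col : ℕ → ℤ), m = (W + 5) / 6 ∧
      (∀ i < n, ∀ j < n, ∀ k < n, cliqueWeight P.Adj D i j k ≤ W) ∧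
      (W = 0 ∨ ∃ i < n, ∃ j < n, ∃ k < n, W = cliqueWeight P.Adj D i j k) ∧
      Palettes m pal ext ∧
      (∀ i ∈ heavy n D m, col i = 1 ∨ col i = 2 ∨ col i = 3) ∧
      (∀ i ∈ heavy n D m, ∀ j ∈ heavy n D m, P.Adj i j → col i ≠ col j) ∧
      (multicolor.run n s).output = encodeIntervals ((List.range n).flatMap fun i =>
        vertexIntervals pal ext m (D i) (parityClass (P.X i) (P.Y i)) (col i) i) := by
  unfold multicolor
  simp only [SProg.run_seq]
  have l1 := load_run h0 hx hy hz hl hd hX hY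
  have f1 := SProg.frame_run n load s
  set s1 := load.run n s
  have f2 := SProg.frame_run n adjAll s1
  have t2 := adjAll_run l1 hv
  have l2 := l1.frame f2 (by decide) (by decide)
  set s2 := adjAll.run n s1
  have f3 := SProg.frame_run n weightAll s2
  obtain ⟨hW, hW'⟩ := weightAll_run t2 l2.d
  have t3 := t2.frame f3 (by decide) (by decide) (by decide)
  have l3 := l2.frame f3 (by decide) (by decide)
  set s3 := weightAll.run n s2
  have f4 := SProg.frame_run n palettes s3
  obtain ⟨hm, hp⟩ := palettes_run (n := n) s3
  have t4 := t3.frame f4 (by decide) (by decide) (by decide)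
  have l4 := l3.frame f4 (by decide) (by decide)
  set s4 := palettes.run n s3
  set m := (s3.reg 10 + 5) / 6 with hmdef
  have f5 := SProg.frame_run n markHeavy s4
  obtain ⟨k5, c5⟩ := markHeavy_run hm l4.d
  have t5 := t4.frame f5 (by decide) (by decide) (by decide)
  have l5 := l4.frame f5 (by decide) (by decide)
  set s5 := markHeavy.run n s4
  have f6 := SProg.frame_run n eliminate s5
  have hsub : heavy n D m ⊆ Finset.range n := Finset.filter_subset _ _
  -- Validity and triangle-freeness pass to subsets, so the geometric lemma applies to whatever the
  -- elimination has left.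
  obtain ⟨cp, L, h6, hal⟩ := eliminate_run t5 k5 c5 (by
    intro A hA hne hdeg
    have htf : TriangleFree P.Adj (heavy n D m) := heavy_triangleFree fun i hi j hj k hk => by
      have := hW i hi j hj k hk; omega
    obtain ⟨u, hu, b, hb, h1, h2, h3⟩ := exists_reducible hne (hv.mono (hA.trans hsub))
      (fun i hi j hj k hk => htf i (hA hi) j (hA hj) k (hA hk)) hdeg
    exact ⟨u, b, hu, hb, h1, h2, h3⟩)
  have l6 := l5.frame f6 (by decide) (by decide)
  set s6 := eliminate.run n s5
  have f7 := SProg.frame_run n colorAll s6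
  obtain ⟨col, hcol, hc1, hc2⟩ := colorAll_run (fun i j h => h.symm) (fun i h => h.ne rfl) h6 hal
    k5.lt (fun i hi => by
      rw [f6.arr 11 (by decide), f5.arr 11 (by decide), f4.arr 11 (by decide),
        f3.arr 11 (by decide), f2.arr 11 (by decide), f1.arr 11 (by decide), h11 i hi])
  have l7 := l6.frame f7 (by decide) (by decide)
  set s7 := colorAll.run n s6
  have hout7 : s7.output = [] := by
    rw [f7.output (by decide), f6.output (by decide), f5.output (by decide),
      f4.output (by decide), f3.output (by decide), f2.output (by decide),
      f1.output (by decide), hout]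
  refine ⟨s3.reg 10, m, s4.arr 13, s4.arr 14, col, rfl, hW, hW', hp, hc1, hc2, ?_⟩
  rw [outAll_run, hout7, List.nil_append, f7.arr 13 (by decide), f6.arr 13 (by decide),
    f5.arr 13 (by decide), f7.arr 14 (by decide), f6.arr 14 (by decide),
    f5.arr 14 (by decide), f7.reg 11 (by decide), f6.reg 11 (by decide),
    f5.reg 11 (by decide), hm]
  congr 1
  refine List.flatMap_congr fun i hi => ?_
  have hi' : i < n := by simpa using hi
  rw [l7.d i hi', l7.x i hi', l7.y i hi', hcol i hi']

end

end Cannonball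

namespace Cannonball

open scoped Classical

/-! ## The coloring -/

theorem mem_colorsAt {L : List ColorInterval} {i : ℕ} {x : ℤ} :
    x ∈ colorsAt L i ↔ ∃ t ∈ L, t.vertex = i ∧ t.lo ≤ x ∧ x < t.hi := by
  unfold colorsAt
  induction L with
  | nil => simp
  | cons t L ih =>
    rw [List.foldr_cons]
    split_ifs with h
    · simp [ih, h]
    · simp [ih, h]

theorem mem_colorsAt_flatMap {n : ℕ} {pal ext : ℤ → ℤ} {m : ℤ} {D c e : ℕ → ℤ} {i : ℕ}
    (hi : i < n) {x : ℤ} :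
    x ∈ colorsAt ((List.range n).flatMap fun i =>
        vertexIntervals pal ext m (D i) (c i) (e i) i) i ↔
      ∃ t ∈ vertexIntervals pal ext m (D i) (c i) (e i) i, t.lo ≤ x ∧ x < t.hi := by
  rw [mem_colorsAt]
  constructor
  · rintro ⟨t, ht, hti, hx⟩
    obtain ⟨j, -, htj⟩ := List.mem_flatMap.1 ht
    have : t.vertex = j := by
      simp only [vertexIntervals, List.mem_cons, List.not_mem_nil, or_false] at htj
      rcases htj with rfl | rfl | rfl | rfl | rfl <;> rfl
    obtain rfl : j = i := this.symm.trans hti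
    exact ⟨t, htj, hx⟩
  · rintro ⟨t, ht, hx⟩
    refine ⟨t, List.mem_flatMap.2 ⟨i, by simpa using hi, ht⟩, ?_, hx⟩
    simp only [vertexIntervals, List.mem_cons, List.not_mem_nil, or_false] at ht
    rcases ht with rfl | rfl | rfl | rfl | rfl <;> rfl

/-- The color `x` belongs to one of the intervals of a vertex. -/
def HasColor (pal ext : ℤ → ℤ) (m d c e x : ℤ) : Prop :=
  pal c ≤ x ∧ x < pal c + min d (m + m) ∨
  ext e ≤ x ∧ x < ext e + min (d - (m + m)) m ∨
  ext (e + 1) + m - min (d - (m + m) - m) m ≤ x ∧ x < ext (e + 1) + m ∨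
  ext (e + 2) ≤ x ∧ x < ext (e + 2) + min (d - (m + m) - m - m) m ∨
  pal (c + 1) + (m + m) - (d - (m + m) - m - m - m) ≤ x ∧ x < pal (c + 1) + (m + m)

theorem hasColor_iff {pal ext : ℤ → ℤ} {m d c e x : ℤ} {i : ℕ} :
    (∃ t ∈ vertexIntervals pal ext m d c e i, t.lo ≤ x ∧ x < t.hi) ↔
      HasColor pal ext m d c e x := by
  simp [vertexIntervals, HasColor]

/-- The intervals of a vertex in terms of the numbers of its palettes. -/
theorem Palettes.pal_eq {m : ℤ} {pal ext : ℤ → ℤ} (h : Palettes m pal ext) {c : ℤ}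
    (hc : 0 ≤ c) (hc' : c < 4) :
    c = 0 ∧ pal c = 0 ∧ pal (c + 1) = 2 * m ∨ c = 1 ∧ pal c = 2 * m ∧ pal (c + 1) = 4 * m ∨
    c = 2 ∧ pal c = 4 * m ∧ pal (c + 1) = 6 * m ∨ c = 3 ∧ pal c = 6 * m ∧ pal (c + 1) = 0 := by
  obtain ⟨h0, h1, h2, h3, h4, -, -, -, -, -⟩ := h
  have : c = 0 ∨ c = 1 ∨ c = 2 ∨ c = 3 := by omega
  rcases this with rfl | rfl | rfl | rfl <;> norm_num [h0, h1, h2, h3, h4]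

theorem Palettes.ext_eq {m : ℤ} {pal ext : ℤ → ℤ} (h : Palettes m pal ext) {e : ℤ}
    (he : e = 1 ∨ e = 2 ∨ e = 3) :
    e = 1 ∧ ext e = 8 * m ∧ ext (e + 1) = 9 * m ∧ ext (e + 2) = 10 * m ∨
    e = 2 ∧ ext e = 9 * m ∧ ext (e + 1) = 10 * m ∧ ext (e + 2) = 8 * m ∨
    e = 3 ∧ ext e = 10 * m ∧ ext (e + 1) = 8 * m ∧ ext (e + 2) = 9 * m := by
  obtain ⟨-, -, -, -, -, h1, h2, h3, h4, h5⟩ := h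
  rcases he with rfl | rfl | rfl <;> norm_num [h1, h2, h3, h4, h5]

/-- A vertex that is not heavy only gets colors of its palette. -/
theorem HasColor.light {pal ext : ℤ → ℤ} {m d c e x : ℤ} (h : HasColor pal ext m d c e x)
    (hm : 0 ≤ m) (hd : d ≤ m + m) : pal c ≤ x ∧ x < pal c + d := by
  unfold HasColor at h
  omega

/-- At most `m` colors are borrowed from the next class, because `d - 5m ≤ m`; they stay inside that
palette. -/
theorem HasColor.bounds {pal ext : ℤ → ℤ} {m d c e x : ℤ} (h : HasColor pal ext m d c e x)
    (hp : Palettes m pal ext) (hm : 0 ≤ m) (hd : d ≤ 6 * m) (hc : 0 ≤ c) (hc' : c < 4)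
    (he : m + m < d → e = 1 ∨ e = 2 ∨ e = 3) : 0 ≤ x ∧ x < 11 * m := by
  have hpal := hp.pal_eq hc hc'
  by_cases hl : d ≤ m + m
  · have := h.light hm hl
    omega
  · have hext := hp.ext_eq (he (by omega))
    unfold HasColor at h
    rcases h with h | h | h | h | h <;> omega

theorem not_hasColor_both_light {pal ext : ℤ → ℤ} {m d d' c c' e e' x : ℤ}
    (hp : Palettes m pal ext) (hm : 0 ≤ m) (hc : 0 ≤ c) (hc4 : c < 4) (hc' : 0 ≤ c')
    (hc4' : c' < 4) (hcc : c ≠ c') (hd : d ≤ m + m) (hd' : d' ≤ m + m)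
    (h : HasColor pal ext m d c e x) (h' : HasColor pal ext m d' c' e' x) : False := by
  have h1 := h.light hm hd
  have h2 := h'.light hm hd'
  have := hp.pal_eq hc hc4
  have := hp.pal_eq hc' hc4'
  omega

/-- Only the borrowed colors can collide. They are the top `d - 5m` of a palette whose light vertex
uses the bottom `d'`, and `d - 5m + d' ≤ m`. -/
theorem not_hasColor_heavy_light {pal ext : ℤ → ℤ} {m d d' c c' e e' x : ℤ}
    (hp : Palettes m pal ext) (hm : 0 ≤ m) (hc : 0 ≤ c) (hc4 : c < 4) (hc' : 0 ≤ c')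
    (hc4' : c' < 4) (hcc : c ≠ c') (he : e = 1 ∨ e = 2 ∨ e = 3) (hd : m + m < d)
    (hd' : d' ≤ m + m) (hdd : d + d' ≤ 6 * m)
    (h : HasColor pal ext m d c e x) (h' : HasColor pal ext m d' c' e' x) : False := by
  have h2 := h'.light hm hd'
  clear h'
  have h3 := hp.pal_eq hc hc4
  have h4 := hp.pal_eq hc' hc4'
  have h5 := hp.ext_eq he
  unfold HasColor at h
  rcases h with h | h | h | h | h
  · clear h5; omega
  · have : 8 * m ≤ ext e := by omega
    clear h5 h3; omega
  · have : 8 * m ≤ ext (e + 1) := by omega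
    clear h5 h3; omega
  · have : 8 * m ≤ ext (e + 2) := by omega
    clear h5 h3; omega
  · clear h5; omega

/-- For `e' = e + 1` cyclically, the common extra palette is `e + 1`: one vertex takes at most `d -
3m` from its top, the other at most `d' - 2m` from its bottom, and these sum to at most `m`. The
case `e = e' + 1` is symmetric. -/
theorem not_hasColor_both_heavy {pal ext : ℤ → ℤ} {m d d' c c' e e' x : ℤ}
    (hp : Palettes m pal ext) (hm : 0 ≤ m) (hc : 0 ≤ c) (hc4 : c < 4) (hc' : 0 ≤ c')
    (hc4' : c' < 4) (hcc : c ≠ c') (he : e = 1 ∨ e = 2 ∨ e = 3) (he' : e' = 1 ∨ e' = 2 ∨ e' = 3)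
    (hee : e ≠ e') (hd : m + m < d) (hd' : m + m < d') (hdd : d + d' ≤ 6 * m)
    (h : HasColor pal ext m d c e x) (h' : HasColor pal ext m d' c' e' x) : False := by
  -- Either demand is below `4m` because the other exceeds `2m`, so the last two intervals are
  -- empty.
  have aux : ∀ {d c e}, m + m < d → d < 4 * m → HasColor pal ext m d c e x →
      pal c ≤ x ∧ x < pal c + (m + m) ∨ ext e ≤ x ∧ x < ext e + m ∧ x < ext e + d - (m + m) ∨
      ext (e + 1) + m - (d - (m + m) - m) ≤ x ∧ x < ext (e + 1) + m := by
    intro d c e h1 h2 h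
    unfold HasColor at h
    omega
  have h1 := aux hd (by omega) h
  have h2 := aux hd' (by omega) h'
  clear h h' aux
  have h3 := hp.pal_eq hc hc4
  have h4 := hp.pal_eq hc' hc4'
  have h5 := hp.ext_eq he
  have h6 := hp.ext_eq he'
  have p1 : 0 ≤ pal c ∧ pal c ≤ 6 * m := by omega
  have p2 : 0 ≤ pal c' ∧ pal c' ≤ 6 * m := by omega
  have p3 : pal c + (m + m) ≤ pal c' ∨ pal c' + (m + m) ≤ pal c := by omega
  clear h3 h4 hcc
  rcases h5 with ⟨rfl, a1, a2, -⟩ | ⟨rfl, a1, a2, -⟩ | ⟨rfl, a1, a2, -⟩ <;>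
  rcases h6 with ⟨rfl, b1, b2, -⟩ | ⟨rfl, b1, b2, -⟩ | ⟨rfl, b1, b2, -⟩ <;>
  first
  | exact hee rfl
  | (rw [a1, a2] at h1; rw [b1, b2] at h2; clear hee he he'; omega)

theorem parityClass_bounds (a b : ℤ) : 0 ≤ parityClass a b ∧ parityClass a b < 4 := by
  unfold parityClass; omega

/-- Each vector listed in `normNine_eq_nine` has an odd first or second entry. -/
theorem parityClass_ne {a b c a' b' c' : ℤ} (h : normNine (a - a') (b - b') (c - c') = 9) :
    parityClass a b ≠ parityClass a' b' := by
  have := normNine_eq_nine h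
  unfold parityClass
  have h1 : (a - a') % 2 = 1 ∨ (b - b') % 2 = 1 := by omega
  omega

/-- The intervals lie in different palettes, hence are disjoint, and the caps `2m, m, m, m` with the
remainder add up to `d`. -/
theorem le_card_of_hasColor {pal ext : ℤ → ℤ} {m d c e : ℤ} {S : Finset ℤ}
    (hS : ∀ x, HasColor pal ext m d c e x → x ∈ S) (hp : Palettes m pal ext) (hm : 0 ≤ m)
    (hd0 : 0 ≤ d) (hd : d ≤ 6 * m) (hc : 0 ≤ c) (hc' : c < 4)
    (he : m + m < d → e = 1 ∨ e = 2 ∨ e = 3) : d ≤ S.card := by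
  have hpal := hp.pal_eq hc hc'
  by_cases hl : d ≤ m + m
  · have hsub : Finset.Ico (pal c) (pal c + d) ⊆ S := by
      intro x hx
      rw [Finset.mem_Ico] at hx
      exact hS x (Or.inl ⟨hx.1, by rw [min_eq_left hl]; exact hx.2⟩)
    have := Finset.card_le_card hsub
    rw [Int.card_Ico, add_sub_cancel_left] at this
    clear hpal
    omega
  · have hext := hp.ext_eq (he (by omega))
    have q1 : pal c + (m + m) ≤ 8 * m := by omega
    have q2 : pal (c + 1) + (m + m) ≤ 8 * m := by omega
    have q3 : pal c + (m + m) ≤ pal (c + 1) ∨ pal (c + 1) + (m + m) ≤ pal c := by omega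
    have e1 : 8 * m ≤ ext e := by omega
    have e2 : 8 * m ≤ ext (e + 1) := by omega
    have e3 : 8 * m ≤ ext (e + 2) := by omega
    have e12 : ext e + m ≤ ext (e + 1) ∨ ext (e + 1) + m ≤ ext e := by omega
    have e13 : ext e + m ≤ ext (e + 2) ∨ ext (e + 2) + m ≤ ext e := by omega
    have e23 : ext (e + 1) + m ≤ ext (e + 2) ∨ ext (e + 2) + m ≤ ext (e + 1) := by omega
    clear hpal hext he hp
    set I1 := Finset.Ico (pal c) (pal c + min d (m + m)) with h1
    set I2 := Finset.Ico (ext e) (ext e + min (d - (m + m)) m) with h2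
    set I3 := Finset.Ico (ext (e + 1) + m - min (d - (m + m) - m) m) (ext (e + 1) + m) with h3
    set I4 := Finset.Ico (ext (e + 2)) (ext (e + 2) + min (d - (m + m) - m - m) m) with h4
    set I5 := Finset.Ico (pal (c + 1) + (m + m) - (d - (m + m) - m - m - m))
      (pal (c + 1) + (m + m)) with h5
    have hsub : (((I1 ∪ I2) ∪ I3) ∪ I4) ∪ I5 ⊆ S := by
      intro x hx
      simp only [Finset.mem_union, h1, h2, h3, h4, h5, Finset.mem_Ico] at hx
      refine hS x ?_
      unfold HasColor
      simpa only [or_assoc] using hx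
    have b1 : ∀ x ∈ I1, pal c ≤ x ∧ x < pal c + (m + m) := by
      intro x hx; rw [h1, Finset.mem_Ico] at hx; omega
    have b2 : ∀ x ∈ I2, ext e ≤ x ∧ x < ext e + m := by
      intro x hx; rw [h2, Finset.mem_Ico] at hx; omega
    have b3 : ∀ x ∈ I3, ext (e + 1) ≤ x ∧ x < ext (e + 1) + m := by
      intro x hx; rw [h3, Finset.mem_Ico] at hx; omega
    have b4 : ∀ x ∈ I4, ext (e + 2) ≤ x ∧ x < ext (e + 2) + m := by
      intro x hx; rw [h4, Finset.mem_Ico] at hx; omega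
    have b5 : ∀ x ∈ I5, pal (c + 1) ≤ x ∧ x < pal (c + 1) + (m + m) := by
      intro x hx; rw [h5, Finset.mem_Ico] at hx; omega
    have := Finset.card_le_card hsub
    rw [Finset.card_union_of_disjoint, Finset.card_union_of_disjoint,
      Finset.card_union_of_disjoint, Finset.card_union_of_disjoint, h1, h2, h3, h4, h5,
      Int.card_Ico, Int.card_Ico, Int.card_Ico, Int.card_Ico, Int.card_Ico] at this
    · clear q1 q2 q3 e1 e2 e3 e12 e13 e23 hc hc' b1 b2 b3 b4 b5 hsub h1 h2 h3 h4 h5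
      have z1 : ((pal c + min d (m + m) - pal c).toNat : ℤ) = m + m := by omega
      have z2 : ((ext e + min (d - (m + m)) m - ext e).toNat : ℤ) = min (d - (m + m)) m := by
        omega
      omega
    · refine Finset.disjoint_left.2 fun x hx hx' => ?_
      have := b1 x hx; have := b2 x hx'; omega
    · refine Finset.disjoint_left.2 fun x hx hx' => ?_
      have := b3 x hx'
      rcases Finset.mem_union.1 hx with hx | hx
      · have := b1 x hx; omega
      · have := b2 x hx; omega
    · refine Finset.disjoint_left.2 fun x hx hx' => ?_
      have := b4 x hx'
      simp only [Finset.mem_union] at hx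
      rcases hx with (hx | hx) | hx
      · have := b1 x hx; omega
      · have := b2 x hx; omega
      · have := b3 x hx; omega
    · refine Finset.disjoint_left.2 fun x hx hx' => ?_
      have := b5 x hx'
      simp only [Finset.mem_union] at hx
      rcases hx with ((hx | hx) | hx) | hx
      · have := b1 x hx; omega
      · have := b2 x hx; omega
      · have := b3 x hx; omega
      · have := b4 x hx; omega

end Cannonball

namespace Cannonball

open scoped Classical

/-! ## Weighted cannonball graphs -/

/-- Nine times the squared distance is `normNine` of the difference of the scaled coordinates; only
`√3² = 3` and `√6² = 6` are used. -/
theorem grid_adj_iff (A : LayerArrangement) (u v : Site) : A.grid.Adj u v ↔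
    normNine ((3 * u.1 + (A.letter u.2.2 : ℕ)) - (3 * v.1 + (A.letter v.2.2 : ℕ)))
      ((3 * u.2.1 + (A.letter u.2.2 : ℕ)) - (3 * v.2.1 + (A.letter v.2.2 : ℕ)))
      (u.2.2 - v.2.2) = 9 := by
  have h3 : Real.sqrt 3 ^ 2 = 3 := Real.sq_sqrt (by norm_num)
  have h6 : Real.sqrt 6 ^ 2 = 6 := Real.sq_sqrt (by norm_num)
  show dist (A.position u) (A.position v) = 1 ↔ _
  rw [EuclideanSpace.dist_eq, Real.sqrt_eq_one, Fin.sum_univ_three, Real.dist_eq, Real.dist_eq,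
    Real.dist_eq, sq_abs, sq_abs, sq_abs]
  generalize hlu : (A.letter u.2.2 : ℕ) = lu
  generalize hlv : (A.letter v.2.2 : ℕ) = lv
  obtain ⟨x, y, z⟩ := u
  obtain ⟨x', y', z'⟩ := v
  dsimp only at hlu hlv
  simp only [LayerArrangement.position, vecP, vecQ, vecH, hlu, hlv, normNine]
  rw [← Int.cast_inj (α := ℝ)]
  simp
  have key : ∀ a b c a' b' c' p q : ℝ,
      (a + b * 2⁻¹ + (p / 3 + p / 3 * 2⁻¹) - (a' + b' * 2⁻¹ + (q / 3 + q / 3 * 2⁻¹))) ^ 2 +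
      (b * (√3 / 2) + p / 3 * (√3 / 2) - (b' * (√3 / 2) + q / 3 * (√3 / 2))) ^ 2 +
      (c * (√6 / 3) - c' * (√6 / 3)) ^ 2 =
      ((3 * a + p - (3 * a' + q)) ^ 2 + (3 * a + p - (3 * a' + q)) * (3 * b + p - (3 * b' + q)) +
        (3 * b + p - (3 * b' + q)) ^ 2 + 6 * (c - c') ^ 2) / 9 := by
    intro a b c a' b' c' p q
    linear_combination (b / 2 + p / 6 - b' / 2 - q / 6) ^ 2 * h3 + ((c - c') / 3) ^ 2 * h6
  rw [key]
  constructor <;> intro h <;> linarith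

theorem eval_le_eval_of_le (p : Polynomial ℕ) {a b : ℕ} (h : a ≤ b) : p.eval a ≤ p.eval b := by
  rw [Polynomial.eval_eq_sum, Polynomial.eval_eq_sum]
  exact Finset.sum_le_sum fun i _ => Nat.mul_le_mul_left _ (Nat.pow_le_pow_left h i)

theorem length_le_inputSize (w : List ℤ) : w.length ≤ inputSize w := by
  induction w with
  | nil => simp [inputSize]
  | cons a w ih => simp only [inputSize, List.map_cons, List.sum_cons, List.length_cons] at *; omega

theorem getD_flatMap {α : Type} {f : α → List ℤ} {k : ℕ} (hf : ∀ a, (f a).length = k) (L : List α)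
    {i c : ℕ} (hi : i < L.length) (hc : c < k) :
    (L.flatMap f).getD (k * i + c) 0 = (f L[i]).getD c 0 := by
  induction L generalizing i with
  | nil => simp at hi
  | cons a L ih =>
    rw [List.flatMap_cons]
    cases i with
    | zero =>
      rw [List.getD_append _ _ _ _ (by rw [hf]; omega)]
      simp
    | succ i =>
      rw [List.getD_append_right _ _ _ _ (by rw [hf]; nlinarith), hf,
        show k * (i + 1) + c - k = k * i + c by rw [Nat.mul_succ]; omega]
      exact ih (by simpa using hi)

section

variable (G : CannonballGraph) {n : ℕ} (e : Fin n ≃ G.Vertex)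

def siteAt (i : ℕ) : Site := if h : i < n then (e ⟨i, h⟩).1 else 0

theorem siteAt_eq (v : G.Vertex) : siteAt G e (e.symm v) = v.1 := by
  simp [siteAt]

/-- The position of the layer of the `i`-th vertex. -/
def letterAt (i : ℕ) : ℤ := ((G.arrangement.letter (siteAt G e i).2.2 : ℕ) : ℤ)

def layout : Layout where
  X i := 3 * (siteAt G e i).1 + letterAt G e i
  Y i := 3 * (siteAt G e i).2.1 + letterAt G e i
  Z i := (siteAt G e i).2.2

def demandAt (i : ℕ) : ℤ := G.demand (siteAt G e i)

theorem getD_encode {i c : ℕ} (hi : i < n) (hc : c < 5) :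
    (G.encode e).getD (1 + 5 * i + c) 0 = (G.record (e ⟨i, hi⟩)).getD c 0 := by
  rw [CannonballGraph.encode, show 1 + 5 * i + c = 5 * i + c + 1 by ring, List.getD_cons_succ,
    getD_flatMap (k := 5) (fun _ => rfl) _ (by simpa using hi) hc]
  simp

theorem le_inputSize_encode : n ≤ inputSize (G.encode e) := by
  refine le_trans ?_ (length_le_inputSize _)
  have : ∀ L : List G.Vertex, (L.flatMap G.record).length = 5 * L.length := by
    intro L
    induction L with
    | nil => rfl
    | cons a L ih =>
      rw [List.flatMap_cons, List.length_append, ih, List.length_cons]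
      simp only [CannonballGraph.record, List.length_cons, List.length_nil]; ring
  rw [CannonballGraph.encode, List.length_cons, this, List.length_ofFn]
  omega

theorem layout_valid : (layout G e).Valid (Finset.range n) := by
  refine ⟨⟨fun z => ((G.arrangement.letter z : ℕ) : ℤ), fun z h => ?_, fun i _ => ⟨?_, ?_⟩⟩, ?_⟩
  · dsimp only at h
    have h1 := (G.arrangement.letter z).2
    have h2 := (G.arrangement.letter (z + 1)).2
    exact G.arrangement.consecutive_ne z (Fin.ext (by omega))
  · simp [layout, letterAt]
  · simp [layout, letterAt]
  · intro i hi j hj hX hY hZ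
    rw [Finset.mem_range] at hi hj
    simp only [layout, letterAt] at hX hY hZ
    rw [hZ] at hX hY
    have hs : siteAt G e i = siteAt G e j :=
      Prod.ext (by omega) (Prod.ext (by omega) hZ)
    simp only [siteAt, hi, hj, dif_pos] at hs
    exact congrArg Fin.val (e.injective (Subtype.ext hs))

theorem graph_adj_iff (u v : G.Vertex) :
    G.graph.Adj u v ↔ (layout G e).Adj (e.symm u) (e.symm v) := by
  simp only [Layout.Adj, layout, letterAt, siteAt_eq]
  exact grid_adj_iff _ _ _

theorem sum_weight_le_omega {K : Finset G.Vertex} (hK : G.graph.IsClique (K : Set G.Vertex)) :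
    ∑ v ∈ K, G.weight v ≤ G.omega := by
  unfold CannonballGraph.omega weightedCliqueNumber
  refine Finset.le_sup (f := fun K : Finset G.Vertex => ∑ v ∈ K, G.weight v) ?_
  have h : K ∈ Finset.univ.filter fun K : Finset G.Vertex => G.graph.IsClique (K : Set G.Vertex) :=
    Finset.mem_filter.2 ⟨Finset.mem_univ _, hK⟩
  convert h

/-- The weight is that of an actual clique, one of `{u}`, `{u, v}`, `{u, v, w}`, according to which
adjacencies hold. -/
theorem cliqueWeight_le_omega {i j k : ℕ} (hi : i < n) (hj : j < n) (hk : k < n) :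
    ∃ w : ℕ, cliqueWeight (layout G e).Adj (demandAt G e) i j k = w ∧ w ≤ G.omega := by
  obtain ⟨u, rfl⟩ : ∃ u, i = (e.symm u : ℕ) := ⟨e ⟨i, hi⟩, by simp⟩
  obtain ⟨v, rfl⟩ : ∃ u, j = (e.symm u : ℕ) := ⟨e ⟨j, hj⟩, by simp⟩
  obtain ⟨w, rfl⟩ : ∃ u, k = (e.symm u : ℕ) := ⟨e ⟨k, hk⟩, by simp⟩
  simp only [cliqueWeight, demandAt, siteAt_eq, ← graph_adj_iff]
  split_ifs with h1 h2
  · refine ⟨∑ x ∈ {u, v, w}, G.weight x, ?_, sum_weight_le_omega G ?_⟩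
    · rw [Finset.sum_insert (by simp [h1.ne, h2.1.ne]), Finset.sum_pair h2.2.ne]
      simp [CannonballGraph.weight]
    · exact (SimpleGraph.is3Clique_triple_iff.2 ⟨h1, h2⟩).isClique
  · refine ⟨∑ x ∈ {u, v}, G.weight x, ?_, sum_weight_le_omega G ?_⟩
    · rw [Finset.sum_pair h1.ne]
      simp [CannonballGraph.weight]
    · simpa [SimpleGraph.isClique_pair] using fun _ => h1
  · refine ⟨∑ x ∈ {u}, G.weight x, ?_, sum_weight_le_omega G ?_⟩
    · simp [CannonballGraph.weight]
    · simp

end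

/-- The program that computes a multicoloring of a weighted cannonball graph. -/
def program : RProg := .seq (.set 0 (.arr 0 (.lit 0))) multicolor.compile

theorem program_outputs (G : CannonballGraph) {n : ℕ} (e : Fin n ≃ G.Vertex) :
    program.OutputsWithin (G.encode e) ((multicolor.time + 4).eval (inputSize (G.encode e)))
      (multicolor.run n ((RState.init (G.encode e)).setReg 0 n)).output := by
  set s := (RState.init (G.encode e)).setReg 0 n with hs
  obtain ⟨t, ht, hex⟩ := SProg.exec_compile (n := n) (P := multicolor) (by decide) s (by simp [hs])
  -- Reading `n` into register `0` costs three units and the sequencing one, which is the `4` in the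
  -- bound.
  refine ⟨_, _, ?_, RExec.seq (RExec.set _ _ _) (?_ : RExec _ s t _), rfl⟩
  · have := eval_le_eval_of_le multicolor.time (le_inputSize_encode G e)
    simp only [RExpr.cost, Polynomial.eval_add, Polynomial.eval_ofNat]
    omega
  · exact hex

end Cannonball

open Cannonball in
theorem theorem1 :
    ∃ (P : RProg) (T : Polynomial ℕ) (C : ℕ),
      ∀ (G : CannonballGraph) (n : ℕ) (e : Fin n ≃ G.Vertex),
        ∃ l : List ColorInterval,
          P.OutputsWithin (G.encode e) (T.eval (inputSize (G.encode e))) (encodeIntervals l) ∧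
          IsProperMulticoloring G.graph G.weight (fun v => colorsAt l (e.symm v)) ∧
          (numColors (fun v : G.Vertex => colorsAt l (e.symm v)) : ℚ)
            ≤ 11 / 6 * (G.omega : ℚ) + (C : ℚ) := by
  -- From `6m ≤ ω + 5` follows `11m ≤ 11/6 ω + 55/6`, and `55/6 < 10`.
  refine ⟨program, multicolor.time + 4, 10, fun G n e => ?_⟩
  have hin : ∀ (i : ℕ) (hi : i < n) (c : ℕ), c < 5 → ((RState.init (G.encode e)).setReg 0 n).arr 0
      (1 + 5 * i + c) = (G.record (e ⟨i, hi⟩)).getD c 0 := by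
    intro i hi c hc
    rw [← getD_encode G e hi hc, RState.setReg_arr]
    have : (1 + 5 * (i : ℤ) + c).toNat = 1 + 5 * i + c := by omega
    simp only [RState.init, this, true_and]
    rw [if_pos (by omega)]
  have hsite : ∀ i (hi : i < n), siteAt G e i = (e ⟨i, hi⟩).1 := fun i hi => by
    simp [siteAt, hi]
  obtain ⟨W, m, pal, ext, col, hm, hW, hW', hp, hcol, hprop, hout⟩ :=
    multicolor_run (n := n) (P := layout G e) (D := demandAt G e)
      (s := (RState.init (G.encode e)).setReg 0 n)
      (x := fun i => (siteAt G e i).1) (y := fun i => (siteAt G e i).2.1) (l := letterAt G e)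
      (by simp)
      (fun i hi => by simpa [CannonballGraph.record, hsite i hi] using hin i hi 0 (by norm_num))
      (fun i hi => by simpa [CannonballGraph.record, hsite i hi] using hin i hi 1 (by norm_num))
      (fun i hi => by
        simpa [CannonballGraph.record, hsite i hi, layout] using hin i hi 2 (by norm_num))
      (fun i hi => by
        simpa [CannonballGraph.record, hsite i hi, letterAt] using hin i hi 3 (by norm_num))
      (fun i hi => by
        simpa [CannonballGraph.record, hsite i hi, demandAt, CannonballGraph.weight]
          using hin i hi 4 (by norm_num))
      (fun _ _ => rfl) (fun _ _ => rfl) (layout_valid G e) (fun i _ => by simp [RState.init])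
      (by simp [RState.init])
  have hWo : ∃ w : ℕ, W = w ∧ w ≤ G.omega := by
    rcases hW' with h | ⟨i, hi, j, hj, k, hk, h⟩
    · exact ⟨0, h, Nat.zero_le _⟩
    · rw [h]; exact cliqueWeight_le_omega G e hi hj hk
  obtain ⟨w, rfl, hw⟩ := hWo
  have hm0 : 0 ≤ m := by omega
  have hW6 : (w : ℤ) ≤ 6 * m := by omega
  have hD0 : ∀ i, 0 ≤ demandAt G e i := fun i => Int.natCast_nonneg _
  have hD6 : ∀ i < n, demandAt G e i ≤ 6 * m := by
    intro i hi
    -- No point is adjacent to itself, so repeated indices reduce the clique to a single vertex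
    -- here, and to an edge in `hDD`.
    have := hW i hi i hi i hi
    rw [cliqueWeight, if_neg fun h => h.ne rfl] at this
    omega
  have hDD : ∀ i < n, ∀ j < n, (layout G e).Adj i j →
      demandAt G e i + demandAt G e j ≤ 6 * m := by
    intro i hi j hj hij
    have := hW i hi j hj i hi
    rw [cliqueWeight, if_pos hij, if_neg fun h => h.1.ne rfl] at this
    omega
  have hheavy : ∀ i < n, m + m < demandAt G e i → i ∈ heavy n (demandAt G e) m := fun i hi h =>
    Finset.mem_filter.2 ⟨Finset.mem_range.2 hi, h⟩
  have hcls := fun i => parityClass_bounds ((layout G e).X i) ((layout G e).Y i)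
  set l := (List.range n).flatMap fun i => vertexIntervals pal ext m (demandAt G e i)
    (parityClass ((layout G e).X i) ((layout G e).Y i)) (col i) i with hl
  have hmem : ∀ i < n, ∀ x, x ∈ colorsAt l i ↔ HasColor pal ext m (demandAt G e i)
      (parityClass ((layout G e).X i) ((layout G e).Y i)) (col i) x := fun i hi x =>
    (mem_colorsAt_flatMap hi).trans hasColor_iff
  clear_value l
  refine ⟨l, hout ▸ program_outputs G e, ⟨fun v => ?_, fun u v huv => ?_⟩, ?_⟩
  · have hv := (e.symm v).2
    have h := le_card_of_hasColor (fun x hx => (hmem _ hv x).2 hx) hp hm0 (hD0 _) (hD6 _ hv)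
      (hcls (e.symm v)).1 (hcls (e.symm v)).2 (fun h => hcol _ (hheavy _ hv h))
    rw [demandAt, siteAt_eq] at h
    exact_mod_cast h
  · have hu := (e.symm u).2
    have hv := (e.symm v).2
    rw [graph_adj_iff G e] at huv
    have hne := parityClass_ne huv
    have hsum := hDD _ hu _ hv huv
    refine Finset.disjoint_left.2 fun x hx hx' => ?_
    have h1 := (hmem _ hu x).1 hx
    have h2 := (hmem _ hv x).1 hx'
    by_cases c1 : m + m < demandAt G e (e.symm u)
    · by_cases c2 : m + m < demandAt G e (e.symm v)
      · exact not_hasColor_both_heavy hp hm0 (hcls _).1 (hcls _).2 (hcls _).1 (hcls _).2 hne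
          (hcol _ (hheavy _ hu c1)) (hcol _ (hheavy _ hv c2))
          (hprop _ (hheavy _ hu c1) _ (hheavy _ hv c2) huv) c1 c2 hsum h1 h2
      · exact not_hasColor_heavy_light hp hm0 (hcls _).1 (hcls _).2 (hcls _).1 (hcls _).2 hne
          (hcol _ (hheavy _ hu c1)) c1 (not_lt.1 c2) hsum h1 h2
    · by_cases c2 : m + m < demandAt G e (e.symm v)
      · exact not_hasColor_heavy_light hp hm0 (hcls _).1 (hcls _).2 (hcls _).1 (hcls _).2 hne.symm
          (hcol _ (hheavy _ hv c2)) c2 (not_lt.1 c1) (by omega) h2 h1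
      · exact not_hasColor_both_light hp hm0 (hcls _).1 (hcls _).2 (hcls _).1 (hcls _).2 hne
          (not_lt.1 c1) (not_lt.1 c2) h1 h2
  · have hcard : (numColors (fun v : G.Vertex => colorsAt l (e.symm v : ℕ)) : ℤ) ≤ 11 * m := by
      have hsub : (Finset.univ.biUnion fun v : G.Vertex => colorsAt l (e.symm v : ℕ)) ⊆
          Finset.Ico 0 (11 * m) := by
        intro x hx
        obtain ⟨v, -, hx⟩ := Finset.mem_biUnion.1 hx
        have hv := (e.symm v).2
        have h1 := (hmem _ hv x).1 hx
        rw [Finset.mem_Ico]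
        exact h1.bounds hp hm0 (hD6 _ hv) (hcls _).1 (hcls _).2 (fun h => hcol _ (hheavy _ hv h))
      have := Finset.card_le_card hsub
      rw [Int.card_Ico] at this
      unfold numColors
      omega
    have h6 : 6 * m ≤ w + 5 := by omega
    have hq1 := (Int.cast_le (R := ℚ)).2 hcard
    have hq2 := (Int.cast_le (R := ℚ)).2 h6
    have hq3 := (Nat.cast_le (α := ℚ)).2 hw
    push_cast at hq1 hq2 ⊢
    linarith
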